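/- **Setting.** Let $1<\alpha<2$ and $0<r<M$. For $R>0$ let $B_R=\{x\in\mathbb R^2:|x|<R\}$. Fix $x_0\in\mathbb R^2$ with $|x_0|=1$ and a nonnegative $\rho\in C^2_c(\mathbb R^2)$. For $n\ge1$ and $y\in\frac1n\mathbb Z^2$ put $y^{\square}=y+[-\frac1{2n},\frac1{2n}]^2$, and let $R_n$ be the finite set of points $y\in\frac1n\mathbb Z^2$ such that $y\in B_M$, or $y^\square\not\subset B_M$ and $y^\square\cap B_M\ne\emptyset$. For a function $f$ on $\frac1n\mathbb Z^2$, let $f^\square(x)$, $x\in\mathbb R^2$, be the value of $f$ at the unique point of $\frac1n\mathbb Z^2\cap(x-\frac1{2n},x+\frac1{2n}]^2$. *Discrete objects.* With $\mu$ the Lebesgue measure, let $$F_n(y)=n^2\mu\big(y^\square\cap(B_M\setminus B_{r/n})\big),\qquad k_n=\frac{n^{2-\alpha}}4\Big(\int_{B_M}\frac{dy}{|y|^\alpha}-\frac1{n^2}\sum_{y\in R_n\setminus\{0\}}\frac{F_n(y)}{|y|^\alpha}\Big),$$ $$p_n(0)=0,\qquad p_n(y)=c_n\Big(k_n\mathbf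 1_{\{|y|=1/n\}}+\frac{F_n(y)}{n^{2+\alpha}|y|^{2+\alpha}}\Big)\quad (y\in\tfrac1n\mathbb Z^2\setminus\{0\}),$$ where $c_n$ is the normalizing constant for which $\sum_y p_n(y)=1$. Assume that $r,M$ are such that $k_1>0$. Let $$L_{M,n}f(x)=n^\alpha\sum_{y\in R_n}p_n(y)\big(f(x+y)-f(x)\big),\qquad \psi_{M,n}(\theta)=n^\alpha\sum_{y\in R_n}p_n(y)\big(1-\cos(\theta\cdot y)\big),$$ $$G_{M,n}(x)=\frac1{(2\pi)^2}\int_{[-n\pi,n\pi]^2}\frac{\cos(\theta\cdot x)-\cos(\theta\cdot x_0)}{\psi_{M,n}(\theta)}\,d\theta,$$ $$\gamma_n(x)=-\frac{|x|^2}{\sigma_{M,n}^2}-\frac1{n^2}\sum_{y\in\frac1n\mathbb Z^2}G_{M,n}(x-y)\rho(y),\qquad \sigma_{M,n}^2=L_{M,n}|x|^2\big|_{x=0},$$ and, for $x\in\frac1n\mathbb Z^2$, $$s_n(x)=\inf\{f(x): f:\tfrac1n\mathbb Z^2\to\mathbb R,\ L_{M,n}f\le0 \text{ on } \tfrac1n\mathbb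 Z^2,\ f\ge\gamma_n\}.$$ *Continuum objects.* Let $c=\lim_{n\to\infty}c_n$ and $$L_Mf(x)=\frac c2\int_{B_M}\frac{f(x+y)+f(x-y)-2f(x)}{|y|^{2+\alpha}}\,dy,\qquad \psi_M(\theta)=c\int_{B_M}\frac{1-\cos(\theta\cdot y)}{|y|^{2+\alpha}}\,dy,$$ $$G_M(x)=\lim_{R\to\infty}\frac1{(2\pi)^2}\int_{B_R}\frac{\cos(\theta\cdot x)-\cos(\theta\cdot x_0)}{\psi_M(\theta)}\,d\theta\quad(x\neq0),$$ $$\gamma(x)=-\frac{|x|^2}{\sigma_M^2}-\int_{\mathbb R^2}G_M(x-y)\rho(y)\,dy,\qquad \sigma_M^2=c\int_{B_M}\frac{dy}{|y|^\alpha}.$$ A function $f\in L^1_{loc}(\mathbb R^2)$ is called superharmonic if $\int f\,L_M\phi\,dx\le0$ for every nonnegative $\phi\in C_c^\infty(\mathbb R^2)$. Let $$s(x)=\inf\{f(x): f \text{ continuous and superharmonic on } \mathbb R^2,\ f\ge\gamma\}.$$ **Proposition.** These objects are well defined: $(c_n)$ converges to a limit $c>0$; for all large $n$ the integrand defining $G_{M,n}(x)$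 is integrable for every $x$; the limit defining $G_M(x)$ exists for every $x\ne0$; $y\mapsto G_M(x-y)\rho(y)$ is integrable for every $x$; and the infima defining $s$, and $s_n$ for all large $n$, are finite infima over nonempty sets. Moreover $$s_n^\square\longrightarrow s\qquad\text{as } n\to\infty,\ \text{uniformly on compact subsets of }\mathbb R^2.$$ -/

import Mathlib

open Filter Topology MeasureTheory
open scoped ContDiff

noncomputable section

namespace Sandpile

/-- The Euclidean plane. -/
abbrev Plane : Type := EuclideanSpace ℝ (Fin 2)

/-- Index set of the lattices: the point `z / n` of `(1/n) ℤ²` is represented by `z ∈ ℤ²`. A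
function on `(1/n) ℤ²` is thus a function `Idx → ℝ`. -/
abbrev Idx : Type := Fin 2 → ℤ

/-- The point `z / n` of the lattice `(1/n) ℤ²`. -/
def latticePt (n : ℕ) (z : Idx) : Plane := WithLp.toLp 2 (fun i => (z i : ℝ) / n)

/-- The closed square of side `1/n` centred at the lattice point `z / n`. -/
def cell (n : ℕ) (z : Idx) : Set Plane :=
  {x | ∀ i, |x i - (z i : ℝ) / n| ≤ 1 / (2 * n)}

/-- The lattice points of the set `A`. -/
def latticeRestrict (n : ℕ) (A : Set Plane) : Set Idx := {z | latticePt n z ∈ A}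

/-- The discrete boundary of `A`: the lattice points whose square meets `A` without being
contained in `A`. -/
def latticeBoundary (n : ℕ) (A : Set Plane) : Set Idx :=
  {z | ¬ cell n z ⊆ A ∧ (cell n z ∩ A).Nonempty}

/-- The lattice points of the open disc `B_M` together with its discrete boundary. -/
def jumpRange (M : ℝ) (n : ℕ) : Set Idx :=
  latticeRestrict n (Metric.ball 0 M) ∪ latticeBoundary n (Metric.ball 0 M)

/-- The piecewise constant extension of a lattice function to the plane: the value at `x` is the
value at the unique lattice point of `(x - 1/(2n), x + 1/(2n)]²`. -/
def latticeExt (n : ℕ) (f : Idx → ℝ) (x : Plane) : ℝ := f (fun i => ⌊n * x i + 1 / 2⌋)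

/-! ### The jump probabilities and the discrete operator -/

/-- The proportion of the square around `z / n` that lies in the annulus `B_M \ B_{r/n}`. -/
def cellFraction (r M : ℝ) (n : ℕ) (z : Idx) : ℝ :=
  (n : ℝ) ^ 2 * volume.real (cell n z ∩ (Metric.ball 0 M \ Metric.ball 0 (r / n)))

/-- The nearest-neighbour correction `k_n`. -/
def nnConst (α r M : ℝ) (n : ℕ) : ℝ :=
  (n : ℝ) ^ (2 - α) / 4 *
    ((∫ y in Metric.ball (0 : Plane) M, 1 / ‖y‖ ^ α) -
      1 / (n : ℝ) ^ 2 *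
        ∑ᶠ z ∈ jumpRange M n \ {0}, cellFraction r M n z / ‖latticePt n z‖ ^ α)

/-- The unnormalised jump weight of the lattice point `z / n ≠ 0`. -/
def jumpWeight (α r M : ℝ) (n : ℕ) (z : Idx) : ℝ :=
  nnConst α r M n * (if ‖latticePt n z‖ = 1 / n then 1 else 0) +
    cellFraction r M n z / ((n : ℝ) ^ (2 + α) * ‖latticePt n z‖ ^ (2 + α))

/-- The normalising constant `c_n`. -/
def normConst (α r M : ℝ) (n : ℕ) : ℝ :=
  (∑ᶠ z ∈ ({0}ᶜ : Set Idx), jumpWeight α r M n z)⁻¹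

/-- The jump probability `p_n`. -/
def jumpProb (α r M : ℝ) (n : ℕ) (z : Idx) : ℝ :=
  if z = 0 then 0 else normConst α r M n * jumpWeight α r M n z

/-- The discrete truncated fractional Laplacian `L_{M,n}`. -/
def discLap (α r M : ℝ) (n : ℕ) (f : Idx → ℝ) (x : Idx) : ℝ :=
  (n : ℝ) ^ α * ∑ᶠ z ∈ jumpRange M n, jumpProb α r M n z * (f (x + z) - f x)

/-- `σ_{M,n}² = L_{M,n} |x|²` (a constant, evaluated here at the origin). -/
def discSigmaSq (α r M : ℝ) (n : ℕ) : ℝ :=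
  discLap α r M n (fun z => ‖latticePt n z‖ ^ 2) 0

/-- The symbol `ψ_{M,n}` of `-L_{M,n}`. -/
def discSymbol (α r M : ℝ) (n : ℕ) (θ : Plane) : ℝ :=
  (n : ℝ) ^ α *
    ∑ᶠ z ∈ jumpRange M n, jumpProb α r M n z * (1 - Real.cos (inner ℝ θ (latticePt n z)))

/-- The square `[-nπ, nπ]²`. -/
def freqSquare (n : ℕ) : Set Plane := {θ | ∀ i, |θ i| ≤ n * Real.pi}

/-- The discrete Green's function `G_{M,n}`. -/
def discGreen (α r M : ℝ) (x₀ : Plane) (n : ℕ) (x : Plane) : ℝ :=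
  1 / (2 * Real.pi) ^ 2 *
    ∫ θ in freqSquare n,
      (Real.cos (inner ℝ θ x) - Real.cos (inner ℝ θ x₀)) / discSymbol α r M n θ

/-- The discrete obstacle `γ_n`, with `ρ_n` the restriction of `ρ` to the lattice. -/
def discObstacle (α r M : ℝ) (x₀ : Plane) (ρ : Plane → ℝ) (n : ℕ) (z : Idx) : ℝ :=
  -(‖latticePt n z‖ ^ 2 / discSigmaSq α r M n) -
    1 / (n : ℝ) ^ 2 *
      ∑ᶠ w : Idx, discGreen α r M x₀ n (latticePt n z - latticePt n w) * ρ (latticePt n w)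

/-- The superharmonic functions on the lattice above the discrete obstacle. -/
def discAdmissible (α r M : ℝ) (x₀ : Plane) (ρ : Plane → ℝ) (n : ℕ) : Set (Idx → ℝ) :=
  {f | (∀ z, discLap α r M n f z ≤ 0) ∧ ∀ z, discObstacle α r M x₀ ρ n z ≤ f z}

/-- The discrete least superharmonic majorant `s_n`. -/
def discMajorant (α r M : ℝ) (x₀ : Plane) (ρ : Plane → ℝ) (n : ℕ) (z : Idx) : ℝ :=
  sInf ((fun f => f z) '' discAdmissible α r M x₀ ρ n)

/-! ### The continuum objects -/

/-- The constant `c = lim c_n`. -/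
def limConst (α r M : ℝ) : ℝ := limUnder atTop (normConst α r M)

/-- The truncated fractional Laplacian `L_M`, on functions for which the integral makes sense. -/
def truncLap (α r M : ℝ) (f : Plane → ℝ) (x : Plane) : ℝ :=
  limConst α r M / 2 *
    ∫ y in Metric.ball (0 : Plane) M, (f (x + y) + f (x - y) - 2 * f x) / ‖y‖ ^ (2 + α)

/-- `σ_M² = c ∫_{B_M} |y|^{-α} dy`. -/
def sigmaSq (α r M : ℝ) : ℝ :=
  limConst α r M * ∫ y in Metric.ball (0 : Plane) M, 1 / ‖y‖ ^ α

/-- The symbol `ψ_M` of `-L_M`. -/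
def symbol (α r M : ℝ) (θ : Plane) : ℝ :=
  limConst α r M *
    ∫ y in Metric.ball (0 : Plane) M, (1 - Real.cos (inner ℝ θ y)) / ‖y‖ ^ (2 + α)

/-- The integral defining the Green's function, cut off at frequency `R`. -/
def cutoffGreen (α r M : ℝ) (x₀ : Plane) (R : ℝ) (x : Plane) : ℝ :=
  1 / (2 * Real.pi) ^ 2 *
    ∫ θ in Metric.ball (0 : Plane) R,
      (Real.cos (inner ℝ θ x) - Real.cos (inner ℝ θ x₀)) / symbol α r M θ

/-- The Green's function `G_M`. Its defining integral over the plane converges only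
conditionally, and is read as the limit of the integrals over the discs `B_R`. -/
def green (α r M : ℝ) (x₀ : Plane) (x : Plane) : ℝ :=
  limUnder atTop (fun R : ℝ => cutoffGreen α r M x₀ R x)

/-- The continuum obstacle `γ`. -/
def obstacle (α r M : ℝ) (x₀ : Plane) (ρ : Plane → ℝ) (x : Plane) : ℝ :=
  -(‖x‖ ^ 2 / sigmaSq α r M) - ∫ y, green α r M x₀ (x - y) * ρ y

/-- Superharmonicity in the sense of distributions, on an open set `U`, with respect to `L_M`. -/
def IsSuperharmonicOn (α r M : ℝ) (f : Plane → ℝ) (U : Set Plane) : Prop :=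
  LocallyIntegrable f volume ∧
    ∀ φ : Plane → ℝ, ContDiff ℝ ∞ φ → HasCompactSupport φ → (∀ x, 0 ≤ φ x) → tsupport φ ⊆ U →
      ∫ x, f x * truncLap α r M φ x ≤ 0

/-- The continuous superharmonic functions above the obstacle. -/
def admissible (α r M : ℝ) (x₀ : Plane) (ρ : Plane → ℝ) : Set (Plane → ℝ) :=
  {f | Continuous f ∧ IsSuperharmonicOn α r M f Set.univ ∧ ∀ x, obstacle α r M x₀ ρ x ≤ f x}

/-- The least superharmonic majorant `s`. -/
def majorant (α r M : ℝ) (x₀ : Plane) (ρ : Plane → ℝ) (x : Plane) : ℝ :=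
  sInf ((fun f => f x) '' admissible α r M x₀ ρ)

end Sandpile

end

noncomputable section

namespace Sandpile

/-! ### Rounding to the lattice -/

/-! Every limit point of the discrete majorants is shown to be the least element of the continuum
admissible class. A least element is unique and the majorants are precompact, so this gives
convergence, and also that `s` is a finite infimum attained by a single function. Four ingredients
enter.

Operators. After scaling by `n`, `k_n` is a quarter of the integral over `B_{nM}` of one fixed
integrable function (`nnConst_eq`), so it converges; its limit is positive because the singular
central cell outweighs all the others (`nnLim_pos`). Hence `c_n → c > 0`. The correction `k_n` makes
the second moment of the jumps exact (`discSigmaSq_eq`) and is negligible on functions with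
quadratically bounded second differences, for which the discrete operators converge even at moving
points (`tendsto_discLap`). On the frequency side the symbols are bounded below by a multiple of
`min (|θ|²) (|θ|^α)` and have a centred Lipschitz modulus, uniformly in `n` (`exists_symbolBound`).

Obstacles. The integral defining the continuum Green function converges only conditionally. Write
`1/ψ = 1/(ψ(1+ψ)) + 1/(1+ψ)`. The first term, against a numerator vanishing to second order at the
origin, is absolutely integrable because `2α > 2`. In the second, translating `θ` by `±b` with `b·x
= π/2` turns the cosine into sines and the resolvent `1/(1+ψ)` into a difference of size
`|θ|^{-(1+α)}`, up to boundary terms that vanish in the limit (`tendsto_oscillatory`). Against the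
Fourier transform of `ρ`, which decays like `|θ|^{-2}`, the second term converges absolutely too.
The same limit formula serves lattice and continuum, so the obstacles converge along convergent
lattice points (`tendsto_discObstacle`). The discrete potentials are moreover uniformly Lipschitz
and solve the discrete Poisson equation.

Fixed scale. Since `L_n γ_n = ρ - 1`, adding a multiple of the barrier `(T - √(1+|x|²))₊²` makes
`γ_n` superharmonic (`exists_obstacleBound`). So `s_n` is finite, `s_n - γ_n` is bounded, and `s_n =
γ_n` outside a ball independent of `n`. Translating the problem bounds `s_n` locally in the
Lipschitz norm (`ObstacleBound.majorant_sub_le`), and the contact far out localises the comparison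
principle (`ObstacleBound.majorant_le_of_local`).

Limit. Along an ultrafilter `s_n` converges to a locally Lipschitz `σ ≥ γ`, and discrete summation
by parts makes `σ` superharmonic (`isSuperharmonicOn_limit`). Conversely, a continuous superharmonic
`f ≥ γ` is mollified until `L_M` is pointwise nonpositive, then perturbed by a small multiple of
`|x|²` to become discretely superharmonic on a large disc; comparison gives `limsup s_n ≤ f`
(`eventually_majorant_le`). So `σ` is the least admissible function, whatever the ultrafilter. -/

/-- The index of the lattice point nearest to `x`. -/
def rnd (n : ℕ) (x : Plane) : Idx := fun i => ⌊n * x i + 1 / 2⌋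

/-- The lattice point nearest to `x`. -/
def rp (n : ℕ) (x : Plane) : Plane := latticePt n (rnd n x)

@[simp] lemma latticePt_apply (n : ℕ) (z : Idx) (i : Fin 2) : latticePt n z i = (z i : ℝ) / n := rfl

lemma latticeExt_eq (n : ℕ) (f : Idx → ℝ) (x : Plane) : latticeExt n f x = f (rnd n x) := rfl

@[simp] lemma latticePt_zero (n : ℕ) : latticePt n 0 = 0 := by
  ext i; simp

lemma latticePt_add (n : ℕ) (z w : Idx) : latticePt n (z + w) = latticePt n z + latticePt n w := by
  ext i; simp [add_div]

lemma latticePt_neg (n : ℕ) (z : Idx) : latticePt n (-z) = -latticePt n z := by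
  ext i; simp [neg_div]

lemma latticePt_sub (n : ℕ) (z w : Idx) : latticePt n (z - w) = latticePt n z - latticePt n w := by
  ext i; simp [sub_div]

lemma norm_sq_plane (x : Plane) : ‖x‖ ^ 2 = x 0 ^ 2 + x 1 ^ 2 := by
  rw [EuclideanSpace.norm_sq_eq]; simp

lemma inner_plane (x y : Plane) : inner ℝ x y = x 0 * y 0 + x 1 * y 1 := by
  simp [PiLp.inner_apply, mul_comm]

lemma abs_apply_le_norm (x : Plane) (i : Fin 2) : |x i| ≤ ‖x‖ := by
  have := PiLp.norm_apply_le x i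
  simpa using this

lemma abs_rnd_sub_le {n : ℕ} (hn : 0 < n) (x : Plane) (i : Fin 2) :
    |x i - (rnd n x i : ℝ) / n| ≤ 1 / (2 * n) := by
  have h1 := Int.floor_le ((n : ℝ) * x i + 1 / 2)
  have h2 := Int.lt_floor_add_one ((n : ℝ) * x i + 1 / 2)
  have hn' : (0 : ℝ) < n := by exact_mod_cast hn
  change |x i - ((⌊(n : ℝ) * x i + 1 / 2⌋ : ℤ) : ℝ) / n| ≤ _
  set k : ℝ := ((⌊(n : ℝ) * x i + 1 / 2⌋ : ℤ) : ℝ)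
  have e : x i - k / n = (n * x i - k) / n := by field_simp
  rw [e, abs_div, abs_of_pos hn', div_le_div_iff₀ hn' (by positivity)]
  have : |n * x i - k| ≤ 1 / 2 := by
    rw [abs_le]; constructor <;> linarith
  nlinarith

lemma norm_sq_sub_rp_le {n : ℕ} (hn : 0 < n) (x : Plane) : ‖x - rp n x‖ ^ 2 ≤ 1 / (2 * n ^ 2) := by
  have hn' : (0 : ℝ) < n := by exact_mod_cast hn
  have h : ∀ i, (x i - (rnd n x i : ℝ) / n) ^ 2 ≤ (1 / (2 * n)) ^ 2 := fun i => by
    rw [← sq_abs]; gcongr; exact abs_rnd_sub_le hn x i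
  rw [norm_sq_plane]
  simp only [rp, PiLp.sub_apply, latticePt_apply]
  calc _ ≤ (1 / (2 * (n : ℝ))) ^ 2 + (1 / (2 * (n : ℝ))) ^ 2 := add_le_add (h 0) (h 1)
    _ = _ := by field_simp; norm_num

lemma norm_sub_rp_le {n : ℕ} (hn : 0 < n) (x : Plane) : ‖x - rp n x‖ ≤ 1 / n := by
  have hn' : (0 : ℝ) < n := by exact_mod_cast hn
  apply le_of_sq_le_sq _ (by positivity)
  refine (norm_sq_sub_rp_le hn x).trans ?_
  rw [div_pow, one_pow]
  gcongr
  nlinarith [sq_nonneg (n : ℝ)]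

lemma rp_tendsto {φ : ℕ → ℕ} (hφ : Tendsto φ atTop atTop) (x : Plane) :
    Tendsto (fun k => rp (φ k) x) atTop (𝓝 x) := by
  rw [tendsto_iff_norm_sub_tendsto_zero]
  have h1 : Tendsto (fun k => 1 / ((φ k : ℕ) : ℝ)) atTop (𝓝 0) :=
    tendsto_one_div_atTop_nhds_zero_nat.comp hφ
  refine tendsto_of_tendsto_of_tendsto_of_le_of_le' tendsto_const_nhds h1
    (Eventually.of_forall fun _ => norm_nonneg _) ?_
  filter_upwards [hφ.eventually_gt_atTop 0] with k hk
  rw [norm_sub_rev]; exact norm_sub_rp_le hk x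

lemma measurable_rnd (n : ℕ) : Measurable (rnd n) := by
  refine measurable_pi_lambda _ fun i => ?_
  exact Int.measurable_floor.comp (by fun_prop)

lemma measurable_comp_rnd (n : ℕ) {β : Type*} [MeasurableSpace β] (f : Idx → β) :
    Measurable fun x => f (rnd n x) :=
  (measurable_of_countable f).comp (measurable_rnd n)

lemma measurable_rp (n : ℕ) : Measurable (rp n) := measurable_comp_rnd n _

lemma norm_latticePt_ge {n : ℕ} (hn : 0 < n) {z : Idx} (hz : z ≠ 0) : 1 / n ≤ ‖latticePt n z‖ := by
  have hn' : (0 : ℝ) < n := by exact_mod_cast hn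
  obtain ⟨i, hi⟩ := Function.ne_iff.1 hz
  refine le_trans ?_ (abs_apply_le_norm _ i)
  rw [latticePt_apply, abs_div, abs_of_pos hn']
  gcongr
  rw [← Int.cast_abs]
  exact_mod_cast (Int.one_le_abs hi : (1 : ℤ) ≤ |z i|)

/-- The half-diagonal of a cell is `1/(√2 n)` and a nonzero lattice point has norm at least `1/n`;
`3/4` is a rational bound for `1/√2`. Any factor below `1` makes `‖x‖` and `‖rp n x‖` comparable off
the central cell. -/
lemma norm_sub_rp_le_mul {n : ℕ} (hn : 0 < n) {x : Plane} (hx : rnd n x ≠ 0) :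
    ‖x - rp n x‖ ≤ 3 / 4 * ‖rp n x‖ := by
  have hn' : (0 : ℝ) < n := by exact_mod_cast hn
  apply le_of_sq_le_sq _ (by positivity)
  have h := norm_latticePt_ge hn hx
  have h2 : (1 / (n : ℝ)) ^ 2 ≤ ‖rp n x‖ ^ 2 := by gcongr; exact h
  refine (norm_sq_sub_rp_le hn x).trans ?_
  have e : 1 / (2 * (n : ℝ) ^ 2) = (1 / 2) * (1 / n) ^ 2 := by field_simp
  rw [e]; nlinarith

lemma norm_rp_le_mul {n : ℕ} (hn : 0 < n) {x : Plane} (hx : rnd n x ≠ 0) : ‖rp n x‖ ≤ 4 * ‖x‖ := by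
  have h1 := norm_sub_rp_le_mul hn hx
  have h2 := norm_le_insert' (rp n x) x
  rw [norm_sub_rev] at h2
  linarith

lemma norm_le_mul_norm_rp {n : ℕ} (hn : 0 < n) {x : Plane} (hx : rnd n x ≠ 0) :
    ‖x‖ ≤ 2 * ‖rp n x‖ := by
  have h1 := norm_sub_rp_le_mul hn hx
  have h2 := norm_le_insert' x (rp n x)
  nlinarith [norm_nonneg (rp n x)]

lemma rnd_mem_cell {n : ℕ} (hn : 0 < n) (x : Plane) : x ∈ cell n (rnd n x) :=
  fun i => abs_rnd_sub_le hn x i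

lemma volume_hyperplane (i : Fin 2) (c : ℝ) : volume {x : Plane | x i = c} = 0 := by
  have h := (PiLp.volume_preserving_ofLp (Fin 2)).measure_preimage
    (s := {x : Fin 2 → ℝ | x i = c})
    (measurableSet_eq_fun (measurable_pi_apply i) measurable_const).nullMeasurableSet
  have h2 := Measure.pi_hyperplane (fun _ : Fin 2 => (volume : Measure ℝ)) i c
  rw [← volume_pi] at h2
  rw [h2] at h
  exact h

/-- The closed square and the half-open one picked out by the floor differ only on the faces `x i =
z i / n + 1/(2n)`, which are null. -/
lemma cell_ae_eq {n : ℕ} (hn : 0 < n) (z : Idx) : cell n z =ᵐ[volume] {x | rnd n x = z} := by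
  have hn' : (0 : ℝ) < n := by exact_mod_cast hn
  have h0 : ∀ᵐ x : Plane, ∀ i, x i ≠ (z i : ℝ) / n + 1 / (2 * n) := by
    rw [ae_all_iff]; intro i
    rw [ae_iff]; simpa using volume_hyperplane i _
  filter_upwards [h0] with x hx
  refine propext ⟨fun h => ?_, fun h => ?_⟩
  · funext i
    have h1 := abs_le.1 (h i)
    have h2 := hx i
    have h3 : x i < (z i : ℝ) / n + 1 / (2 * n) := lt_of_le_of_ne (by linarith [h1.2]) h2
    have e1 : (n : ℝ) * ((z i : ℝ) / n + 1 / (2 * n)) = z i + 1 / 2 := by field_simp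
    have e2 : (n : ℝ) * ((z i : ℝ) / n - 1 / (2 * n)) = z i - 1 / 2 := by field_simp
    change ⌊_⌋ = _
    rw [Int.floor_eq_iff]
    have h4 : (n : ℝ) * x i < z i + 1 / 2 := by rw [← e1]; gcongr
    have h5 : (z i : ℝ) - 1 / 2 ≤ (n : ℝ) * x i := by rw [← e2]; gcongr; linarith [h1.1]
    constructor <;> linarith
  · have : rnd n x = z := h
    rw [← this]; exact rnd_mem_cell hn x

lemma measurableSet_rnd_eq (n : ℕ) (z : Idx) : MeasurableSet {x | rnd n x = z} :=
  (measurable_rnd n) (measurableSet_singleton z)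

lemma measureReal_cell_inter {n : ℕ} (hn : 0 < n) (z : Idx) (A : Set Plane) :
    volume.real (cell n z ∩ A) = volume.real ({x | rnd n x = z} ∩ A) :=
  measureReal_congr ((cell_ae_eq hn z).inter (ae_eq_refl A))

/-- A weighted sum over the squares is the integral of the rounded function. -/
lemma sum_volume_cell {n : ℕ} (hn : 0 < n) {A : Set Plane} (hA : MeasurableSet A)
    (hA' : volume A ≠ ⊤) (S : Finset Idx) (hS : ∀ x ∈ A, rnd n x ∈ S) (g : Idx → ℝ) :
    ∑ z ∈ S, volume.real (cell n z ∩ A) * g z = ∫ x in A, g (rnd n x) := by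
  have e : ∀ x ∈ A, g (rnd n x) = ∑ z ∈ S, Set.indicator {x | rnd n x = z} (fun _ => g z) x := by
    intro x hx
    rw [Finset.sum_eq_single (rnd n x)]
    · simp
    · intro b _ hb
      exact Set.indicator_of_notMem (fun h => hb (Eq.symm h)) _
    · intro h; exact absurd (hS x hx) h
  rw [setIntegral_congr_fun hA e, integral_finsetSum]
  · refine Finset.sum_congr rfl fun z _ => ?_
    rw [integral_indicator_const _ (measurableSet_rnd_eq n z), smul_eq_mul,
      measureReal_cell_inter hn]
    congr 1
    rw [measureReal_def, measureReal_def, Measure.restrict_apply (measurableSet_rnd_eq n z)]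
  · intro z _
    have : IsFiniteMeasure (volume.restrict A) := ⟨by simpa using hA'.lt_top⟩
    exact (integrable_const _).indicator (measurableSet_rnd_eq n z)

/-! ### Radial integrals -/

lemma finrank_plane : Module.finrank ℝ Plane = 2 := by simp

lemma integrable_radial_iff {f : ℝ → ℝ} :
    Integrable (fun x : Plane => f ‖x‖) ↔ IntegrableOn (fun s => s * f s) (Set.Ioi 0) := by
  have := integrable_fun_norm_addHaar (E := Plane) volume (f := f)
  simpa [finrank_plane] using this

lemma integral_radial (f : ℝ → ℝ) :
    ∫ x : Plane, f ‖x‖ = 2 * Real.pi * ∫ s in Set.Ioi (0 : ℝ), s * f s := by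
  have := integral_fun_norm_addHaar (E := Plane) volume f
  rw [this]
  simp [measureReal_def, EuclideanSpace.volume_ball_fin_two, Real.pi_pos.le]
  ring

lemma integrableOn_ball_rpow {p : ℝ} (hp : p < 2) (R : ℝ) :
    IntegrableOn (fun x : Plane => ‖x‖ ^ (-p)) (Metric.ball 0 R) := by
  rcases le_or_gt R 0 with hR | hR
  · rw [Metric.ball_eq_empty.2 hR]; exact integrableOn_empty
  rw [← integrable_indicator_iff Metric.isOpen_ball.measurableSet]
  have e : (Metric.ball (0 : Plane) R).indicator (fun x => ‖x‖ ^ (-p)) =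
      fun x => (Set.Iio R).indicator (fun s => s ^ (-p)) ‖x‖ := by
    funext x; simp [Set.indicator]
  rw [e, integrable_radial_iff]
  have h := (intervalIntegral.intervalIntegrable_rpow' (a := 0) (b := R) (r := 1 - p)
    (by linarith))
  rw [intervalIntegrable_iff_integrableOn_Ioo_of_le hR.le] at h
  rw [← integrable_indicator_iff measurableSet_Ioi]
  rw [← integrable_indicator_iff measurableSet_Ioo] at h
  refine h.congr (Eventually.of_forall fun s => ?_)
  by_cases h1 : 0 < s <;> by_cases h2 : s < R <;> simp [Set.indicator, h1, h2]
  rw [sub_eq_add_neg, Real.rpow_add h1, Real.rpow_one]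

lemma integral_ball_rpow {p : ℝ} (hp : p < 2) {R : ℝ} (hR : 0 ≤ R) :
    ∫ x in Metric.ball (0 : Plane) R, ‖x‖ ^ (-p) = 2 * Real.pi * (R ^ (2 - p) / (2 - p)) := by
  rw [← integral_indicator Metric.isOpen_ball.measurableSet]
  have e : (Metric.ball (0 : Plane) R).indicator (fun x => ‖x‖ ^ (-p)) =
      fun x => (Set.Iio R).indicator (fun s => s ^ (-p)) ‖x‖ := by
    funext x; simp [Set.indicator]
  rw [e, integral_radial]
  congr 1
  have h := integral_rpow (a := 0) (b := R) (r := 1 - p) (Or.inl (by linarith))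
  rw [intervalIntegral.integral_of_le hR, Real.zero_rpow (by linarith), sub_zero,
    show 1 - p + 1 = 2 - p by ring] at h
  rw [← h, integral_Ioc_eq_integral_Ioo, ← integral_indicator measurableSet_Ioi,
    ← integral_indicator measurableSet_Ioo]
  congr 1
  funext s
  by_cases h1 : 0 < s <;> by_cases h2 : s < R <;> simp [Set.indicator, h1, h2]
  rw [sub_eq_add_neg, Real.rpow_add h1, Real.rpow_one]

lemma integrableOn_compl_ball_rpow {q : ℝ} (hq : 2 < q) {R : ℝ} (hR : 0 < R) :
    IntegrableOn (fun x : Plane => ‖x‖ ^ (-q)) (Metric.ball 0 R)ᶜ := by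
  rw [← integrable_indicator_iff Metric.isOpen_ball.measurableSet.compl]
  have e : (Metric.ball (0 : Plane) R)ᶜ.indicator (fun x => ‖x‖ ^ (-q)) =
      fun x => (Set.Ici R).indicator (fun s => s ^ (-q)) ‖x‖ := by
    funext x; simp [Set.indicator]
  rw [e, integrable_radial_iff]
  have h := integrableOn_Ioi_rpow_of_lt (a := 1 - q) (by linarith) hR
  rw [← integrableOn_Ici_iff_integrableOn_Ioi] at h
  rw [← integrable_indicator_iff measurableSet_Ioi]
  rw [← integrable_indicator_iff measurableSet_Ici] at h
  refine h.congr (Eventually.of_forall fun s => ?_)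
  by_cases h2 : R ≤ s
  · have h1 : 0 < s := by linarith
    simp [Set.indicator, h1, h2]
    rw [sub_eq_add_neg, Real.rpow_add h1, Real.rpow_one]
  · simp [Set.indicator, h2]

lemma integral_compl_ball_rpow {q : ℝ} (hq : 2 < q) {R : ℝ} (hR : 0 < R) :
    ∫ x in (Metric.ball (0 : Plane) R)ᶜ, ‖x‖ ^ (-q) = 2 * Real.pi * (R ^ (2 - q) / (q - 2)) := by
  rw [← integral_indicator Metric.isOpen_ball.measurableSet.compl]
  have e : (Metric.ball (0 : Plane) R)ᶜ.indicator (fun x => ‖x‖ ^ (-q)) =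
      fun x => (Set.Ici R).indicator (fun s => s ^ (-q)) ‖x‖ := by
    funext x; simp [Set.indicator]
  rw [e, integral_radial]
  congr 1
  have h := integral_Ioi_rpow_of_lt (a := 1 - q) (by linarith) hR
  rw [show 1 - q + 1 = 2 - q by ring, ← neg_div_neg_eq, neg_neg, neg_sub] at h
  rw [← h, ← integral_Ici_eq_integral_Ioi (x := R), ← integral_indicator measurableSet_Ioi,
    ← integral_indicator measurableSet_Ici]
  congr 1
  funext s
  by_cases h2 : R ≤ s
  · have h1 : 0 < s := by linarith
    simp [Set.indicator, h1, h2]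
    rw [sub_eq_add_neg, Real.rpow_add h1, Real.rpow_one]
  · simp [Set.indicator, h2]

/-! ### Finite index sets -/

/-- The indices of sup norm at most `N`. -/
def idxBox (N : ℕ) : Finset Idx := Fintype.piFinset fun _ => Finset.Icc (-(N : ℤ)) N

lemma mem_idxBox {N : ℕ} {z : Idx} : z ∈ idxBox N ↔ ∀ i, |z i| ≤ N := by
  simp [idxBox, abs_le]

lemma card_idxBox (N : ℕ) : (idxBox N).card = (2 * N + 1) ^ 2 := by
  simp only [idxBox, Fintype.card_piFinset, Int.card_Icc, Finset.prod_const, Finset.card_univ,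
    Fintype.card_fin]
  congr 1; omega

lemma idxBox_mono {N K : ℕ} (h : N ≤ K) : idxBox N ⊆ idxBox K := fun z hz => by
  rw [mem_idxBox] at hz ⊢
  exact fun i => (hz i).trans (by exact_mod_cast h)

lemma neg_mem_idxBox {N : ℕ} {z : Idx} : -z ∈ idxBox N ↔ z ∈ idxBox N := by
  simp [mem_idxBox]

lemma sum_idxBox_neg (N : ℕ) (f : Idx → ℝ) : ∑ z ∈ idxBox N, f (-z) = ∑ z ∈ idxBox N, f z :=
  Finset.sum_bij (fun z _ => -z) (fun _ h => neg_mem_idxBox.2 h) (fun _ _ _ _ h => neg_injective h)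
    (fun z h => ⟨-z, neg_mem_idxBox.2 h, neg_neg z⟩) (fun _ _ => rfl)

lemma tendsto_idxBox : Tendsto idxBox atTop atTop := by
  refine tendsto_atTop_finset_of_monotone (fun _ _ h => idxBox_mono h) fun z => ?_
  refine ⟨∑ i, (z i).natAbs, mem_idxBox.2 fun i => ?_⟩
  rw [Int.abs_eq_natAbs]
  exact_mod_cast Finset.single_le_sum (f := fun i => (z i).natAbs) (fun _ _ => Nat.zero_le _)
    (Finset.mem_univ i)

/-- A box of indices that contains every lattice point within distance `R + 1` of the origin. -/
def latBox (R : ℝ) (n : ℕ) : Finset Idx := idxBox ⌈(n : ℝ) * (R + 2)⌉₊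

lemma mem_latBox_of_norm_le {R : ℝ} {n : ℕ} (hn : 0 < n) {z : Idx}
    (hz : ‖latticePt n z‖ ≤ R + 2) : z ∈ latBox R n := by
  have hn' : (0 : ℝ) < n := by exact_mod_cast hn
  refine mem_idxBox.2 fun i => ?_
  have h := (abs_apply_le_norm (latticePt n z) i).trans hz
  rw [latticePt_apply, abs_div, abs_of_pos hn', div_le_iff₀ hn'] at h
  have h2 : |(z i : ℝ)| ≤ (⌈(n : ℝ) * (R + 2)⌉₊ : ℝ) :=
    h.trans (by rw [mul_comm]; exact Nat.le_ceil _)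
  exact_mod_cast h2

lemma rnd_mem_latBox {R : ℝ} {n : ℕ} (hn : 0 < n) {x : Plane} (hx : ‖x‖ ≤ R + 1) :
    rnd n x ∈ latBox R n := by
  have hn' : (1 : ℝ) ≤ n := by exact_mod_cast hn
  apply mem_latBox_of_norm_le hn
  have h1 := norm_sub_rp_le hn x
  have h2 : 1 / (n : ℝ) ≤ 1 := by rw [div_le_one (by positivity)]; exact hn'
  have h3 := norm_le_insert x (rp n x)
  change ‖rp n x‖ ≤ _
  linarith

/-- A square contained in the ball has its centre there, and a square that meets the ball without
being contained in it is in the discrete boundary; so every square meeting the ball is indexed by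
`jumpRange`. -/
lemma cell_inter_ball_eq_empty {M : ℝ} {n : ℕ} {z : Idx} (hz : z ∉ jumpRange M n) :
    cell n z ∩ Metric.ball 0 M = ∅ := by
  by_contra h
  have h := Set.nonempty_iff_ne_empty.2 h
  apply hz
  by_cases hc : cell n z ⊆ Metric.ball 0 M
  · left
    refine hc fun i => ?_
    simp
  · exact Or.inr ⟨hc, h⟩

lemma cellFraction_eq_zero {r M : ℝ} {n : ℕ} {z : Idx} (hz : z ∉ jumpRange M n) :
    cellFraction r M n z = 0 := by
  have h := cell_inter_ball_eq_empty hz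
  have : cell n z ∩ (Metric.ball 0 M \ Metric.ball 0 (r / n)) = ∅ := by
    rw [← Set.inter_sdiff_assoc, h, Set.empty_sdiff]
  simp [cellFraction, this]

lemma jumpRange_subset_latBox {M : ℝ} {n : ℕ} (hn : 0 < n) {z : Idx}
    (hz : z ∈ jumpRange M n) : z ∈ latBox M n := by
  rcases hz with hz | ⟨-, x, hx, hxM⟩
  · have : ‖latticePt n z‖ < M := by simpa [latticeRestrict] using hz
    exact mem_latBox_of_norm_le hn (by linarith)
  · have hn' : (1 : ℝ) ≤ n := by exact_mod_cast hn
    refine mem_idxBox.2 fun i => ?_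
    have h1 := abs_apply_le_norm x i
    have h2 : ‖x‖ < M := by simpa using hxM
    have h3 := hx i
    have h4 : |(z i : ℝ) / n| ≤ M + 1 := by
      have : 1 / (2 * (n : ℝ)) ≤ 1 := by rw [div_le_one (by positivity)]; linarith
      have e : (z i : ℝ) / n = x i - (x i - z i / n) := by ring
      rw [e]; refine (abs_sub _ _).trans ?_; linarith
    rw [abs_div, abs_of_pos (by linarith : (0 : ℝ) < n), div_le_iff₀ (by linarith)] at h4
    have h5 : |(z i : ℝ)| ≤ (⌈(n : ℝ) * (M + 2)⌉₊ : ℝ) :=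
      h4.trans (le_trans (by nlinarith) (Nat.le_ceil _))
    exact_mod_cast h5

/-- Lets all the sums over `jumpRange` be taken over one box that is symmetric under negation and
has an explicit cardinality. -/
lemma finsum_mem_eq_sum {s : Set Idx} {S : Finset Idx} {f : Idx → ℝ}
    (h1 : ∀ z ∈ s, f z ≠ 0 → z ∈ S) (h2 : ∀ z ∉ s, f z = 0) :
    ∑ᶠ z ∈ s, f z = ∑ z ∈ S, f z := by
  have e : ∀ z, (∑ᶠ _ : z ∈ s, f z) = f z := by
    intro z
    by_cases hz : z ∈ s
    · simp [hz]
    · simp [hz, h2 z hz]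
  simp only [e]
  refine finsum_eq_sum_of_support_subset _ fun z hz => ?_
  have hz' : f z ≠ 0 := hz
  by_cases hs : z ∈ s
  · exact h1 z hs hz'
  · exact absurd (h2 z hs) hz'

/-- The four nearest neighbours of the origin. -/
def nnSet : Finset Idx := {![1, 0], ![-1, 0], ![0, 1], ![0, -1]}

lemma card_nnSet : nnSet.card = 4 := by decide

lemma sum_nnSet (f : Idx → ℝ) :
    ∑ z ∈ nnSet, f z = f ![1, 0] + f ![-1, 0] + f ![0, 1] + f ![0, -1] := by
  rw [nnSet, Finset.sum_insert (by decide), Finset.sum_insert (by decide),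
    Finset.sum_insert (by decide), Finset.sum_singleton]
  ring

lemma norm_sq_latticePt (n : ℕ) (z : Idx) :
    ‖latticePt n z‖ ^ 2 = ((z 0 : ℝ) ^ 2 + (z 1 : ℝ) ^ 2) / n ^ 2 := by
  rw [norm_sq_plane]; simp [div_pow, add_div]

lemma norm_latticePt_eq_iff {n : ℕ} (hn : 0 < n) (z : Idx) :
    ‖latticePt n z‖ = 1 / n ↔ z ∈ nnSet := by
  have hn' : (0 : ℝ) < n := by exact_mod_cast hn
  rw [← sq_eq_sq₀ (norm_nonneg _) (by positivity), norm_sq_latticePt, div_pow, one_pow,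
    div_left_inj' (by positivity)]
  have hz : z = ![z 0, z 1] := by funext i; fin_cases i <;> rfl
  constructor
  · intro h
    have h' : z 0 ^ 2 + z 1 ^ 2 = 1 := by exact_mod_cast h
    have a1 : z 0 ≤ 1 := by nlinarith
    have a2 : -1 ≤ z 0 := by nlinarith
    have b1 : z 1 ≤ 1 := by nlinarith
    have b2 : -1 ≤ z 1 := by nlinarith
    rw [hz]
    generalize z 0 = a at *
    generalize z 1 = b at *
    interval_cases a <;> interval_cases b <;> simp_all [nnSet]
  · intro h
    simp only [nnSet, Finset.mem_insert, Finset.mem_singleton] at h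
    rcases h with h | h | h | h <;> simp [h]

/-! ### The nearest-neighbour correction and the normalising constant as integrals -/

lemma one_div_rpow_norm (p : ℝ) (x : Plane) : 1 / ‖x‖ ^ p = ‖x‖ ^ (-p) := by
  rw [Real.rpow_neg (norm_nonneg _), one_div]

/-- The annulus of the jumps. -/
def annulus (r M : ℝ) (n : ℕ) : Set Plane := Metric.ball 0 M \ Metric.ball 0 (r / n)

lemma measurableSet_annulus (r M : ℝ) (n : ℕ) : MeasurableSet (annulus r M n) :=
  Metric.isOpen_ball.measurableSet.diff Metric.isOpen_ball.measurableSet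

lemma mem_annulus {r M : ℝ} {n : ℕ} {x : Plane} :
    x ∈ annulus r M n ↔ ‖x‖ < M ∧ r / n ≤ ‖x‖ := by simp [annulus]

lemma volume_annulus_ne_top (r M : ℝ) (n : ℕ) : volume (annulus r M n) ≠ ⊤ :=
  ((measure_mono Set.sdiff_subset).trans_lt measure_ball_lt_top).ne

lemma sum_cellFraction {r M : ℝ} {n : ℕ} (hn : 0 < n) (g : Idx → ℝ) :
    ∑ z ∈ latBox M n, cellFraction r M n z * g z
      = (n : ℝ) ^ 2 * ∫ x in annulus r M n, g (rnd n x) := by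
  rw [← sum_volume_cell hn (measurableSet_annulus r M n) (volume_annulus_ne_top r M n) (latBox M n),
    Finset.mul_sum]
  · exact Finset.sum_congr rfl fun z _ => by simp only [cellFraction, annulus]; ring
  · intro x hx
    exact rnd_mem_latBox hn (by linarith [(mem_annulus.1 hx).1])

/-- Rounding commutes with the scaling of the lattice, so every scale reduces to the unit lattice.
-/
lemma rp_smul {n : ℕ} (hn : 0 < n) (u : Plane) :
    rp n ((n : ℝ)⁻¹ • u) = (n : ℝ)⁻¹ • rp 1 u := by
  have hn' : (n : ℝ) ≠ 0 := by positivity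
  ext i
  simp [rp, rnd, mul_inv_cancel_left₀ hn', div_eq_inv_mul]

/-- The pointwise discrepancy between `|u|^{-α}` and its rounding outside `B_r`. -/
def discrepancy (α r : ℝ) (u : Plane) : ℝ :=
  ‖u‖ ^ (-α) - (Metric.ball (0 : Plane) r)ᶜ.indicator (fun u => ‖rp 1 u‖ ^ (-α)) u

lemma norm_rp_rpow_neg_le_one {p : ℝ} (hp : 0 < p) (u : Plane) : ‖rp 1 u‖ ^ (-p) ≤ 1 := by
  by_cases h : rnd 1 u = 0
  · simp [rp, h, Real.zero_rpow (neg_ne_zero.2 hp.ne')]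
  · have := norm_latticePt_ge one_pos h
    exact Real.rpow_le_one_of_one_le_of_nonpos (by simpa [rp] using this) (by linarith)

lemma rpow_neg_norm_measurable (p : ℝ) (n : ℕ) : Measurable fun u : Plane => ‖rp n u‖ ^ (-p) :=
  (measurable_rp n).norm.pow_const _

lemma setIntegral_ball_scale {n : ℕ} (hn : 0 < n) (M : ℝ) (f : Plane → ℝ) :
    ∫ u in Metric.ball 0 (n * M), f ((n : ℝ)⁻¹ • u) = (n : ℝ) ^ 2 * ∫ y in Metric.ball 0 M, f y := by
  have hn' : (0 : ℝ) < n := by exact_mod_cast hn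
  rw [Measure.setIntegral_comp_smul_of_pos volume f _ (inv_pos.2 hn'), smul_ball (by positivity)]
  simp [hn'.ne']

/-- The substitution `u = n y` removes `n` from the integrand: the prefactor `n^(2-α)` is exactly
the homogeneity of `|y|^{-α} dy`. Only the domain still depends on `n`. -/
lemma nnConst_eq {α r M : ℝ} (hα : 0 < α) (hα2 : α < 2) {n : ℕ} (hn : 0 < n) :
    nnConst α r M n = 1 / 4 * ∫ u in Metric.ball 0 (n * M), discrepancy α r u := by
  have hn' : (0 : ℝ) < n := by exact_mod_cast hn
  have h1 : ∑ᶠ z ∈ jumpRange M n \ {0}, cellFraction r M n z / ‖latticePt n z‖ ^ α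
      = (n : ℝ) ^ 2 * ∫ x in annulus r M n, ‖rp n x‖ ^ (-α) := by
    rw [finsum_mem_eq_sum (S := latBox M n)]
    · refine Eq.trans ?_ (sum_cellFraction hn fun z => ‖latticePt n z‖ ^ (-α))
      exact Finset.sum_congr rfl fun z _ => by
        rw [Real.rpow_neg (norm_nonneg _), div_eq_mul_inv]
    · exact fun z hz _ => jumpRange_subset_latBox hn hz.1
    · intro z hz
      -- The excluded origin costs nothing: `0 ^ α = 0`, and division by zero gives zero.
      by_cases h : z = 0
      · simp [h, Real.zero_rpow hα.ne']
      · rw [cellFraction_eq_zero fun h' => hz ⟨h', h⟩, zero_div]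
  have h2 : ∫ x in annulus r M n, ‖rp n x‖ ^ (-α) = ∫ x in Metric.ball 0 M,
      (Metric.ball (0 : Plane) (r / n))ᶜ.indicator (fun x => ‖rp n x‖ ^ (-α)) x := by
    rw [setIntegral_indicator Metric.isOpen_ball.measurableSet.compl]; rfl
  have hi : IntegrableOn ((Metric.ball (0 : Plane) (r / n))ᶜ.indicator
      (fun x => ‖rp n x‖ ^ (-α))) (Metric.ball 0 M) := by
    refine Measure.integrableOn_of_bounded (M := (n : ℝ) ^ α) measure_ball_lt_top.ne
      ((rpow_neg_norm_measurable α n).indicator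
        Metric.isOpen_ball.measurableSet.compl).aestronglyMeasurable
      (Eventually.of_forall fun x => ?_)
    rw [Real.norm_eq_abs, abs_of_nonneg (Set.indicator_nonneg
      (fun _ _ => Real.rpow_nonneg (norm_nonneg _) _) _)]
    refine (Set.indicator_le_self' (fun _ _ => Real.rpow_nonneg (norm_nonneg _) _) x).trans ?_
    have e := rp_smul hn ((n : ℝ) • x)
    rw [inv_smul_smul₀ hn'.ne'] at e
    rw [e, norm_smul, Real.mul_rpow (norm_nonneg _) (norm_nonneg _), norm_inv, Real.norm_natCast,
      Real.inv_rpow hn'.le, Real.rpow_neg hn'.le, inv_inv]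
    exact mul_le_of_le_one_right (by positivity) (norm_rp_rpow_neg_le_one hα _)
  have h3 : ∀ u, discrepancy α r u = (n : ℝ) ^ (-α) * (‖(n : ℝ)⁻¹ • u‖ ^ (-α) -
      (Metric.ball (0 : Plane) (r / n))ᶜ.indicator (fun x => ‖rp n x‖ ^ (-α)) ((n : ℝ)⁻¹ • u)) := by
    intro u
    have a : ∀ v : Plane, (n : ℝ) ^ (-α) * ‖(n : ℝ)⁻¹ • v‖ ^ (-α) = ‖v‖ ^ (-α) := by
      intro v
      rw [← Real.mul_rpow hn'.le (norm_nonneg _), norm_smul, norm_inv, Real.norm_natCast,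
        mul_inv_cancel_left₀ hn'.ne']
    have b : (n : ℝ)⁻¹ • u ∈ (Metric.ball (0 : Plane) (r / n))ᶜ ↔ u ∈ (Metric.ball (0 : Plane) r)ᶜ := by
      simp [norm_smul, div_eq_inv_mul, hn']
    rw [mul_sub, a, discrepancy]
    congr 1
    by_cases hu : u ∈ (Metric.ball (0 : Plane) r)ᶜ
    · rw [Set.indicator_of_mem hu, Set.indicator_of_mem (b.2 hu), rp_smul hn, a]
    · rw [Set.indicator_of_notMem hu, Set.indicator_of_notMem (fun h => hu (b.1 h)), mul_zero]
  rw [nnConst, h1, h2]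
  simp only [one_div_rpow_norm, h3]
  rw [integral_const_mul, setIntegral_ball_scale hn M fun y => ‖y‖ ^ (-α) -
      (Metric.ball (0 : Plane) (r / n))ᶜ.indicator (fun x => ‖rp n x‖ ^ (-α)) y,
    integral_sub (integrableOn_ball_rpow hα2 M) hi, Real.rpow_sub hn', Real.rpow_neg hn'.le,
    Real.rpow_two]
  field_simp

/-- Each of the four neighbours contributes `k_n`; the remaining weights are homogeneous of degree
`-(2+α)`, and scaling turns their sum into an integral of a fixed function. -/
lemma inv_normConst {α r M : ℝ} (hα : 0 < α) {n : ℕ} (hn : 0 < n) :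
    (normConst α r M n)⁻¹ = 4 * nnConst α r M n +
      ∫ u in Metric.ball 0 (n * M), (Metric.ball (0 : Plane) r)ᶜ.indicator
        (fun u => ‖rp 1 u‖ ^ (-(2 + α))) u := by
  have hn' : (0 : ℝ) < n := by exact_mod_cast hn
  -- Nothing relates `1/n` to `M` here, so the nearest neighbours need not lie in the box for `B_M`;
  -- radius `max M 0` contains them as well.
  have hnn : nnSet ⊆ latBox (max M 0) n := fun z hz => by
    apply mem_latBox_of_norm_le hn
    rw [(norm_latticePt_eq_iff hn z).2 hz]
    have : 1 / (n : ℝ) ≤ 1 := by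
      rw [div_le_one hn']; exact_mod_cast hn
    linarith [le_max_right M 0]
  have hsub : latBox M n ⊆ latBox (max M 0) n := idxBox_mono (by
    apply Nat.ceil_mono; gcongr; exact le_max_left _ _)
  have hF : ∀ z ∉ latBox M n, cellFraction r M n z = 0 := fun z hz =>
    cellFraction_eq_zero fun h => hz (jumpRange_subset_latBox hn h)
  rw [normConst, inv_inv, finsum_mem_eq_sum (S := latBox (max M 0) n)]
  · simp only [jumpWeight, norm_latticePt_eq_iff hn]
    rw [Finset.sum_add_distrib, ← Finset.mul_sum, Finset.sum_ite_mem,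
      Finset.inter_eq_right.2 hnn, Finset.sum_const, card_nnSet]
    congr 1
    · simp; ring
    · rw [← Finset.sum_subset hsub (fun z _ hz => by rw [hF z hz, zero_div])]
      have e : ∀ z, cellFraction r M n z / ((n : ℝ) ^ (2 + α) * ‖latticePt n z‖ ^ (2 + α))
        = cellFraction r M n z * (((n : ℝ) ^ (2 + α))⁻¹ * ‖latticePt n z‖ ^ (-(2 + α))) := by
        intro z
        rw [Real.rpow_neg (norm_nonneg _), div_eq_mul_inv, mul_inv]
      simp only [e]
      rw [sum_cellFraction hn fun z => ((n : ℝ) ^ (2 + α))⁻¹ * ‖latticePt n z‖ ^ (-(2 + α))]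
      change (n : ℝ) ^ 2 * ∫ x in Metric.ball 0 M ∩ (Metric.ball 0 (r / n))ᶜ,
        ((n : ℝ) ^ (2 + α))⁻¹ * ‖rp n x‖ ^ (-(2 + α)) = _
      rw [← setIntegral_indicator Metric.isOpen_ball.measurableSet.compl,
        ← setIntegral_ball_scale hn]
      congr 1
      funext u
      have b : (n : ℝ)⁻¹ • u ∈ (Metric.ball (0 : Plane) (r / n))ᶜ ↔
          u ∈ (Metric.ball (0 : Plane) r)ᶜ := by
        simp [norm_smul, div_eq_inv_mul, hn']
      by_cases hu : u ∈ (Metric.ball (0 : Plane) r)ᶜ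
      · rw [Set.indicator_of_mem hu, Set.indicator_of_mem (b.2 hu), rp_smul hn, norm_smul, norm_inv,
          Real.norm_natCast, Real.mul_rpow (by positivity) (norm_nonneg _), Real.inv_rpow hn'.le,
          Real.rpow_neg hn'.le, inv_inv, inv_mul_cancel_left₀ (by positivity)]
      · rw [Set.indicator_of_notMem hu, Set.indicator_of_notMem (fun h => hu (b.1 h))]
  · intro z hz hw
    by_contra h
    apply hw
    rw [jumpWeight, hF z fun h' => h (hsub h'), if_neg fun h' =>
      h (hnn ((norm_latticePt_eq_iff hn z).1 h'))]
    simp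
  · intro z hz
    have hz : z = 0 := by simpa using hz
    have h0 : (0 : ℝ) ≠ (n : ℝ)⁻¹ := by positivity
    simp [jumpWeight, hz, Real.zero_rpow (by linarith : 2 + α ≠ 0), h0]

/-! ### Convergence and positivity of the constants -/

lemma one_sub_mul_le_rpow_neg {β x : ℝ} (hβ : 0 ≤ β) (hx : 0 < x) :
    1 - β * (x - 1) ≤ x ^ (-β) := by
  rw [Real.rpow_def_of_pos hx]
  have h1 := Real.add_one_le_exp (Real.log x * -β)
  have h2 := Real.log_le_sub_one_of_pos hx
  nlinarith

/-- The tangent line of the convex function `x ^ (-β)` lies below its graph; the normalised case at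
`1` is applied to `b / a`. -/
lemma tangent_le_rpow_neg {β a b : ℝ} (hβ : 0 ≤ β) (ha : 0 < a) (hb : 0 < b) :
    a ^ (-β) - β * a ^ (-β - 1) * (b - a) ≤ b ^ (-β) := by
  have h := one_sub_mul_le_rpow_neg hβ (div_pos hb ha)
  have ha' : 0 < a ^ (-β) := Real.rpow_pos_of_pos ha _
  have h1 := mul_le_mul_of_nonneg_left h ha'.le
  rw [Real.div_rpow hb.le ha.le, mul_div_cancel₀ _ ha'.ne'] at h1
  refine le_trans (le_of_eq ?_) h1
  rw [Real.rpow_sub_one ha.ne']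
  field_simp

lemma abs_rpow_neg_sub_le {β a b m : ℝ} (hβ : 0 ≤ β) (hm : 0 < m) (ha : m ≤ a) (hb : m ≤ b) :
    |a ^ (-β) - b ^ (-β)| ≤ β * m ^ (-β - 1) * |a - b| := by
  have key : ∀ a b : ℝ, m ≤ a → m ≤ b → a ^ (-β) - b ^ (-β) ≤ β * m ^ (-β - 1) * |a - b| := by
    intro a b ha hb
    have h1 := tangent_le_rpow_neg hβ (hm.trans_le ha) (hm.trans_le hb)
    have h2 : a ^ (-β - 1) ≤ m ^ (-β - 1) := Real.rpow_le_rpow_of_nonpos hm ha (by linarith)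
    have h3 : 0 < a ^ (-β - 1) := Real.rpow_pos_of_pos (hm.trans_le ha) _
    calc a ^ (-β) - b ^ (-β) ≤ β * a ^ (-β - 1) * (b - a) := by linarith
      _ ≤ β * a ^ (-β - 1) * |a - b| := by
        gcongr; rw [abs_sub_comm]; exact le_abs_self _
      _ ≤ _ := by gcongr
  rw [abs_le]
  have := key b a hb ha
  rw [abs_sub_comm] at this
  exact ⟨by linarith, key a b ha hb⟩

lemma rnd_ne_zero_of_norm_gt {n : ℕ} (hn : 0 < n) {x : Plane} (hx : 1 / n < ‖x‖) : rnd n x ≠ 0 := by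
  intro h
  have h1 := norm_sub_rp_le hn x
  simp only [rp, h, latticePt_zero, sub_zero] at h1
  linarith

lemma measurable_discrepancy (α r : ℝ) : Measurable (discrepancy α r) :=
  (measurable_norm.pow_const _).sub
    ((rpow_neg_norm_measurable α 1).indicator Metric.isOpen_ball.measurableSet.compl)

/-- Rounding moves the norm by at most `1` and at most halves it, so the mean value bound gains one
power of decay. The exponent `α + 1 > 2` is then integrable at infinity, which `α` alone is not. -/
lemma abs_discrepancy_le {α r : ℝ} (hα : 0 < α) {u : Plane} (hr : r ≤ ‖u‖) (hu : 1 < ‖u‖) :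
    |discrepancy α r u| ≤ α * 2 ^ (α + 1) * ‖u‖ ^ (-(α + 1)) := by
  have h0 : rnd 1 u ≠ 0 := rnd_ne_zero_of_norm_gt one_pos (by simpa using hu)
  have hmem : u ∈ (Metric.ball (0 : Plane) r)ᶜ := by simpa using hr
  rw [discrepancy, Set.indicator_of_mem hmem]
  have h1 : ‖u‖ / 2 ≤ ‖rp 1 u‖ := by
    have := norm_le_mul_norm_rp one_pos h0
    linarith
  have h2 : |‖u‖ - ‖rp 1 u‖| ≤ 1 := by
    have := (abs_norm_sub_norm_le u (rp 1 u)).trans (norm_sub_rp_le one_pos u)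
    simpa using this
  refine (abs_rpow_neg_sub_le hα.le (by positivity : 0 < ‖u‖ / 2) (by linarith) h1).trans ?_
  have e : (‖u‖ / 2) ^ (-α - 1) = 2 ^ (α + 1) * ‖u‖ ^ (-(α + 1)) := by
    rw [Real.div_rpow (norm_nonneg _) zero_le_two, show -α - 1 = -(α + 1) by ring,
      Real.rpow_neg zero_le_two, div_inv_eq_mul, mul_comm]
  rw [e, ← mul_assoc]
  exact mul_le_of_le_one_right (by positivity) h2

lemma integrable_discrepancy {α r : ℝ} (hα : 1 < α) (hα2 : α < 2) :
    Integrable (discrepancy α r) := by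
  set ρ : ℝ := max r 1 + 1
  have hρ1 : 1 < ρ := by have := le_max_right r 1; simp only [ρ]; linarith
  have hρr : r ≤ ρ := by have := le_max_left r 1; simp only [ρ]; linarith
  rw [← integrableOn_univ, ← Set.union_compl_self (Metric.ball (0 : Plane) ρ)]
  refine IntegrableOn.union ?_ ?_
  · refine (integrableOn_ball_rpow hα2 ρ).sub ?_
    refine Measure.integrableOn_of_bounded (M := 1) measure_ball_lt_top.ne
      ((rpow_neg_norm_measurable α 1).indicator
        Metric.isOpen_ball.measurableSet.compl).aestronglyMeasurable
      (Eventually.of_forall fun x => ?_)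
    rw [Real.norm_eq_abs, abs_of_nonneg (Set.indicator_nonneg
      (fun _ _ => Real.rpow_nonneg (norm_nonneg _) _) _)]
    exact (Set.indicator_le_self' (fun _ _ => Real.rpow_nonneg (norm_nonneg _) _) x).trans
      (norm_rp_rpow_neg_le_one (by linarith) x)
  · refine Integrable.mono' ((integrableOn_compl_ball_rpow (by linarith : 2 < α + 1)
      (by linarith : 0 < ρ)).const_mul (α * 2 ^ (α + 1)))
      (measurable_discrepancy α r).aestronglyMeasurable ?_
    refine (ae_restrict_iff' Metric.isOpen_ball.measurableSet.compl).2 (Eventually.of_forall ?_)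
    intro u hu
    have hu : ρ ≤ ‖u‖ := by simpa using hu
    exact abs_discrepancy_le (by linarith) (by linarith) (by linarith)

lemma integrable_rp_tail {α r : ℝ} (hα : 1 < α) :
    Integrable ((Metric.ball (0 : Plane) r)ᶜ.indicator (fun u => ‖rp 1 u‖ ^ (-(2 + α)))) := by
  refine Integrable.indicator ?_ Metric.isOpen_ball.measurableSet.compl
  rw [← integrableOn_univ, ← Set.union_compl_self (Metric.ball (0 : Plane) 2)]
  refine IntegrableOn.union ?_ ?_
  · refine Measure.integrableOn_of_bounded (M := 1) measure_ball_lt_top.ne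
      (rpow_neg_norm_measurable _ 1).aestronglyMeasurable (Eventually.of_forall fun x => ?_)
    rw [Real.norm_eq_abs, abs_of_nonneg (Real.rpow_nonneg (norm_nonneg _) _)]
    exact norm_rp_rpow_neg_le_one (by linarith) x
  · refine Integrable.mono' ((integrableOn_compl_ball_rpow (by linarith : 2 < 2 + α)
      two_pos).const_mul (2 ^ (2 + α)))
      (rpow_neg_norm_measurable _ 1).aestronglyMeasurable ?_
    refine (ae_restrict_iff' Metric.isOpen_ball.measurableSet.compl).2 (Eventually.of_forall ?_)
    intro u hu
    have hu : 2 ≤ ‖u‖ := by simpa using hu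
    have h0 : rnd 1 u ≠ 0 := rnd_ne_zero_of_norm_gt one_pos (by norm_num; linarith)
    have h1 : ‖u‖ / 2 ≤ ‖rp 1 u‖ := by
      have := norm_le_mul_norm_rp one_pos h0
      linarith
    rw [Real.norm_eq_abs, abs_of_nonneg (Real.rpow_nonneg (norm_nonneg _) _)]
    refine (Real.rpow_le_rpow_of_nonpos (by positivity) h1 (by linarith)).trans (le_of_eq ?_)
    rw [Real.div_rpow (norm_nonneg _) zero_le_two, Real.rpow_neg zero_le_two, div_inv_eq_mul,
      mul_comm]

lemma tendsto_setIntegral_ball_mul {M : ℝ} (hM : 0 < M) {f : Plane → ℝ} (hf : Integrable f) :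
    Tendsto (fun n : ℕ => ∫ u in Metric.ball 0 (n * M), f u) atTop (𝓝 (∫ u, f u)) :=
  (aecover_ball (tendsto_natCast_atTop_atTop.atTop_mul_const hM)).integral_tendsto_of_countably_generated hf

/-- The limit of the nearest-neighbour corrections. -/
def nnLim (α r : ℝ) : ℝ := 1 / 4 * ∫ u, discrepancy α r u

lemma tendsto_nnConst {α r M : ℝ} (hα : 1 < α) (hα2 : α < 2) (hM : 0 < M) :
    Tendsto (nnConst α r M) atTop (𝓝 (nnLim α r)) := by
  refine ((tendsto_setIntegral_ball_mul hM
    (integrable_discrepancy (r := r) hα hα2)).const_mul (1 / 4)).congr' ?_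
  filter_upwards [eventually_gt_atTop 0] with n hn
  exact (nnConst_eq (by linarith) hα2 hn).symm

/-! ### Positivity of the limiting nearest-neighbour correction. -/

lemma mem_rnd_one_iff (z : Idx) (u : Plane) :
    rnd 1 u = z ↔ ∀ i, u i ∈ Set.Ico ((z i : ℝ) - 1 / 2) (z i + 1 / 2) := by
  rw [funext_iff]
  refine forall_congr' fun i => ?_
  simp only [rnd, Nat.cast_one, one_mul, Int.floor_eq_iff, Set.mem_Ico]
  constructor <;> rintro ⟨h1, h2⟩ <;> constructor <;> linarith

/-- The extra `1/6` is twice the variance `1/12` of the uniform law on a unit interval. -/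
lemma integral_sq_cell (z : Idx) :
    IntegrableOn (fun u : Plane => ‖u‖ ^ 2) {u | rnd 1 u = z} ∧
    volume.real {u : Plane | rnd 1 u = z} = 1 ∧
    ∫ u in {u | rnd 1 u = z}, ‖u‖ ^ 2 = (z 0 : ℝ) ^ 2 + (z 1 : ℝ) ^ 2 + 1 / 6 := by
  set I : Fin 2 → Set ℝ := fun i => Set.Ico ((z i : ℝ) - 1 / 2) (z i + 1 / 2) with hI
  have hset : {u : Plane | rnd 1 u = z} = (@WithLp.ofLp 2 (Fin 2 → ℝ)) ⁻¹' (Set.univ.pi I) := by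
    ext u; simp [mem_rnd_one_iff, I]
  have hmp := PiLp.volume_preserving_ofLp (Fin 2)
  have hemb : MeasurableEmbedding (@WithLp.ofLp 2 (Fin 2 → ℝ)) :=
    (MeasurableEquiv.toLp 2 (Fin 2 → ℝ)).symm.measurableEmbedding
  have hmI : MeasurableSet (Set.univ.pi I) := MeasurableSet.univ_pi fun i => measurableSet_Ico
  have hvol : volume (Set.univ.pi I) = 1 := by
    rw [volume_pi_pi]
    simp only [hI, Real.volume_Ico]
    norm_num
  have h1d : ∀ i, ∫ t in I i, t ^ 2 = (z i : ℝ) ^ 2 + 1 / 12 := by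
    intro i
    rw [hI, integral_Ico_eq_integral_Ioc, ← intervalIntegral.integral_of_le (by linarith),
      integral_pow]
    ring
  have h1c : ∀ i, ∫ t in I i, (1 : ℝ) = 1 := by
    intro i
    simp [hI, Measure.real, Real.volume_Ico]
    norm_num
  have hres : (volume : Measure (Fin 2 → ℝ)).restrict (Set.univ.pi I)
      = Measure.pi fun i => (volume : Measure ℝ).restrict (I i) := by
    rw [volume_pi, Measure.restrict_pi_pi]
  have hint1 : ∀ i, Integrable (fun t : ℝ => t ^ 2) (volume.restrict (I i)) := fun i =>
    ((continuous_pow 2).integrableOn_Icc).mono_set Set.Ico_subset_Icc_self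
  have hintc : ∀ i, Integrable (fun t : ℝ => (1 : ℝ)) (volume.restrict (I i)) := fun i =>
    (continuous_const.integrableOn_Icc).mono_set Set.Ico_subset_Icc_self
  have hA : Integrable (fun x : Fin 2 → ℝ => (x 0) ^ 2) (volume.restrict (Set.univ.pi I)) ∧
      ∫ x in Set.univ.pi I, (x 0) ^ 2 = (z 0 : ℝ) ^ 2 + 1 / 12 := by
    have e : (fun x : Fin 2 → ℝ => (x 0) ^ 2) =
        fun x => ∏ i, (![fun t : ℝ => t ^ 2, fun _ => 1] : Fin 2 → ℝ → ℝ) i (x i) := by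
      funext x; simp
    rw [hres, e]
    constructor
    · refine Integrable.fintype_prod fun i => ?_
      fin_cases i
      · exact hint1 0
      · exact hintc 1
    · rw [integral_fintype_prod_eq_prod, Fin.prod_univ_two]
      simp only [Matrix.cons_val_zero, Matrix.cons_val_one]
      rw [h1d, h1c, mul_one]
  have hB : Integrable (fun x : Fin 2 → ℝ => (x 1) ^ 2) (volume.restrict (Set.univ.pi I)) ∧
      ∫ x in Set.univ.pi I, (x 1) ^ 2 = (z 1 : ℝ) ^ 2 + 1 / 12 := by
    have e : (fun x : Fin 2 → ℝ => (x 1) ^ 2) =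
        fun x => ∏ i, (![fun _ => 1, fun t : ℝ => t ^ 2] : Fin 2 → ℝ → ℝ) i (x i) := by
      funext x; simp
    rw [hres, e]
    constructor
    · refine Integrable.fintype_prod fun i => ?_
      fin_cases i
      · exact hintc 0
      · exact hint1 1
    · rw [integral_fintype_prod_eq_prod, Fin.prod_univ_two]
      simp only [Matrix.cons_val_zero, Matrix.cons_val_one]
      rw [h1d, h1c, one_mul]
  have hf : (fun u : Plane => ‖u‖ ^ 2) =
      (fun x : Fin 2 → ℝ => (x 0) ^ 2 + (x 1) ^ 2) ∘ (@WithLp.ofLp 2 (Fin 2 → ℝ)) := by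
    funext u; simp [norm_sq_plane]
  refine ⟨?_, ?_, ?_⟩
  · rw [hset, hf, hmp.integrableOn_comp_preimage hemb]
    exact hA.1.add hB.1
  · rw [hset, measureReal_def, hmp.measure_preimage hmI.nullMeasurableSet, hvol]; simp
  · rw [hset, hf]
    refine (hmp.setIntegral_preimage_emb hemb (fun x : Fin 2 → ℝ => (x 0) ^ 2 + (x 1) ^ 2)
      (Set.univ.pi I)).trans ?_
    rw [integral_add hA.1 hB.1, hA.2, hB.2]
    ring

/-- As a function of `t = |u|²`, `|u|^{-α} = t^{-α/2}` is convex. Its tangent at `t = |z|²`,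
averaged over the cell, loses `(α/2) |z|^{-α-2}` times the mean `1/6` of `|u|² - |z|²`. Since `1 < α
< 2` and `|z| ≥ 1`, this is at most `|z|^{-3}/6`. Dropping the cut-off at `r` only decreases the
discrepancy. -/
lemma integral_discrepancy_cell_ge {α r : ℝ} (hα : 1 < α) (hα2 : α < 2) {z : Idx} (hz : z ≠ 0) :
    -(1 / 6) * ‖latticePt 1 z‖ ^ (-3 : ℝ) ≤ ∫ u in {u | rnd 1 u = z}, discrepancy α r u := by
  obtain ⟨h1, h2, h3⟩ := integral_sq_cell z
  set m := ‖latticePt 1 z‖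
  have hm : 1 ≤ m := by simpa using norm_latticePt_ge one_pos hz
  have hm2 : m ^ 2 = (z 0 : ℝ) ^ 2 + (z 1 : ℝ) ^ 2 := by
    rw [norm_sq_latticePt]; simp
  have hfin : volume {u : Plane | rnd 1 u = z} ≠ ⊤ := fun h => by
    rw [measureReal_def, h] at h2; simp at h2
  have hc : IntegrableOn (fun _ : Plane => m ^ 2) {u | rnd 1 u = z} :=
    integrableOn_const hfin
  have hint : IntegrableOn (fun u : Plane => -(α / 2 * m ^ (-α - 2)) * (‖u‖ ^ 2 - m ^ 2))
      {u | rnd 1 u = z} := (h1.sub hc).const_mul _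
  have hmono := setIntegral_mono_on hint (integrable_discrepancy (r := r) hα hα2).integrableOn
    (measurableSet_rnd_eq 1 z) (fun u hu => by
      have hu : rnd 1 u = z := hu
      have hu0 : 0 < ‖u‖ := by
        rw [norm_pos_iff]; rintro rfl
        apply hz; rw [← hu]; funext i; simp [rnd]; norm_num
      have hrp : ‖rp 1 u‖ = m := by rw [rp, hu]
      have hle : ‖u‖ ^ (-α) - m ^ (-α) ≤ discrepancy α r u := by
        rw [discrepancy]
        gcongr
        refine (Set.indicator_le_self' (fun _ _ => Real.rpow_nonneg (norm_nonneg _) _) u).trans ?_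
        rw [hrp]
      refine le_trans ?_ hle
      have ht := tangent_le_rpow_neg (β := α / 2) (by linarith) (by positivity : 0 < m ^ 2)
        (by positivity : 0 < ‖u‖ ^ 2)
      have e : ∀ x : ℝ, 0 ≤ x → ∀ p : ℝ, (x ^ 2) ^ p = x ^ (2 * p) := fun x hx p => by
        rw [← Real.rpow_natCast, ← Real.rpow_mul hx]; norm_num
      rw [e _ (norm_nonneg _), e _ (norm_nonneg _), e _ (norm_nonneg _),
        show 2 * -(α / 2) = -α by ring, show 2 * (-(α / 2) - 1) = -α - 2 by ring] at ht
      linarith)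
  refine le_trans ?_ hmono
  rw [integral_const_mul, integral_sub h1 hc, h3, setIntegral_const, h2, ← hm2, smul_eq_mul]
  have h4 : m ^ (-α - 2) ≤ m ^ (-3 : ℝ) := Real.rpow_le_rpow_of_exponent_le hm (by linarith)
  have h5 : 0 < m ^ (-α - 2) := by positivity
  nlinarith

/-- In the central cell the rounded term is `0 ^ (-α) = 0`, so only the singular part remains. The
disc of radius `1/2` already gives `2π (1/2)^(2-α)/(2-α) ≥ π`, because `0 < 2 - α < 1`. -/
lemma integral_discrepancy_cell_zero_ge {α r : ℝ} (hα : 1 < α) (hα2 : α < 2) :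
    Real.pi ≤ ∫ u in {u | rnd 1 u = 0}, discrepancy α r u := by
  have hD : ∀ u ∈ {u : Plane | rnd 1 u = 0}, discrepancy α r u = ‖u‖ ^ (-α) := by
    intro u hu
    have hu : rnd 1 u = 0 := hu
    have h0 : ‖rp 1 u‖ ^ (-α) = 0 := by
      simp [rp, hu, Real.zero_rpow (by linarith : -α ≠ 0)]
    rw [discrepancy]
    by_cases h : u ∈ (Metric.ball (0 : Plane) r)ᶜ
    · rw [Set.indicator_of_mem h, h0, sub_zero]
    · rw [Set.indicator_of_notMem h, sub_zero]
  have hsub : Metric.ball (0 : Plane) (1 / 2) ⊆ {u | rnd 1 u = 0} := by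
    intro u hu
    have hu : ‖u‖ < 1 / 2 := by simpa using hu
    refine (mem_rnd_one_iff 0 u).2 fun i => ?_
    have := abs_lt.1 ((abs_apply_le_norm u i).trans_lt hu)
    simp only [Pi.zero_apply, Int.cast_zero, Set.mem_Ico]
    constructor <;> linarith
  have hint : IntegrableOn (discrepancy α r) {u | rnd 1 u = 0} :=
    (integrable_discrepancy hα hα2).integrableOn
  calc Real.pi ≤ ∫ u in Metric.ball (0 : Plane) (1 / 2), ‖u‖ ^ (-α) := by
        rw [integral_ball_rpow hα2 (by norm_num)]
        have h1 : (1 / 2 : ℝ) ≤ (1 / 2) ^ (2 - α) := by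
          conv_lhs => rw [← Real.rpow_one (1 / 2 : ℝ)]
          exact Real.rpow_le_rpow_of_exponent_ge (by norm_num) (by norm_num) (by linarith)
        have h2 : 1 / 2 ≤ (1 / 2 : ℝ) ^ (2 - α) / (2 - α) := by
          rw [le_div_iff₀ (by linarith)]; linarith
        nlinarith [Real.pi_pos]
    _ = ∫ u in Metric.ball (0 : Plane) (1 / 2), discrepancy α r u :=
        setIntegral_congr_fun Metric.isOpen_ball.measurableSet fun u hu => (hD u (hsub hu)).symm
    _ ≤ _ := by
        refine setIntegral_mono_set hint ?_ (Eventually.of_forall hsub)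
        refine (ae_restrict_iff' (measurableSet_rnd_eq 1 0)).2 (Eventually.of_forall fun u hu => ?_)
        rw [hD u hu]
        exact Real.rpow_nonneg (norm_nonneg _) _

/-- The shell of sup norm `N + 1` has `8(N+1)` points of norm at least `N + 1`, so it loses at most
`(4/3)/(N+1)²`. As `1/(N+1)² ≤ 1/(N+1/2) - 1/(N+3/2)`, the losses telescope to at most `8/3`; the
last term on the left is the part of that budget not yet spent. -/
lemma sum_idxBox_ge {f : Idx → ℝ} {a : ℝ} (h0 : a ≤ f 0)
    (h : ∀ z ≠ 0, -(1 / 6) * ‖latticePt 1 z‖ ^ (-3 : ℝ) ≤ f z) (N : ℕ) :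
    a - 8 / 3 + 4 / 3 * (1 / (N + 1 / 2 : ℝ)) ≤ ∑ z ∈ idxBox N, f z := by
  induction N with
  | zero =>
    have e : idxBox 0 = {0} := by
      ext z
      simp [mem_idxBox, funext_iff]
    rw [e, Finset.sum_singleton]
    norm_num
    linarith
  | succ N ih =>
    rw [← Finset.sum_sdiff (idxBox_mono (Nat.le_succ N))]
    have hcard : ((idxBox (N + 1) \ idxBox N).card : ℝ) = 8 * (N + 1) := by
      have h1 := Finset.card_sdiff_add_card_eq_card (idxBox_mono (Nat.le_succ N))
      rw [card_idxBox, card_idxBox] at h1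
      have h2 : ((idxBox (N + 1) \ idxBox N).card : ℝ) + (2 * N + 1) ^ 2
        = (2 * (N + 1) + 1) ^ 2 := by exact_mod_cast h1
      linarith
    have hshell : ∀ z ∈ idxBox (N + 1) \ idxBox N, -(1 / 6) * (1 / ((N : ℝ) + 1) ^ 3) ≤ f z := by
      intro z hz
      rw [Finset.mem_sdiff, mem_idxBox (N := N)] at hz
      obtain ⟨-, hz⟩ := hz
      push Not at hz
      obtain ⟨i, hi⟩ := hz
      have hi' : ((N : ℝ) + 1) ≤ |(z i : ℝ)| := by
        have : (N : ℤ) + 1 ≤ |z i| := hi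
        exact_mod_cast this
      have hz0 : z ≠ 0 := by
        rintro rfl; simp at hi; omega
      have hn : (N : ℝ) + 1 ≤ ‖latticePt 1 z‖ := by
        have := abs_apply_le_norm (latticePt 1 z) i
        simp at this
        linarith
      refine le_trans ?_ (h z hz0)
      have h3 : ‖latticePt 1 z‖ ^ (-3 : ℝ) ≤ 1 / ((N : ℝ) + 1) ^ 3 := by
        refine (Real.rpow_le_rpow_of_nonpos (by positivity) hn (by norm_num)).trans (le_of_eq ?_)
        rw [Real.rpow_neg (by positivity), one_div]
        norm_cast
      linarith
    have hs := Finset.card_nsmul_le_sum _ _ _ hshell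
    rw [nsmul_eq_mul, hcard] at hs
    have hk : (4 / 3 : ℝ) * (1 / (((N + 1 : ℕ) : ℝ) + 1 / 2)) ≤ 4 / 3 * (1 / (N + 1 / 2 : ℝ))
        + 8 * (N + 1) * (-(1 / 6) * (1 / ((N : ℝ) + 1) ^ 3)) := by
      have hN : (0 : ℝ) ≤ N := Nat.cast_nonneg N
      push_cast
      have e : 4 / 3 * (1 / (N + 1 / 2 : ℝ)) + 8 * (N + 1) * (-(1 / 6) * (1 / ((N : ℝ) + 1) ^ 3))
        - (4 / 3 : ℝ) * (1 / ((N : ℝ) + 1 + 1 / 2)) =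
        4 / 3 * (1 / ((N + 1 / 2 : ℝ) * (N + 3 / 2)) - 1 / ((N : ℝ) + 1) ^ 2) := by
        field_simp; ring
      have h2 : 1 / ((N : ℝ) + 1) ^ 2 ≤ 1 / ((N + 1 / 2 : ℝ) * (N + 3 / 2)) := by
        gcongr; nlinarith
      linarith
    linarith

/-- Comes down to `π > 8/3`: the central cell gains at least `π` and all the others together lose at
most `8/3`. -/
lemma nnLim_pos {α : ℝ} (r : ℝ) (hα : 1 < α) (hα2 : α < 2) : 0 < nnLim α r := by
  have hint := integrable_discrepancy (r := r) hα hα2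
  have hs := hasSum_integral_iUnion (μ := volume) (f := discrepancy α r)
    (s := fun z : Idx => {u : Plane | rnd 1 u = z})
    (fun z => measurableSet_rnd_eq 1 z)
    (fun z w hzw => Set.disjoint_left.2 fun u (hu : rnd 1 u = z) (hu' : rnd 1 u = w) =>
      hzw (hu.symm.trans hu'))
    hint.integrableOn
  have hU : (⋃ z : Idx, {u : Plane | rnd 1 u = z}) = Set.univ := by
    ext u; simp
  rw [hU, setIntegral_univ] at hs
  have hlim := hs.comp tendsto_idxBox
  have hge : Real.pi - 8 / 3 ≤ ∫ u, discrepancy α r u := by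
    refine ge_of_tendsto' hlim fun N => ?_
    refine le_trans ?_ (sum_idxBox_ge (integral_discrepancy_cell_zero_ge hα hα2)
      (fun z hz => integral_discrepancy_cell_ge hα hα2 hz) N)
    have : 0 ≤ 4 / 3 * (1 / (N + 1 / 2 : ℝ)) := by positivity
    linarith
  have := Real.pi_gt_three
  rw [nnLim]
  linarith

lemma exists_tendsto_normConst {α r M : ℝ} (hα : 1 < α) (hα2 : α < 2) (hM : 0 < M) :
    ∃ c > 0, Tendsto (normConst α r M) atTop (𝓝 c) := by
  set J := ∫ u, (Metric.ball (0 : Plane) r)ᶜ.indicator (fun u => ‖rp 1 u‖ ^ (-(2 + α))) u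
  have hJ : 0 ≤ J := integral_nonneg fun u =>
    Set.indicator_nonneg (fun _ _ => Real.rpow_nonneg (norm_nonneg _) _) u
  have hpos := nnLim_pos r hα hα2
  have h : Tendsto (fun n => (normConst α r M n)⁻¹) atTop (𝓝 (4 * nnLim α r + J)) := by
    refine (((tendsto_nnConst hα hα2 hM).const_mul 4).add (tendsto_setIntegral_ball_mul hM
      (integrable_rp_tail (r := r) hα))).congr' ?_
    filter_upwards [eventually_gt_atTop 0] with n hn
    exact (inv_normConst (by linarith) hn).symm
  refine ⟨(4 * nnLim α r + J)⁻¹, by positivity, ?_⟩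
  simpa using h.inv₀ (by positivity)

lemma limConst_pos {α r M : ℝ} (hα : 1 < α) (hα2 : α < 2) (hM : 0 < M) :
    0 < limConst α r M ∧ Tendsto (normConst α r M) atTop (𝓝 (limConst α r M)) := by
  obtain ⟨c, hc, h⟩ := exists_tendsto_normConst (r := r) hα hα2 hM
  rw [limConst, h.limUnder_eq]
  exact ⟨hc, h⟩

/-! ### The jump kernel -/

/-- The jump rates `n^α p_n`. -/
def kern (α r M : ℝ) (n : ℕ) (z : Idx) : ℝ := (n : ℝ) ^ α * jumpProb α r M n z

/-- The scales at which the lattice constants are close to their limits. -/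
structure GoodScale (α r M : ℝ) (n : ℕ) : Prop where
  pos : 0 < n
  one_div_lt : 1 / (n : ℝ) < M
  le_nn : nnLim α r / 2 ≤ nnConst α r M n
  nn_le : nnConst α r M n ≤ 2 * nnLim α r
  le_norm : limConst α r M / 2 ≤ normConst α r M n
  norm_le : normConst α r M n ≤ 2 * limConst α r M

/-- The standing assumptions on the parameters. -/
structure Params (α r M : ℝ) : Prop where
  one_lt : 1 < α
  lt_two : α < 2
  r_pos : 0 < r
  r_lt : r < M

section
variable {α r M : ℝ} (hp : Params α r M)
include hp

lemma Params.M_pos : 0 < M := hp.r_pos.trans hp.r_lt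

lemma Params.α_pos : 0 < α := by linarith [hp.one_lt]

lemma Params.nnLim_pos : 0 < nnLim α r := Sandpile.nnLim_pos r hp.one_lt hp.lt_two

lemma Params.limConst_pos : 0 < limConst α r M :=
  (Sandpile.limConst_pos hp.one_lt hp.lt_two hp.M_pos).1

lemma Params.tendsto_normConst : Tendsto (normConst α r M) atTop (𝓝 (limConst α r M)) :=
  (Sandpile.limConst_pos hp.one_lt hp.lt_two hp.M_pos).2

lemma eventually_goodScale : ∀ᶠ n in atTop, GoodScale α r M n := by
  have h1 := tendsto_nnConst (r := r) hp.one_lt hp.lt_two hp.M_pos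
  have h2 := hp.tendsto_normConst
  have h3 : Tendsto (fun n : ℕ => 1 / (n : ℝ)) atTop (𝓝 0) := tendsto_one_div_atTop_nhds_zero_nat
  have k := hp.nnLim_pos
  have c := hp.limConst_pos
  filter_upwards [eventually_gt_atTop 0, h3.eventually_lt_const hp.M_pos,
    h1.eventually_const_le (by linarith : nnLim α r / 2 < nnLim α r),
    h1.eventually_le_const (by linarith : nnLim α r < 2 * nnLim α r),
    h2.eventually_const_le (by linarith : limConst α r M / 2 < limConst α r M),
    h2.eventually_le_const (by linarith : limConst α r M < 2 * limConst α r M)]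
    with n a b c d e f using ⟨a, b, c, d, e, f⟩

end

/-! ### Symmetry and positivity of the jump rates, and their exact second moment. -/

lemma cellFraction_neg (r M : ℝ) (n : ℕ) (z : Idx) :
    cellFraction r M n (-z) = cellFraction r M n z := by
  have e : cell n (-z) ∩ (Metric.ball 0 M \ Metric.ball 0 (r / n))
      = -(cell n z ∩ (Metric.ball 0 M \ Metric.ball 0 (r / n))) := by
    ext x
    have : ∀ i, |x i - ((-z) i : ℤ) / (n : ℝ)| = |(-x) i - (z i : ℝ) / n| := fun i => by
      rw [← abs_neg]; congr 1; simp; ring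
    have h0 := this 0
    have h1 := this 1
    simp only [Pi.neg_apply, PiLp.neg_apply, Int.cast_neg] at h0 h1
    simp [cell, h0, h1]
  rw [cellFraction, e, measureReal_def, Measure.measure_neg]
  rfl

lemma kern_neg (α r M : ℝ) (n : ℕ) (z : Idx) : kern α r M n (-z) = kern α r M n z := by
  simp [kern, jumpProb, jumpWeight, cellFraction_neg, latticePt_neg]

lemma cellFraction_nonneg (r M : ℝ) (n : ℕ) (z : Idx) : 0 ≤ cellFraction r M n z :=
  mul_nonneg (by positivity) measureReal_nonneg

section
variable {α r M : ℝ} (hp : Params α r M) {n : ℕ} (hn : GoodScale α r M n)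
include hp hn

lemma GoodScale.nn_pos : 0 < nnConst α r M n := by
  have := hp.nnLim_pos; have := hn.le_nn; linarith

lemma GoodScale.norm_pos : 0 < normConst α r M n := by
  have := hp.limConst_pos; have := hn.le_norm; linarith

lemma kern_nonneg (z : Idx) : 0 ≤ kern α r M n z := by
  refine mul_nonneg (by positivity) ?_
  rw [jumpProb]
  split_ifs
  · exact le_rfl
  · refine mul_nonneg (hn.norm_pos hp).le (add_nonneg (mul_nonneg (hn.nn_pos hp).le ?_)
      (div_nonneg (cellFraction_nonneg _ _ _ _) (by positivity)))
    split_ifs <;> norm_num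

omit hp in
lemma nnSet_subset_jumpRange {z : Idx} (hz : z ∈ nnSet) : z ∈ jumpRange M n := by
  left
  simpa [latticeRestrict, (norm_latticePt_eq_iff hn.pos z).2 hz] using hn.one_div_lt

omit hp in
lemma jumpProb_eq_zero {z : Idx} (hz : z ∉ jumpRange M n) : jumpProb α r M n z = 0 := by
  rw [jumpProb]
  split_ifs
  · rfl
  · rw [jumpWeight, cellFraction_eq_zero hz, if_neg fun h =>
      hz (nnSet_subset_jumpRange hn ((norm_latticePt_eq_iff hn.pos z).1 h))]
    simp

omit hp in
lemma finsum_jumpProb (g : Idx → ℝ) : (n : ℝ) ^ α * ∑ᶠ z ∈ jumpRange M n, jumpProb α r M n z * g z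
    = ∑ z ∈ latBox M n, kern α r M n z * g z := by
  rw [finsum_mem_eq_sum (S := latBox M n), Finset.mul_sum]
  · exact Finset.sum_congr rfl fun z _ => by rw [kern, mul_assoc]
  · exact fun z hz _ => jumpRange_subset_latBox hn.pos hz
  · exact fun z hz => by rw [jumpProb_eq_zero hn hz, zero_mul]

omit hp in
lemma discLap_eq (f : Idx → ℝ) (x : Idx) :
    discLap α r M n f x = ∑ z ∈ latBox M n, kern α r M n z * (f (x + z) - f x) :=
  finsum_jumpProb hn _

omit hp in
lemma discSymbol_eq (θ : Plane) : discSymbol α r M n θ =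
    ∑ z ∈ latBox M n, kern α r M n z * (1 - Real.cos (inner ℝ θ (latticePt n z))) :=
  finsum_jumpProb hn _

/-- Sums against the jump rates as integrals. -/
lemma sum_kern (g : Idx → ℝ) : ∑ z ∈ latBox M n, kern α r M n z * g z =
    (n : ℝ) ^ α * normConst α r M n * nnConst α r M n * ∑ z ∈ nnSet, g z +
    normConst α r M n * ∫ y in annulus r M n, g (rnd n y) * ‖rp n y‖ ^ (-(2 + α)) := by
  have hα := hp.α_pos
  have hn' : (0 : ℝ) < n := by exact_mod_cast hn.pos
  have h0 : (0 : ℝ) ≠ (n : ℝ)⁻¹ := by positivity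
  have e : ∀ z, kern α r M n z * g z = (if z ∈ nnSet then
      (n : ℝ) ^ α * normConst α r M n * nnConst α r M n * g z else 0) +
      cellFraction r M n z * (normConst α r M n * ((n : ℝ) ^ 2)⁻¹ *
        (g z * ‖latticePt n z‖ ^ (-(2 + α)))) := by
    intro z
    rw [kern, jumpProb]
    by_cases hz : z = 0
    · have : (0 : Idx) ∉ nnSet := by decide
      simp [hz, this, Real.zero_rpow (by linarith : -α + -2 ≠ 0)]
    · rw [if_neg hz, jumpWeight, Real.rpow_neg (norm_nonneg _), Real.rpow_add hn', Real.rpow_two]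
      simp only [norm_latticePt_eq_iff hn.pos]
      split_ifs <;> field_simp <;> ring
  have hnn : nnSet ⊆ latBox M n := fun z hz =>
    jumpRange_subset_latBox hn.pos (nnSet_subset_jumpRange hn hz)
  rw [Finset.sum_congr rfl fun z _ => e z, Finset.sum_add_distrib, Finset.sum_ite_mem,
    Finset.inter_eq_right.2 hnn, ← Finset.mul_sum]
  congr 1
  rw [sum_cellFraction hn.pos fun z => normConst α r M n * ((n : ℝ) ^ 2)⁻¹ *
        (g z * ‖latticePt n z‖ ^ (-(2 + α))), integral_const_mul]
  field_simp
  rfl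

/-- This identity is the purpose of `k_n`: the four neighbours carry exactly the second moment by
which the Riemann sum of `|y|^{-α}` falls short of its integral. -/
lemma discSigmaSq_eq : discSigmaSq α r M n =
    normConst α r M n * ∫ y in Metric.ball (0 : Plane) M, 1 / ‖y‖ ^ α := by
  have hα := hp.α_pos
  have hn' : (0 : ℝ) < n := by exact_mod_cast hn.pos
  have h1 : ∑ᶠ z ∈ jumpRange M n \ {0}, cellFraction r M n z / ‖latticePt n z‖ ^ α
      = (n : ℝ) ^ 2 * ∫ x in annulus r M n, ‖rp n x‖ ^ (-α) := by
    rw [finsum_mem_eq_sum (S := latBox M n)]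
    · refine Eq.trans ?_ (sum_cellFraction hn.pos fun z => ‖latticePt n z‖ ^ (-α))
      exact Finset.sum_congr rfl fun z _ => by
        rw [Real.rpow_neg (norm_nonneg _), div_eq_mul_inv]
    · exact fun z hz _ => jumpRange_subset_latBox hn.pos hz.1
    · intro z hz
      by_cases h : z = 0
      · simp [h, Real.zero_rpow hα.ne']
      · rw [cellFraction_eq_zero fun h' => hz ⟨h', h⟩, zero_div]
  have h2 : ∀ y : Plane, ‖rp n y‖ ^ 2 * ‖rp n y‖ ^ (-(2 + α)) = ‖rp n y‖ ^ (-α) := by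
    intro y
    rcases (norm_nonneg (rp n y)).eq_or_lt with h | h
    · rw [← h, Real.zero_rpow (by linarith : -α ≠ 0)]; simp
    · rw [← Real.rpow_two, ← Real.rpow_add h]; congr 1; ring
  rw [discSigmaSq, discLap_eq hn]
  simp only [zero_add, latticePt_zero, norm_zero, ne_eq, OfNat.ofNat_ne_zero, not_false_eq_true,
    zero_pow, sub_zero]
  rw [sum_kern hp hn]
  have h3 : ∑ z ∈ nnSet, ‖latticePt n z‖ ^ 2 = 4 / (n : ℝ) ^ 2 := by
    rw [Finset.sum_congr rfl fun z hz => by rw [(norm_latticePt_eq_iff hn.pos z).2 hz],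
      Finset.sum_const, card_nnSet]
    simp; ring
  have h4 : ∫ y in annulus r M n, ‖latticePt n (rnd n y)‖ ^ 2 * ‖rp n y‖ ^ (-(2 + α))
      = ∫ x in annulus r M n, ‖rp n x‖ ^ (-α) := integral_congr_ae (Eventually.of_forall h2)
  rw [h3, h4, nnConst, h1, Real.rpow_sub hn', Real.rpow_two]
  have : (0 : ℝ) < (n : ℝ) ^ α := by positivity
  field_simp
  ring

end

section
variable {α r M : ℝ} (hp : Params α r M)
include hp

lemma Params.integral_ball_pos : 0 < ∫ y in Metric.ball (0 : Plane) M, 1 / ‖y‖ ^ α := by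
  simp only [one_div_rpow_norm]
  rw [integral_ball_rpow hp.lt_two hp.M_pos.le]
  have := hp.M_pos
  have : 0 < 2 - α := by linarith [hp.lt_two]
  positivity

lemma Params.sigmaSq_pos : 0 < sigmaSq α r M := mul_pos hp.limConst_pos hp.integral_ball_pos

lemma discSigmaSq_bounds {n : ℕ} (hn : GoodScale α r M n) :
    sigmaSq α r M / 2 ≤ discSigmaSq α r M n ∧ discSigmaSq α r M n ≤ 2 * sigmaSq α r M := by
  have := hp.integral_ball_pos
  rw [discSigmaSq_eq hp hn, sigmaSq]
  constructor
  · have := mul_le_mul_of_nonneg_right hn.le_norm this.le; linarith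
  · have := mul_le_mul_of_nonneg_right hn.norm_le this.le; linarith

lemma discSigmaSq_pos {n : ℕ} (hn : GoodScale α r M n) : 0 < discSigmaSq α r M n := by
  have := (discSigmaSq_bounds hp hn).1
  have := hp.sigmaSq_pos
  linarith

lemma tendsto_discSigmaSq : Tendsto (discSigmaSq α r M) atTop (𝓝 (sigmaSq α r M)) := by
  refine (hp.tendsto_normConst.mul_const _).congr' ?_
  filter_upwards [eventually_goodScale hp] with n hn
  exact (discSigmaSq_eq hp hn).symm

/-! ### Consistency of the discrete operator -/

omit hp in
-- Symmetry of the jumps replaces first differences by second differences, whose quadratic size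
-- makes the weight `|y|^{-(2+α)}` integrable at the origin.
lemma sum_kern_symm {n : ℕ} (hn : GoodScale α r M n) (f : Idx → ℝ) (x : Idx) :
    discLap α r M n f x =
      ∑ z ∈ latBox M n, kern α r M n z * ((f (x + z) + f (x - z) - 2 * f x) / 2) := by
  have h := sum_idxBox_neg ⌈(n : ℝ) * (M + 2)⌉₊ fun z => kern α r M n z * (f (x + z) - f x)
  simp only [kern_neg] at h
  change ∑ z ∈ latBox M n, _ = ∑ z ∈ latBox M n, _ at h
  rw [discLap_eq hn]
  have e : ∀ z, kern α r M n z * ((f (x + z) + f (x - z) - 2 * f x) / 2) =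
      (kern α r M n z * (f (x + z) - f x) + kern α r M n z * (f (x + -z) - f x)) / 2 := by
    intro z; rw [sub_eq_add_neg x z]; ring
  rw [Finset.sum_congr rfl fun z _ => e z, ← Finset.sum_div, Finset.sum_add_distrib, h]
  ring

omit hp in
lemma norm_rp_rpow_neg_le {n : ℕ} (hn : 0 < n) {p : ℝ} (hp0 : 0 < p) (y : Plane) :
    ‖rp n y‖ ^ (-p) ≤ 2 ^ p * ‖y‖ ^ (-p) := by
  by_cases h : rnd n y = 0
  · simp only [rp, h, latticePt_zero, norm_zero, Real.zero_rpow (neg_ne_zero.2 hp0.ne')]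
    positivity
  · rcases (norm_nonneg y).eq_or_lt with hy | hy
    · exfalso
      apply h
      have : y = 0 := norm_eq_zero.1 hy.symm
      funext i; simp [rnd, this]; norm_num
    have h1 : ‖y‖ / 2 ≤ ‖rp n y‖ := by
      have := norm_le_mul_norm_rp hn h
      linarith
    refine (Real.rpow_le_rpow_of_nonpos (by positivity) h1 (by linarith)).trans (le_of_eq ?_)
    rw [Real.div_rpow (norm_nonneg _) zero_le_two, Real.rpow_neg zero_le_two, div_inv_eq_mul,
      mul_comm]

omit hp in
lemma ae_ne_zero_plane (s : Set Plane) : ∀ᵐ y ∂(volume.restrict s), y ≠ (0 : Plane) := by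
  refine ae_restrict_of_ae ?_
  exact compl_mem_ae_iff.2 (measure_singleton (0 : Plane))

/-- The base points move with the scale, and no smoothness of `f` is asked beyond a quadratic bound
on its second differences at those points. This is the form needed for mollified superharmonic
functions, for test functions and for cosines. -/
theorem tendsto_discLap {φ : ℕ → ℕ} (hφ : Tendsto φ atTop atTop) {z : ℕ → Idx} {x : Plane}
    (hz : Tendsto (fun k => latticePt (φ k) (z k)) atTop (𝓝 x)) {f : Plane → ℝ} (hf : Continuous f)
    {C : ℝ} (hC : ∀ k y, ‖y‖ ≤ M + 1 →
      |f (latticePt (φ k) (z k) + y) + f (latticePt (φ k) (z k) - y)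
        - 2 * f (latticePt (φ k) (z k))| ≤ C * ‖y‖ ^ 2) :
    Tendsto (fun k => discLap α r M (φ k) (fun w => f (latticePt (φ k) w)) (z k)) atTop
      (𝓝 (truncLap α r M f x)) := by
  have hα := hp.α_pos
  have hM := hp.M_pos
  have hgood := hφ.eventually (eventually_goodScale hp)
  set p : ℕ → Plane := fun k => latticePt (φ k) (z k) with hpdef
  set g : ℕ → Plane → ℝ := fun k y => (f (p k + y) + f (p k - y) - 2 * f (p k)) / 2 with hg
  have hC0 : 0 ≤ C := by
    have h := (abs_nonneg _).trans (hC 0 (EuclideanSpace.single 0 1) (by simp; linarith))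
    simpa using h
  have hgC : ∀ k y, ‖y‖ ≤ M + 1 → |g k y| ≤ C / 2 * ‖y‖ ^ 2 := fun k y hy => by
    rw [hg]; simp only [abs_div, abs_two]; linarith [hC k y hy]
  have hone : ∀ᶠ k in atTop, 1 / ((φ k : ℕ) : ℝ) ≤ 1 := by
    filter_upwards [hgood] with k hk
    have : (1 : ℝ) ≤ φ k := by exact_mod_cast hk.pos
    rw [div_le_one (by linarith)]; exact this
  -- The nearest-neighbour part has rate of order `n^α` and second differences of order `n^{-2}`, so
  -- it vanishes because `α < 2`.
  have hnn : Tendsto (fun k => ((φ k : ℕ) : ℝ) ^ α * normConst α r M (φ k) *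
      nnConst α r M (φ k) * ∑ w ∈ nnSet, g k (latticePt (φ k) w)) atTop (𝓝 0) := by
    have hlim : Tendsto (fun k => 8 * limConst α r M * nnLim α r * C *
        ((φ k : ℕ) : ℝ) ^ (-(2 - α))) atTop (𝓝 0) := by
      have := ((tendsto_rpow_neg_atTop (by linarith [hp.lt_two] : 0 < 2 - α)).comp
        (tendsto_natCast_atTop_atTop.comp hφ)).const_mul (8 * limConst α r M * nnLim α r * C)
      simpa using this
    refine squeeze_zero_norm' ?_ hlim
    filter_upwards [hgood, hone] with k hk hk1
    have hn' : (0 : ℝ) < φ k := by exact_mod_cast hk.pos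
    have hs : |∑ w ∈ nnSet, g k (latticePt (φ k) w)| ≤ 2 * C * (1 / (φ k : ℝ)) ^ 2 := by
      refine (Finset.abs_sum_le_sum_abs _ _).trans ?_
      refine (Finset.sum_le_card_nsmul _ _ (C / 2 * (1 / (φ k : ℝ)) ^ 2) fun w hw => ?_).trans ?_
      · have hw := (norm_latticePt_eq_iff hk.pos w).2 hw
        rw [← hw]
        exact hgC k _ (by rw [hw]; linarith)
      · rw [card_nnSet]; simp; ring_nf; exact le_rfl
    have hcn := hk.norm_pos hp
    have hkn := hk.nn_pos hp
    rw [Real.norm_eq_abs, abs_mul, abs_of_pos (by positivity)]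
    calc _ ≤ (φ k : ℝ) ^ α * (2 * limConst α r M) * (2 * nnLim α r) *
          (2 * C * (1 / (φ k : ℝ)) ^ 2) := by
          have := hp.limConst_pos
          have := hp.nnLim_pos
          gcongr
          · exact hk.norm_le
          · exact hk.nn_le
      _ = _ := by
          rw [neg_sub, Real.rpow_sub hn', Real.rpow_two]; field_simp; ring
  -- The quadratic bound, taken at the rounded jump, leaves `|rp y|^{-α}`, dominated by `2^α
  -- |y|^{-α}` and hence integrable on the disc.
  have hint : Tendsto (fun k => ∫ y in Metric.ball (0 : Plane) M,
      (annulus r M (φ k)).indicator (fun y => g k (rp (φ k) y) * ‖rp (φ k) y‖ ^ (-(2 + α))) y) atTop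
      (𝓝 (∫ y in Metric.ball (0 : Plane) M,
        (f (x + y) + f (x - y) - 2 * f x) / 2 * ‖y‖ ^ (-(2 + α)))) := by
    refine tendsto_integral_filter_of_dominated_convergence
      (fun y => C / 2 * (2 ^ α * ‖y‖ ^ (-α))) ?_ ?_ ?_ ?_
    · refine Eventually.of_forall fun k => ?_
      refine (Measurable.indicator ?_ (measurableSet_annulus _ _ _)).aestronglyMeasurable
      have hgm : Measurable (g k) := by
        have : Continuous (g k) := by rw [hg]; fun_prop
        exact this.measurable
      exact (hgm.comp (measurable_rp _)).mul (rpow_neg_norm_measurable _ _)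
    · filter_upwards [hgood, hone] with k hk hk1
      refine (ae_restrict_iff' Metric.isOpen_ball.measurableSet).2 (Eventually.of_forall ?_)
      intro y hy
      have hy : ‖y‖ < M := by simpa using hy
      refine (norm_indicator_le_norm_self _ _).trans ?_
      have hr : ‖rp (φ k) y‖ ≤ M + 1 := by
        have h1 := norm_sub_rp_le hk.pos y
        have h3 := norm_le_insert y (rp (φ k) y)
        linarith
      rw [Real.norm_eq_abs, abs_mul, abs_of_nonneg (by positivity : 0 ≤ ‖rp (φ k) y‖ ^ (-(2 + α)))]
      have h2 : ‖rp (φ k) y‖ ^ 2 * ‖rp (φ k) y‖ ^ (-(2 + α)) = ‖rp (φ k) y‖ ^ (-α) := by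
        rcases (norm_nonneg (rp (φ k) y)).eq_or_lt with h | h
        · rw [← h, Real.zero_rpow (by linarith : -α ≠ 0)]; simp
        · rw [← Real.rpow_two, ← Real.rpow_add h]; congr 1; ring
      calc _ ≤ C / 2 * ‖rp (φ k) y‖ ^ 2 * ‖rp (φ k) y‖ ^ (-(2 + α)) := by
            gcongr; exact hgC k _ hr
        _ = C / 2 * ‖rp (φ k) y‖ ^ (-α) := by rw [mul_assoc, h2]
        _ ≤ _ := by
            gcongr
            exact norm_rp_rpow_neg_le hk.pos hα y
    · exact ((integrableOn_ball_rpow hp.lt_two M).const_mul _).const_mul _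
    · filter_upwards [ae_ne_zero_plane (Metric.ball 0 M), ae_restrict_mem
        Metric.isOpen_ball.measurableSet] with y hy hyM
      have hyM : ‖y‖ < M := by simpa using hyM
      have hy0 : 0 < ‖y‖ := norm_pos_iff.2 hy
      have hrp := rp_tendsto hφ y
      have h1 : Tendsto (fun k => g k (rp (φ k) y) * ‖rp (φ k) y‖ ^ (-(2 + α))) atTop
          (𝓝 ((f (x + y) + f (x - y) - 2 * f x) / 2 * ‖y‖ ^ (-(2 + α)))) := by
        refine Tendsto.mul ?_ ?_
        · refine Tendsto.div_const ?_ 2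
          exact (((hf.tendsto _).comp (hz.add hrp)).add ((hf.tendsto _).comp (hz.sub hrp))).sub
            (((hf.tendsto _).comp hz).const_mul 2)
        · exact hrp.norm.rpow_const (Or.inl hy0.ne')
      refine h1.congr' ?_
      have h3 : Tendsto (fun k => r / ((φ k : ℕ) : ℝ)) atTop (𝓝 0) :=
        (tendsto_const_div_atTop_nhds_zero_nat r).comp hφ
      filter_upwards [h3.eventually_lt_const hy0] with k hk
      rw [Set.indicator_of_mem (mem_annulus.2 ⟨hyM, hk.le⟩)]
  have hfin := hnn.add ((hp.tendsto_normConst.comp hφ).mul hint)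
  have hval : 0 + limConst α r M * (∫ y in Metric.ball (0 : Plane) M,
        (f (x + y) + f (x - y) - 2 * f x) / 2 * ‖y‖ ^ (-(2 + α))) = truncLap α r M f x := by
    rw [truncLap, zero_add, div_mul_eq_mul_div, mul_div_assoc, ← integral_div]
    congr 2
    funext y
    rw [Real.rpow_neg (norm_nonneg _)]
    ring
  rw [hval] at hfin
  refine hfin.congr' ?_
  filter_upwards [hgood] with k hk
  rw [sum_kern_symm hk, sum_kern hp hk fun w => (f (latticePt (φ k) (z k + w)) +
    f (latticePt (φ k) (z k - w)) - 2 * f (latticePt (φ k) (z k))) / 2]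
  simp only [latticePt_add, latticePt_sub]
  congr 2
  rw [setIntegral_indicator (measurableSet_annulus _ _ _), Set.inter_eq_right.2]
  · rfl
  · exact fun y hy => Metric.mem_ball.2 (by simpa using (mem_annulus.1 hy).1)

omit hp in
lemma one_sub_cos_le (t : ℝ) : 1 - Real.cos t ≤ t ^ 2 / 2 := by
  linarith [Real.one_sub_sq_div_two_le_cos (x := t)]

/-- The symbol at `θ` is minus the operator applied to `cos(θ·y)` and evaluated at the origin. -/
lemma tendsto_discSymbol (θ : Plane) :
    Tendsto (fun n => discSymbol α r M n θ) atTop (𝓝 (symbol α r M θ)) := by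
  have h := tendsto_discLap hp (φ := id) tendsto_id (z := fun _ => 0) (x := 0)
    (by simp) (f := fun y => Real.cos (inner ℝ θ y)) (by fun_prop) (C := ‖θ‖ ^ 2) (by
      intro k y _
      simp only [latticePt_zero, zero_add, zero_sub, inner_neg_right, Real.cos_neg,
        inner_zero_right, Real.cos_zero]
      have h1 := one_sub_cos_le (inner ℝ θ y)
      have h2 := Real.cos_le_one (inner ℝ θ y)
      have h3 : (inner ℝ θ y) ^ 2 ≤ ‖θ‖ ^ 2 * ‖y‖ ^ 2 := by
        rw [← mul_pow, ← sq_abs]; gcongr; exact abs_real_inner_le_norm _ _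
      rw [abs_le]; constructor <;> nlinarith)
  have e : truncLap α r M (fun y => Real.cos (inner ℝ θ y)) 0 = -symbol α r M θ := by
    rw [truncLap, symbol, ← mul_neg, ← integral_neg, div_mul_eq_mul_div, mul_div_assoc,
      ← integral_div]
    congr 2
    funext y
    simp
    ring
  rw [e] at h
  refine (neg_neg (symbol α r M θ) ▸ h.neg).congr' ?_
  filter_upwards [eventually_goodScale hp] with n hn
  rw [discSymbol_eq hn, id, discLap_eq hn, ← Finset.sum_neg_distrib]
  refine Finset.sum_congr rfl fun z _ => ?_
  simp
  ring

end

/-! ### Bounds on the symbols -/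

/-- Two-sided control of a symbol: ellipticity on the set `D` of frequencies, and regularity. -/
structure SymbolBound (α c C : ℝ) (ψ : Plane → ℝ) (D : Set Plane) : Prop where
  nonneg : ∀ θ, 0 ≤ ψ θ
  lower : ∀ θ ∈ D, c * min (‖θ‖ ^ 2) (‖θ‖ ^ α) ≤ ψ θ
  lip : ∀ θ a, |ψ (θ + a) - ψ (θ - a)| ≤ C * ‖a‖ * ‖θ‖ ^ (α - 1)

/-- The Lipschitz bound is used with the midpoint `(p+q)/2` as centre and `(q-p)/2` as increment. -/
lemma SymbolBound.continuous {α c C : ℝ} {ψ : Plane → ℝ} {D : Set Plane}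
    (h : SymbolBound α c C ψ D) (hα : 1 < α) : Continuous ψ := by
  rw [continuous_iff_continuousAt]
  intro p
  rw [ContinuousAt, tendsto_iff_dist_tendsto_zero]
  have h1 : ∀ q, dist (ψ q) (ψ p) ≤
      C * ‖(1 / 2 : ℝ) • (q - p)‖ * ‖(1 / 2 : ℝ) • (q + p)‖ ^ (α - 1) := by
    intro q
    have h2 := h.lip ((1 / 2 : ℝ) • (q + p)) ((1 / 2 : ℝ) • (q - p))
    have e1 : (1 / 2 : ℝ) • (q + p) + (1 / 2 : ℝ) • (q - p) = q := by module
    have e2 : (1 / 2 : ℝ) • (q + p) - (1 / 2 : ℝ) • (q - p) = p := by module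
    rw [e1, e2] at h2
    exact h2
  refine squeeze_zero (fun _ => dist_nonneg) h1 ?_
  have hc : Continuous fun q : Plane =>
      C * ‖(1 / 2 : ℝ) • (q - p)‖ * ‖(1 / 2 : ℝ) • (q + p)‖ ^ (α - 1) := by
    refine Continuous.mul (by fun_prop) (Continuous.rpow_const (by fun_prop) fun _ => Or.inr ?_)
    linarith
  have := hc.tendsto p
  simpa using this

lemma min_one_le_rpow {s p : ℝ} (hs : 0 ≤ s) (hp : 0 ≤ p) (hp1 : p ≤ 1) : min 1 s ≤ s ^ p := by
  rcases le_total 1 s with h | h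
  · rw [min_eq_left h]; exact Real.one_le_rpow h hp
  · rw [min_eq_right h]
    conv_lhs => rw [← Real.rpow_one s]
    rcases hs.eq_or_lt with h0 | h0
    · rw [← h0, Real.zero_rpow one_ne_zero]; positivity
    · exact Real.rpow_le_rpow_of_exponent_ge h0 h hp1

lemma volume_box (a b : Fin 2 → ℝ) :
    volume {y : Plane | ∀ i, y i ∈ Set.Icc (a i) (b i)} = ∏ i, ENNReal.ofReal (b i - a i) := by
  have hset : {y : Plane | ∀ i, y i ∈ Set.Icc (a i) (b i)} =
      (@WithLp.ofLp 2 (Fin 2 → ℝ)) ⁻¹' (Set.univ.pi fun i => Set.Icc (a i) (b i)) := by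
    ext u; simp only [Set.mem_preimage, Set.mem_univ_pi]; rfl
  rw [hset, (PiLp.volume_preserving_ofLp (Fin 2)).measure_preimage
    (MeasurableSet.univ_pi fun i => measurableSet_Icc).nullMeasurableSet, volume_pi_pi]
  simp [Real.volume_Icc]

lemma measurableSet_box (a b : Fin 2 → ℝ) :
    MeasurableSet {y : Plane | ∀ i, y i ∈ Set.Icc (a i) (b i)} := by
  rw [Set.ofPred_forall]
  refine MeasurableSet.iInter fun i => ?_
  have : Measurable fun y : Plane => y i := by fun_prop
  exact this measurableSet_Icc

/-- A radial majorant of `min 1 (t|y|) |y|^{-(1+α)}`. -/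
def lipMajorant (α t : ℝ) (y : Plane) : ℝ :=
  (Metric.ball (0 : Plane) (1 / t)).indicator (fun y => 4 * t * ‖y‖ ^ (-α)) y +
    (Metric.ball (0 : Plane) (1 / t))ᶜ.indicator (fun y => ‖y‖ ^ (-(1 + α))) y

lemma lipMajorant_nonneg {α t : ℝ} (ht : 0 < t) (y : Plane) : 0 ≤ lipMajorant α t y :=
  add_nonneg (Set.indicator_nonneg (fun _ _ => by positivity) _)
    (Set.indicator_nonneg (fun _ _ => by positivity) _)

lemma integrable_lipMajorant {α t : ℝ} (hα : 1 < α) (hα2 : α < 2) (ht : 0 < t) :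
    Integrable (lipMajorant α t) :=
  (IntegrableOn.integrable_indicator ((integrableOn_ball_rpow hα2 (1 / t)).const_mul (4 * t))
    Metric.isOpen_ball.measurableSet).add ((integrableOn_compl_ball_rpow (by linarith)
      (by positivity)).integrable_indicator Metric.isOpen_ball.measurableSet.compl)

lemma integral_lipMajorant {α t : ℝ} (hα : 1 < α) (hα2 : α < 2) (ht : 0 < t) :
    ∫ y, lipMajorant α t y = (8 * Real.pi / (2 - α) + 2 * Real.pi / (α - 1)) * t ^ (α - 1) := by
  have h1 : 2 - α ≠ 0 := by linarith
  have h2 : α - 1 ≠ 0 := by linarith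
  simp only [lipMajorant]
  rw [integral_add, integral_indicator Metric.isOpen_ball.measurableSet,
    integral_indicator Metric.isOpen_ball.measurableSet.compl, integral_const_mul,
    integral_ball_rpow hα2 (by positivity), integral_compl_ball_rpow (by linarith) (by positivity)]
  · have e1 : (1 / t) ^ (2 - α) = t ^ (α - 1) / t := by
      rw [one_div, Real.inv_rpow ht.le, ← Real.rpow_neg ht.le, ← Real.rpow_sub_one ht.ne']
      congr 1; ring
    have e2 : (1 / t) ^ (2 - (1 + α)) = t ^ (α - 1) := by
      rw [one_div, Real.inv_rpow ht.le, ← Real.rpow_neg ht.le]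
      congr 1; ring
    rw [e1, e2, show 1 + α - 2 = α - 1 by ring]
    field_simp
    ring
  · exact IntegrableOn.integrable_indicator
      ((integrableOn_ball_rpow hα2 (1 / t)).const_mul (4 * t)) Metric.isOpen_ball.measurableSet
  · exact (integrableOn_compl_ball_rpow (by linarith)
      (by positivity)).integrable_indicator Metric.isOpen_ball.measurableSet.compl

/-- The factor `4` in the majorant absorbs `‖rp n y‖ ≤ 4‖y‖`, and `2^(1+α)` pays for rounding inside
the negative power. In the central cell the left side is zero. -/
lemma rounded_le_lipMajorant {α t : ℝ} (hα : 1 < α) (ht : 0 < t) {n : ℕ} (hn : 0 < n) (y : Plane) :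
    min 1 (t * ‖rp n y‖) * ‖rp n y‖ * ‖rp n y‖ ^ (-(2 + α)) ≤ 2 ^ (1 + α) * lipMajorant α t y := by
  by_cases h : rnd n y = 0
  · have : ‖rp n y‖ = 0 := by simp [rp, h]
    rw [this]
    have := lipMajorant_nonneg (α := α) ht y
    simp only [mul_zero, zero_mul]
    positivity
  have hpos : 0 < ‖rp n y‖ := lt_of_lt_of_le (by positivity) (norm_latticePt_ge hn h)
  have e : ‖rp n y‖ * ‖rp n y‖ ^ (-(2 + α)) = ‖rp n y‖ ^ (-(1 + α)) := by
    nth_rewrite 1 [← Real.rpow_one ‖rp n y‖]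
    rw [← Real.rpow_add hpos]; congr 1; ring
  have h1 := norm_rp_le_mul hn h
  have h2 := norm_rp_rpow_neg_le hn (by linarith : 0 < 1 + α) y
  have hy : 0 < ‖y‖ := by nlinarith
  rw [mul_assoc, e]
  refine (mul_le_mul_of_nonneg_left h2 (le_min zero_le_one (by positivity))).trans ?_
  rw [mul_left_comm]
  refine mul_le_mul_of_nonneg_left ?_ (by positivity)
  rw [lipMajorant]
  by_cases hb : y ∈ Metric.ball (0 : Plane) (1 / t)
  · rw [Set.indicator_of_mem hb, Set.indicator_of_notMem (by simpa using hb), add_zero]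
    have e2 : ‖y‖ ^ (-α) = ‖y‖ * ‖y‖ ^ (-(1 + α)) := by
      nth_rewrite 2 [← Real.rpow_one ‖y‖]
      rw [← Real.rpow_add hy]; congr 1; ring
    rw [e2, ← mul_assoc]
    gcongr
    refine (min_le_right _ _).trans ?_
    nlinarith
  · rw [Set.indicator_of_notMem hb, Set.indicator_of_mem (by simpa using hb), zero_add]
    exact mul_le_of_le_one_left (by positivity) (min_le_left _ _)

section
variable {α r M : ℝ} (hp : Params α r M)
include hp

/-- The identity `cos((θ-a)·y) - cos((θ+a)·y) = 2 sin(θ·y) sin(a·y)` bounds the increment by `2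
min(1, |θ||y|) |a||y|`, with no smallness of `a` required. Integrated against `|y|^{-(2+α)}` this
gives `|a||θ|^{α-1}`, by splitting at `|y| = 1/|θ|`. -/
lemma exists_discSymbol_lip : ∃ C : ℝ, 0 ≤ C ∧ ∀ n, GoodScale α r M n → ∀ θ a,
    |discSymbol α r M n (θ + a) - discSymbol α r M n (θ - a)| ≤ C * ‖a‖ * ‖θ‖ ^ (α - 1) := by
  set c := limConst α r M
  set k := nnLim α r
  have hc : 0 < c := hp.limConst_pos
  have hk : 0 < k := hp.nnLim_pos
  have hα := hp.one_lt
  have hα2 := hp.lt_two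
  obtain ⟨B, hBdef⟩ : ∃ B, B = 2 ^ (1 + α) * (8 * Real.pi / (2 - α) + 2 * Real.pi / (α - 1)) :=
    ⟨_, rfl⟩
  have hB : 0 ≤ B := by
    have : 0 < 2 - α := by linarith
    have : 0 < α - 1 := by linarith
    rw [hBdef]
    positivity
  refine ⟨32 * c * k + 4 * c * B, by positivity, fun n hn θ a => ?_⟩
  have hn' : (0 : ℝ) < n := by exact_mod_cast hn.pos
  have hcn := hn.norm_pos hp
  have hkn := hn.nn_pos hp
  -- At `θ = 0` both terms agree because the symbol is even; the radial majorant requires `|θ| > 0`.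
  rcases eq_or_ne θ 0 with rfl | hθ
  · have e : discSymbol α r M n (0 + a) - discSymbol α r M n (0 - a) = 0 := by
      rw [discSymbol_eq hn, discSymbol_eq hn, zero_add, zero_sub]
      simp [inner_neg_left]
    rw [e, abs_zero]
    positivity
  have ht : 0 < ‖θ‖ := norm_pos_iff.2 hθ
  set g : Idx → ℝ := fun z => 2 * ‖a‖ * (min 1 (‖θ‖ * ‖latticePt n z‖) * ‖latticePt n z‖)
  have hsin : ∀ s : ℝ, |Real.sin s| ≤ |s| := fun s => Real.abs_sin_le_abs
  have h1 : |discSymbol α r M n (θ + a) - discSymbol α r M n (θ - a)| ≤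
      ∑ z ∈ latBox M n, kern α r M n z * g z := by
    rw [discSymbol_eq hn, discSymbol_eq hn, ← Finset.sum_sub_distrib]
    refine (Finset.abs_sum_le_sum_abs _ _).trans (Finset.sum_le_sum fun z _ => ?_)
    rw [← mul_sub, abs_mul, abs_of_nonneg (kern_nonneg hp hn z)]
    refine mul_le_mul_of_nonneg_left ?_ (kern_nonneg hp hn z)
    set y := latticePt n z
    have e : (1 - Real.cos (inner ℝ (θ + a) y)) - (1 - Real.cos (inner ℝ (θ - a) y)) =
        2 * (Real.sin (inner ℝ θ y) * Real.sin (inner ℝ a y)) := by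
      rw [inner_add_left, inner_sub_left, Real.cos_add, Real.cos_sub]; ring
    rw [e, abs_mul, abs_two, abs_mul]
    have i1 : |Real.sin (inner ℝ θ y)| ≤ min 1 (‖θ‖ * ‖y‖) :=
      le_min (Real.abs_sin_le_one _) ((hsin _).trans (abs_real_inner_le_norm _ _))
    have i2 : |Real.sin (inner ℝ a y)| ≤ ‖a‖ * ‖y‖ := (hsin _).trans (abs_real_inner_le_norm _ _)
    calc 2 * (|Real.sin (inner ℝ θ y)| * |Real.sin (inner ℝ a y)|)
        ≤ 2 * (min 1 (‖θ‖ * ‖y‖) * (‖a‖ * ‖y‖)) := by gcongr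
      _ = _ := by simp only [g]; ring
  refine h1.trans ?_
  rw [sum_kern hp hn]
  -- With `min 1 s ≤ s^(α-1)` at `s = |θ|/n`, the powers of `n` cancel: `n^α (|θ|/n)^(α-1) (1/n) =
  -- |θ|^(α-1)`.
  have hnn : (n : ℝ) ^ α * normConst α r M n * nnConst α r M n * ∑ z ∈ nnSet, g z ≤
      32 * c * k * ‖a‖ * ‖θ‖ ^ (α - 1) := by
    have hs : ∑ z ∈ nnSet, g z ≤ 8 * ‖a‖ * ((‖θ‖ / n) ^ (α - 1) * (1 / n)) := by
      refine (Finset.sum_le_card_nsmul _ _ (2 * ‖a‖ * ((‖θ‖ / n) ^ (α - 1) * (1 / n)))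
        fun w hw => ?_).trans ?_
      · simp only [g]
        rw [(norm_latticePt_eq_iff hn.pos w).2 hw]
        gcongr
        rw [mul_one_div]
        exact min_one_le_rpow (by positivity) (by linarith) (by linarith)
      · rw [card_nnSet]; simp; ring_nf; exact le_rfl
    calc _ ≤ (n : ℝ) ^ α * (2 * c) * (2 * k) * (8 * ‖a‖ * ((‖θ‖ / n) ^ (α - 1) * (1 / n))) := by
          refine mul_le_mul ?_ hs (Finset.sum_nonneg fun z _ => ?_) (by positivity)
          · exact mul_le_mul (mul_le_mul_of_nonneg_left hn.norm_le (by positivity)) hn.nn_le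
              hkn.le (by positivity)
          · exact mul_nonneg (by positivity) (mul_nonneg (le_min zero_le_one (by positivity))
              (norm_nonneg _))
      _ = _ := by
        rw [Real.div_rpow (norm_nonneg _) hn'.le, Real.rpow_sub_one hn'.ne' α]
        field_simp
        ring
  have hI : ∫ y in annulus r M n, g (rnd n y) * ‖rp n y‖ ^ (-(2 + α)) ≤
      2 * ‖a‖ * B * ‖θ‖ ^ (α - 1) := by
    have hm := (integrable_lipMajorant hα hα2 ht).const_mul (2 * ‖a‖ * 2 ^ (1 + α))
    calc _ ≤ ∫ y in annulus r M n, 2 * ‖a‖ * 2 ^ (1 + α) * lipMajorant α ‖θ‖ y := by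
          refine integral_mono_of_nonneg (Eventually.of_forall fun y => ?_) hm.integrableOn
            (Eventually.of_forall fun y => ?_)
          · simp only [g, Pi.zero_apply]; positivity
          · have := mul_le_mul_of_nonneg_left (rounded_le_lipMajorant hα ht hn.pos y)
              (by positivity : 0 ≤ 2 * ‖a‖)
            simp only [g]
            simp only [rp] at this ⊢
            linarith
      _ ≤ ∫ y, 2 * ‖a‖ * 2 ^ (1 + α) * lipMajorant α ‖θ‖ y :=
          setIntegral_le_integral hm (Eventually.of_forall fun y =>
            mul_nonneg (by positivity) (lipMajorant_nonneg ht y))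
      _ = _ := by
        rw [integral_const_mul, integral_lipMajorant hα hα2 ht, hBdef]; ring
  have hI2 : normConst α r M n * ∫ y in annulus r M n, g (rnd n y) * ‖rp n y‖ ^ (-(2 + α)) ≤
      2 * c * (2 * ‖a‖ * B * ‖θ‖ ^ (α - 1)) :=
    (mul_le_mul_of_nonneg_left hI hcn.le).trans
      (mul_le_mul_of_nonneg_right hn.norm_le (by positivity))
  linarith

lemma discSymbol_nonneg {n : ℕ} (hn : GoodScale α r M n) (θ : Plane) :
    0 ≤ discSymbol α r M n θ := by
  rw [discSymbol_eq hn]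
  exact Finset.sum_nonneg fun z _ => mul_nonneg (kern_nonneg hp hn z)
    (by linarith [Real.cos_le_one (inner ℝ θ (latticePt n z))])

omit hp in
lemma two_div_pi_sq_mul_le {x : ℝ} (hx : |x| ≤ Real.pi) :
    2 / Real.pi ^ 2 * x ^ 2 ≤ 1 - Real.cos x := by
  linarith [Real.cos_le_one_sub_mul_cos_sq hx]

/-- At frequencies comparable with `n` the four nearest neighbours alone give the bound, so the
positive limit of `k_n` is essential. The inequality `1 - cos x ≥ 2x²/π²` applies because `|θ i / n|
≤ π` on the frequency square. -/
lemma discSymbol_lower_high {n : ℕ} (hn : GoodScale α r M n) {K : ℝ} (hK : 0 < K) {θ : Plane}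
    (hθ : θ ∈ freqSquare n) (hθK : n / K ≤ ‖θ‖) :
    limConst α r M * nnLim α r / Real.pi ^ 2 * K ^ (α - 2) * ‖θ‖ ^ α ≤ discSymbol α r M n θ := by
  set c := limConst α r M
  set k := nnLim α r
  have hc : 0 < c := hp.limConst_pos
  have hk : 0 < k := hp.nnLim_pos
  have hn' : (0 : ℝ) < n := by exact_mod_cast hn.pos
  have hcn := hn.norm_pos hp
  have hkn := hn.nn_pos hp
  have hθ0 : 0 < ‖θ‖ := lt_of_lt_of_le (by positivity) hθK
  rw [discSymbol_eq hn, sum_kern hp hn]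
  have h1 : 0 ≤ normConst α r M n * ∫ y in annulus r M n,
      (1 - Real.cos (inner ℝ θ (latticePt n (rnd n y)))) * ‖rp n y‖ ^ (-(2 + α)) := by
    refine mul_nonneg hcn.le (integral_nonneg fun y => mul_nonneg ?_ (by positivity))
    linarith [Real.cos_le_one (inner ℝ θ (latticePt n (rnd n y)))]
  have h2 : ∀ i, 2 / Real.pi ^ 2 * (θ i / n) ^ 2 ≤ 1 - Real.cos (θ i / n) := fun i => by
    refine two_div_pi_sq_mul_le ?_
    rw [abs_div, abs_of_pos hn', div_le_iff₀ hn', mul_comm]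
    exact hθ i
  have h3 : 4 / Real.pi ^ 2 * ‖θ‖ ^ 2 / n ^ 2 ≤
      ∑ z ∈ nnSet, (1 - Real.cos (inner ℝ θ (latticePt n z))) := by
    rw [sum_nnSet, norm_sq_plane]
    simp only [inner_plane, latticePt_apply]
    have a0 := h2 0
    have a1 := h2 1
    simp
    simp only [neg_div, mul_neg, Real.cos_neg]
    simp only [div_eq_mul_inv, one_mul] at a0 a1 ⊢
    rw [mul_pow] at a0 a1
    have : ((n : ℝ) ^ 2)⁻¹ = ((n : ℝ)⁻¹) ^ 2 := by rw [inv_pow]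
    rw [this]
    nlinarith
  have h4 : K ^ (α - 2) * ‖θ‖ ^ α ≤ (n : ℝ) ^ α * ‖θ‖ ^ 2 / n ^ 2 := by
    have e : (n : ℝ) ^ α * ‖θ‖ ^ 2 / n ^ 2 = (‖θ‖ / n) ^ (2 - α) * ‖θ‖ ^ α := by
      rw [Real.div_rpow hθ0.le hn'.le, Real.rpow_sub hθ0, Real.rpow_sub hn', Real.rpow_two,
        Real.rpow_two]
      field_simp
    have e2 : K ^ (α - 2) = (1 / K) ^ (2 - α) := by
      rw [one_div, Real.inv_rpow hK.le, ← Real.rpow_neg hK.le, neg_sub]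
    rw [e, e2]
    gcongr ?_ * _
    refine Real.rpow_le_rpow (by positivity) ?_ (by linarith [hp.lt_two])
    rw [div_le_div_iff₀ hK hn', one_mul]
    rwa [div_le_iff₀ hK] at hθK
  calc _ = (c / 2) * (k / 2) * (4 / Real.pi ^ 2) * (K ^ (α - 2) * ‖θ‖ ^ α) := by ring
    _ ≤ (c / 2) * (k / 2) * (4 / Real.pi ^ 2) * ((n : ℝ) ^ α * ‖θ‖ ^ 2 / n ^ 2) := by gcongr
    _ = (n : ℝ) ^ α * (c / 2) * (k / 2) * (4 / Real.pi ^ 2 * ‖θ‖ ^ 2 / n ^ 2) := by ring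
    _ ≤ (n : ℝ) ^ α * normConst α r M n * nnConst α r M n *
        ∑ z ∈ nnSet, (1 - Real.cos (inner ℝ θ (latticePt n z))) := by
        gcongr
        · exact hn.le_norm
        · exact hn.le_nn
    _ ≤ _ := by linarith

omit hp in
-- The sign `s` makes the two coordinate contributions to `θ·w` add rather than cancel, so `(θ·w)²`
-- is at least `|θ|² T²/256`; and `|θ·w| ≤ |θ|T ≤ 1` allows the quadratic lower bound for `1 - cos`.
lemma symbol_integrand_lower (hα : 0 < α) {T s p₀ p₁ : ℝ} (hT : 0 < T) (hs1 : s ^ 2 = 1) {θ w : Plane}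
    (hs : 0 ≤ s * (θ 0 * θ 1)) (hθT : ‖θ‖ * T ≤ 1) (hp₀ : w 0 = p₀) (hp₁ : s * w 1 = p₁)
    (h1 : T / 16 ≤ p₀) (h2 : p₀ ≤ T / 2) (h3 : T / 16 ≤ p₁) (h4 : p₁ ≤ T / 2) :
    2 / Real.pi ^ 2 * (‖θ‖ ^ 2 * T ^ 2 / 256) * T ^ (-(2 + α)) ≤
      (1 - Real.cos (inner ℝ θ w)) * ‖w‖ ^ (-(2 + α)) := by
  have hwn : ‖w‖ ^ 2 = p₀ ^ 2 + p₁ ^ 2 := by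
    rw [norm_sq_plane, ← hp₁, ← hp₀, mul_pow, hs1, one_mul]
  have hw1 : ‖w‖ ≤ T := by
    apply le_of_sq_le_sq _ hT.le
    rw [hwn]; nlinarith
  have hw2 : 0 < ‖w‖ := by
    rw [norm_pos_iff]; intro h
    have : p₀ = 0 := by simp [← hp₀, h]
    linarith
  have hin : inner ℝ θ w = θ 0 * p₀ + (s * θ 1) * p₁ := by
    rw [inner_plane, ← hp₁, ← hp₀]
    linear_combination -(θ 1 * w 1 * hs1)
  have hsq : ‖θ‖ ^ 2 * T ^ 2 / 256 ≤ (inner ℝ θ w) ^ 2 := by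
    have hθ2 : ‖θ‖ ^ 2 = θ 0 ^ 2 + (s * θ 1) ^ 2 := by
      rw [norm_sq_plane, mul_pow, hs1, one_mul]
    have e1 : (T / 16) ^ 2 ≤ p₀ ^ 2 := by gcongr
    have e2 : (T / 16) ^ 2 ≤ p₁ ^ 2 := by gcongr
    have e3 : 0 ≤ (θ 0 * (s * θ 1)) * (p₀ * p₁) := by
      refine mul_nonneg (by linarith) (mul_nonneg (by linarith) (by linarith))
    rw [hin, hθ2]
    generalize s * θ 1 = b at *
    have f1 := mul_le_mul_of_nonneg_left e1 (sq_nonneg (θ 0))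
    have f2 := mul_le_mul_of_nonneg_left e2 (sq_nonneg b)
    linarith
  have hle : |inner ℝ θ w| ≤ Real.pi := by
    refine (abs_real_inner_le_norm θ w).trans ?_
    have := mul_le_mul_of_nonneg_left hw1 (norm_nonneg θ)
    linarith [Real.pi_gt_three]
  have hcos := two_div_pi_sq_mul_le hle
  have hpow : T ^ (-(2 + α)) ≤ ‖w‖ ^ (-(2 + α)) :=
    Real.rpow_le_rpow_of_nonpos hw2 hw1 (by linarith)
  calc _ ≤ 2 / Real.pi ^ 2 * (inner ℝ θ w) ^ 2 * ‖w‖ ^ (-(2 + α)) := by gcongr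
    _ ≤ _ := mul_le_mul_of_nonneg_right hcos (by positivity)

omit hp in
lemma integrableOn_annulus_rounded {n : ℕ} (hn : 0 < n) (g : Idx → ℝ) :
    IntegrableOn (fun y => g (rnd n y)) (annulus r M n) := by
  obtain ⟨B, hB⟩ := ((latBox M n).finite_toSet.image fun z => ‖g z‖).bddAbove
  refine Measure.integrableOn_of_bounded (M := B) (volume_annulus_ne_top _ _ _)
    (measurable_comp_rnd n g).aestronglyMeasurable ?_
  refine (ae_restrict_iff' (measurableSet_annulus _ _ _)).2 (Eventually.of_forall fun y hy => ?_)
  exact hB ⟨rnd n y, rnd_mem_latBox hn (by linarith [(mem_annulus.1 hy).1]), rfl⟩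

/-- Only jumps in one square of side `T/8`, at distance of order `T` from the origin, are kept. The
choice `T = M/2` yields `|θ|²` at low frequency and `T = 1/|θ|` yields `|θ|^α` in the intermediate
range. -/
lemma discSymbol_lower_low {n : ℕ} (hn : GoodScale α r M n) {T : ℝ} (hT1 : 16 / n ≤ T)
    (hT2 : 8 * r / n ≤ T) (hTM : T ≤ M / 2) {θ : Plane} (hθT : ‖θ‖ * T ≤ 1) :
    limConst α r M / (16384 * Real.pi ^ 2) * ‖θ‖ ^ 2 * T ^ (2 - α) ≤ discSymbol α r M n θ := by
  set c := limConst α r M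
  have hc : 0 < c := hp.limConst_pos
  have hn' : (0 : ℝ) < n := by exact_mod_cast hn.pos
  have hcn := hn.norm_pos hp
  have hkn := hn.nn_pos hp
  have hα := hp.α_pos
  have hT0 : 0 < T := lt_of_lt_of_le (by positivity) hT1
  obtain ⟨s, hs', hs⟩ : ∃ s : ℝ, (s = 1 ∨ s = -1) ∧ 0 ≤ s * (θ 0 * θ 1) := by
    rcases le_total 0 (θ 0 * θ 1) with h | h
    · exact ⟨1, Or.inl rfl, by linarith⟩
    · exact ⟨-1, Or.inr rfl, by linarith⟩
  have hs1 : s ^ 2 = 1 := by rcases hs' with rfl | rfl <;> norm_num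
  -- The window `[T/8, T/4]` leaves room for rounding, which moves coordinates by at most `T/32`
  -- since `16/n ≤ T`; rounded coordinates stay in `[T/16, T/2]`. The bound `8r/n ≤ T` keeps the
  -- window outside `B_{r/n}`.
  obtain ⟨lo, hi, hlen, hlohi⟩ : ∃ lo hi : ℝ, hi - lo = T / 8 ∧
      ∀ y ∈ Set.Icc lo hi, T / 8 ≤ s * y ∧ s * y ≤ T / 4 := by
    rcases hs' with h | h
    · exact ⟨T / 8, T / 4, by ring, fun y hy => by rw [h]; constructor <;> linarith [hy.1, hy.2]⟩
    · exact ⟨-(T / 4), -(T / 8), by ring, fun y hy => by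
        rw [h]; constructor <;> linarith [hy.1, hy.2]⟩
  set E : Set Plane := {y | ∀ i, y i ∈ Set.Icc ((![T / 8, lo] : Fin 2 → ℝ) i)
    ((![T / 4, hi] : Fin 2 → ℝ) i)} with hE
  have hEmeas : MeasurableSet E := measurableSet_box _ _
  have hEvol : volume.real E = (T / 8) ^ 2 := by
    rw [measureReal_def, hE, volume_box, Fin.prod_univ_two]
    simp only [Matrix.cons_val_zero, Matrix.cons_val_one, hlen]
    rw [show T / 4 - T / 8 = T / 8 by ring, ← ENNReal.ofReal_mul (by positivity),
      ENNReal.toReal_ofReal (by positivity)]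
    ring
  have hinv : 1 / (2 * (n : ℝ)) ≤ T / 32 := by
    have : 1 / (2 * (n : ℝ)) = (16 / n) / 32 := by field_simp; norm_num
    rw [this]; gcongr
  have hmem : ∀ y ∈ E, (T / 8 ≤ y 0 ∧ y 0 ≤ T / 4) ∧ (T / 8 ≤ s * y 1 ∧ s * y 1 ≤ T / 4) :=
    fun y hy => ⟨hy 0, hlohi _ (hy 1)⟩
  have hEsub : E ⊆ annulus r M n := by
    intro y hy
    obtain ⟨⟨a1, a2⟩, ⟨b1, b2⟩⟩ := hmem y hy
    have hsq : ‖y‖ ^ 2 = y 0 ^ 2 + (s * y 1) ^ 2 := by rw [norm_sq_plane, mul_pow, hs1, one_mul]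
    rw [mem_annulus]
    constructor
    · apply lt_of_pow_lt_pow_left₀ 2 hp.M_pos.le
      rw [hsq]
      nlinarith
    · refine le_trans ?_ ((a1.trans (le_abs_self _)).trans (abs_apply_le_norm y 0))
      have : r / n = (8 * r / n) / 8 := by ring
      rw [this]; gcongr
  set F : Plane → ℝ := fun y => (1 - Real.cos (inner ℝ θ (latticePt n (rnd n y)))) *
    ‖latticePt n (rnd n y)‖ ^ (-(2 + α)) with hF
  have hF0 : ∀ y, 0 ≤ F y := fun y => mul_nonneg
    (by linarith [Real.cos_le_one (inner ℝ θ (latticePt n (rnd n y)))]) (by positivity)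
  have hFE : ∀ y ∈ E, 2 / Real.pi ^ 2 * (‖θ‖ ^ 2 * T ^ 2 / 256) * T ^ (-(2 + α)) ≤ F y := by
    intro y hy
    obtain ⟨⟨a1, a2⟩, ⟨b1, b2⟩⟩ := hmem y hy
    have c0 := abs_le.1 (abs_rnd_sub_le hn.pos y 0)
    have c1 : |s * y 1 - s * ((rnd n y 1 : ℝ) / n)| ≤ 1 / (2 * n) := by
      have hsabs : |s| = 1 := by rcases hs' with rfl | rfl <;> norm_num
      rw [← mul_sub, abs_mul, hsabs, one_mul]
      exact abs_rnd_sub_le hn.pos y 1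
    have c1 := abs_le.1 c1
    have w0 : latticePt n (rnd n y) 0 = (rnd n y 0 : ℝ) / n := rfl
    have w1 : latticePt n (rnd n y) 1 = (rnd n y 1 : ℝ) / n := rfl
    rw [← w0] at c0
    rw [← w1] at c1
    exact symbol_integrand_lower hα hT0 hs1 hs hθT rfl rfl (by linarith) (by linarith)
      (by linarith) (by linarith)
  have hFint : IntegrableOn F (annulus r M n) :=
    integrableOn_annulus_rounded hn.pos fun z =>
      (1 - Real.cos (inner ℝ θ (latticePt n z))) * ‖latticePt n z‖ ^ (-(2 + α))
  have hEfin : volume E ≠ ⊤ := ((measure_mono hEsub).trans_lt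
    (volume_annulus_ne_top r M n).lt_top).ne
  have hint : 2 / Real.pi ^ 2 * (‖θ‖ ^ 2 * T ^ 2 / 256) * T ^ (-(2 + α)) * (T / 8) ^ 2 ≤
      ∫ y in annulus r M n, F y := by
    calc _ = ∫ y in E, 2 / Real.pi ^ 2 * (‖θ‖ ^ 2 * T ^ 2 / 256) * T ^ (-(2 + α)) := by
          rw [setIntegral_const, hEvol, smul_eq_mul, mul_comm]
      _ ≤ ∫ y in E, F y := setIntegral_mono_on (integrableOn_const hEfin) (hFint.mono_set hEsub)
          hEmeas hFE
      _ ≤ _ := setIntegral_mono_set hFint (Eventually.of_forall hF0) (Eventually.of_forall hEsub)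
  rw [discSymbol_eq hn, sum_kern hp hn]
  have h1 : 0 ≤ (n : ℝ) ^ α * normConst α r M n * nnConst α r M n *
      ∑ z ∈ nnSet, (1 - Real.cos (inner ℝ θ (latticePt n z))) :=
    mul_nonneg (by positivity) (Finset.sum_nonneg fun z _ => by
      linarith [Real.cos_le_one (inner ℝ θ (latticePt n z))])
  have h2 : c / 2 * (2 / Real.pi ^ 2 * (‖θ‖ ^ 2 * T ^ 2 / 256) * T ^ (-(2 + α)) * (T / 8) ^ 2) ≤
      normConst α r M n * ∫ y in annulus r M n, F y := by
    gcongr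
    exact hn.le_norm
  have e : T ^ (2 - α) = T ^ 2 * T ^ 2 * T ^ (-(2 + α)) := by
    rw [← Real.rpow_two, ← Real.rpow_add hT0, ← Real.rpow_add hT0]; congr 1; ring
  rw [e]
  refine le_trans (le_of_eq ?_) (h2.trans (le_add_of_nonneg_left h1))
  ring

lemma exists_discSymbol_lower : ∃ c > 0, ∀ᶠ n in atTop, ∀ θ ∈ freqSquare n,
    c * min (‖θ‖ ^ 2) (‖θ‖ ^ α) ≤ discSymbol α r M n θ := by
  have hM := hp.M_pos
  have hr := hp.r_pos
  have hα2 : 0 < 2 - α := by linarith [hp.lt_two]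
  have hc := hp.limConst_pos
  have hk := hp.nnLim_pos
  have hα := hp.α_pos
  -- This `K` makes `T ≥ K/n` imply both `T ≥ 16/n` and `T ≥ 8r/n`. Frequencies above `n/K` are left
  -- to the nearest neighbours.
  set K : ℝ := 16 + 8 * r
  set c1 := limConst α r M * nnLim α r / Real.pi ^ 2 * K ^ (α - 2)
  set c2 := limConst α r M / (16384 * Real.pi ^ 2)
  set c3 := c2 * (M / 2) ^ (2 - α)
  have hK : 0 < K := by positivity
  have hc1 : 0 < c1 := by positivity
  have hc2 : 0 < c2 := by positivity
  have hc3 : 0 < c3 := by positivity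
  refine ⟨min c1 (min c2 c3), lt_min hc1 (lt_min hc2 hc3), ?_⟩
  have hlim : Tendsto (fun n : ℕ => K / (n : ℝ)) atTop (𝓝 0) :=
    tendsto_const_div_atTop_nhds_zero_nat K
  filter_upwards [eventually_goodScale hp, hlim.eventually_le_const (by positivity : 0 < M / 2)]
    with n hn hnK θ hθ
  have hn' : (0 : ℝ) < n := by exact_mod_cast hn.pos
  have hm0 : 0 ≤ min (‖θ‖ ^ 2) (‖θ‖ ^ α) := le_min (by positivity) (by positivity)
  rcases le_or_gt (n / K) ‖θ‖ with h | h
  · refine le_trans ?_ (discSymbol_lower_high hp hn hK hθ h)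
    exact mul_le_mul (min_le_left _ _) (min_le_right _ _) hm0 hc1.le
  have h16 : 16 / (n : ℝ) ≤ K / n := by gcongr; simp only [K]; linarith
  have h8r : 8 * r / (n : ℝ) ≤ K / n := by gcongr; simp only [K]; linarith
  rcases le_or_gt (‖θ‖ * (M / 2)) 1 with h2 | h2
  · refine le_trans ?_ (discSymbol_lower_low hp hn (h16.trans hnK) (h8r.trans hnK) le_rfl h2)
    rw [show limConst α r M / (16384 * Real.pi ^ 2) * ‖θ‖ ^ 2 * (M / 2) ^ (2 - α) = c3 * ‖θ‖ ^ 2 by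
      simp only [c3, c2]; ring]
    exact mul_le_mul ((min_le_right _ _).trans (min_le_right _ _)) (min_le_left _ _) hm0 hc3.le
  · have hθ0 : 0 < ‖θ‖ := by
      by_contra h0
      have : ‖θ‖ = 0 := le_antisymm (not_lt.1 h0) (norm_nonneg _)
      rw [this, zero_mul] at h2
      linarith
    have hKT : K / n ≤ 1 / ‖θ‖ := by
      rw [div_le_div_iff₀ hn' hθ0]
      rw [lt_div_iff₀ hK] at h
      linarith
    have hTM : 1 / ‖θ‖ ≤ M / 2 := by
      rw [div_le_iff₀ hθ0]; linarith
    refine le_trans ?_ (discSymbol_lower_low hp hn (h16.trans hKT) (h8r.trans hKT) hTM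
      (le_of_eq (mul_one_div_cancel hθ0.ne')))
    have e : ‖θ‖ ^ 2 * (1 / ‖θ‖) ^ (2 - α) = ‖θ‖ ^ α := by
      rw [one_div, Real.inv_rpow hθ0.le, ← Real.rpow_neg hθ0.le, ← Real.rpow_two,
        ← Real.rpow_add hθ0]
      congr 1; ring
    rw [mul_assoc, e]
    exact mul_le_mul ((min_le_right _ _).trans (min_le_left _ _)) (min_le_right _ _) hm0 hc2.le

omit hp in
lemma eventually_mem_freqSquare (θ : Plane) : ∀ᶠ n in atTop, θ ∈ freqSquare n := by
  have h : Tendsto (fun n : ℕ => (n : ℝ) * Real.pi) atTop atTop :=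
    tendsto_natCast_atTop_atTop.atTop_mul_const Real.pi_pos
  filter_upwards [h.eventually_ge_atTop ‖θ‖] with n hn i
  exact (abs_apply_le_norm θ i).trans hn

theorem exists_symbolBound : ∃ c > 0, ∃ C ≥ 0,
    (∀ᶠ n in atTop, SymbolBound α c C (discSymbol α r M n) (freqSquare n)) ∧
      SymbolBound α c C (symbol α r M) Set.univ := by
  obtain ⟨c, hc, h1⟩ := exists_discSymbol_lower hp
  obtain ⟨C, hC, h2⟩ := exists_discSymbol_lip hp
  have hall : ∀ᶠ n in atTop, SymbolBound α c C (discSymbol α r M n) (freqSquare n) := by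
    filter_upwards [h1, eventually_goodScale hp] with n hn hg
    exact ⟨discSymbol_nonneg hp hg, hn, h2 n hg⟩
  refine ⟨c, hc, C, hC, hall, fun θ => ?_, fun θ _ => ?_, fun θ a => ?_⟩
  · refine ge_of_tendsto (tendsto_discSymbol hp θ) ?_
    filter_upwards [hall] with n hn using hn.nonneg θ
  · refine ge_of_tendsto (tendsto_discSymbol hp θ) ?_
    filter_upwards [hall, eventually_mem_freqSquare θ] with n hn hθ using hn.lower θ hθ
  · refine le_of_tendsto ((tendsto_discSymbol hp (θ + a)).sub
      (tendsto_discSymbol hp (θ - a))).abs ?_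
    filter_upwards [hall] with n hn using hn.lip θ a

end

/-! ### Oscillatory integrals -/

lemma one_add_rpow_le {t α : ℝ} (ht : 0 ≤ t) (hα : 0 ≤ α) :
    (1 + t) ^ α ≤ 2 ^ α * max 1 (t ^ α) := by
  rcases le_total t 1 with h | h
  · calc (1 + t) ^ α ≤ 2 ^ α := Real.rpow_le_rpow (by positivity) (by linarith) hα
      _ ≤ _ := le_mul_of_one_le_right (by positivity) (le_max_left _ _)
  · calc (1 + t) ^ α ≤ (2 * t) ^ α := Real.rpow_le_rpow (by positivity) (by linarith) hα
      _ = 2 ^ α * t ^ α := Real.mul_rpow zero_le_two ht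
      _ ≤ _ := by gcongr; exact le_max_right _ _

section
open scoped Pointwise
variable {α c C : ℝ} {ψ : Plane → ℝ} {D : Set Plane}

lemma SymbolBound.resolvent_le (h : SymbolBound α c C ψ D) (hα : 0 < α) (hα2 : α < 2) (hc : 0 < c)
    {θ : Plane} (hθ : θ ∈ D) :
    1 / (1 + ψ θ) ≤ 2 ^ α / min c 1 * (1 + ‖θ‖) ^ (-α) := by
  have h0 := h.nonneg θ
  have h1 := h.lower θ hθ
  have hc1 : 0 < min c 1 := lt_min hc one_pos
  have key : min c 1 * max 1 (‖θ‖ ^ α) ≤ 1 + ψ θ := by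
    rcases le_total ‖θ‖ 1 with ht | ht
    · rw [max_eq_left (Real.rpow_le_one (norm_nonneg _) ht hα.le), mul_one]
      linarith [min_le_right c 1]
    · rw [max_eq_right (Real.one_le_rpow ht hα.le)]
      have : min (‖θ‖ ^ 2) (‖θ‖ ^ α) = ‖θ‖ ^ α := by
        refine min_eq_right ?_
        rw [← Real.rpow_two]
        exact Real.rpow_le_rpow_of_exponent_le ht hα2.le
      rw [this] at h1
      have := mul_le_mul_of_nonneg_right (min_le_left c 1)
        (by positivity : 0 ≤ ‖θ‖ ^ α)
      linarith
  have h2 := one_add_rpow_le (norm_nonneg θ) hα.le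
  rw [Real.rpow_neg (by positivity), ← div_eq_mul_inv, div_div, div_le_div_iff₀ (by linarith)
    (by positivity), one_mul]
  calc min c 1 * (1 + ‖θ‖) ^ α ≤ min c 1 * (2 ^ α * max 1 (‖θ‖ ^ α)) := by gcongr
    _ = 2 ^ α * (min c 1 * max 1 (‖θ‖ ^ α)) := by ring
    _ ≤ _ := by gcongr

lemma SymbolBound.pos (h : SymbolBound α c C ψ D) (hc : 0 < c) {θ : Plane} (hθ : θ ∈ D)
    (h0 : θ ≠ 0) : 0 < ψ θ := by
  have : 0 < ‖θ‖ := norm_pos_iff.2 h0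
  exact lt_of_lt_of_le (by positivity) (h.lower θ hθ)

lemma SymbolBound.min_div_le (h : SymbolBound α c C ψ D) (hα : 0 < α) (hα2 : α < 2) (hc : 0 < c)
    {θ : Plane} (hθ : θ ∈ D) :
    min 1 (‖θ‖ ^ 2) / ψ θ ≤ 2 ^ α / c * (1 + ‖θ‖) ^ (-α) := by
  rcases eq_or_ne θ 0 with rfl | h0
  · simp
    positivity
  have hψ := h.pos hc hθ h0
  have hθ0 : 0 < ‖θ‖ := norm_pos_iff.2 h0
  have h1 := h.lower θ hθ
  have h2 := one_add_rpow_le (norm_nonneg θ) hα.le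
  rw [Real.rpow_neg (by positivity), ← div_eq_mul_inv, div_div, div_le_div_iff₀ hψ (by positivity)]
  have key : min 1 (‖θ‖ ^ 2) * max 1 (‖θ‖ ^ α) ≤ min (‖θ‖ ^ 2) (‖θ‖ ^ α) := by
    rcases le_total ‖θ‖ 1 with ht | ht
    · rw [max_eq_left (Real.rpow_le_one (norm_nonneg _) ht hα.le), mul_one]
      refine le_min (min_le_right _ _) ((min_le_right _ _).trans ?_)
      rw [← Real.rpow_two]
      exact Real.rpow_le_rpow_of_exponent_ge hθ0 ht hα2.le
    · rw [max_eq_right (Real.one_le_rpow ht hα.le), min_eq_left (one_le_pow₀ ht), one_mul]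
      refine le_min ?_ le_rfl
      rw [← Real.rpow_two]
      exact Real.rpow_le_rpow_of_exponent_le ht hα2.le
  calc min 1 (‖θ‖ ^ 2) * (c * (1 + ‖θ‖) ^ α)
      ≤ min 1 (‖θ‖ ^ 2) * (c * (2 ^ α * max 1 (‖θ‖ ^ α))) := by gcongr
    _ = 2 ^ α * (c * (min 1 (‖θ‖ ^ 2) * max 1 (‖θ‖ ^ α))) := by ring
    _ ≤ 2 ^ α * (c * min (‖θ‖ ^ 2) (‖θ‖ ^ α)) := by gcongr
    _ ≤ _ := by gcongr

lemma resolvent_le_one (h : SymbolBound α c C ψ D) (θ : Plane) : 1 / (1 + ψ θ) ≤ 1 := by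
  have := h.nonneg θ
  rw [div_le_one (by linarith)]; linarith

lemma resolvent_nonneg (h : SymbolBound α c C ψ D) (θ : Plane) : 0 ≤ 1 / (1 + ψ θ) := by
  have := h.nonneg θ
  positivity

lemma resolvent_continuous (h : SymbolBound α c C ψ D) (hα : 1 < α) :
    Continuous fun θ => 1 / (1 + ψ θ) :=
  continuous_const.div (continuous_const.add (h.continuous hα)) fun θ => by
    have := h.nonneg θ; positivity

/-- The difference of reciprocals carries two resolvent factors, worth `|θ|^{-2α}` at infinity,
against a growth `|θ|^{α-1}` of the symbol increment. The net exponent `-(1+α)` is integrable in the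
plane. -/
lemma abs_resolvent_sub (h : SymbolBound α c C ψ D) (θ b : Plane) :
    |1 / (1 + ψ (θ - b)) - 1 / (1 + ψ (θ + b))| ≤
      C * ‖b‖ * ‖θ‖ ^ (α - 1) * (1 / (1 + ψ (θ - b)) * (1 / (1 + ψ (θ + b)))) := by
  have h1 := h.nonneg (θ - b)
  have h2 := h.nonneg (θ + b)
  have e : 1 / (1 + ψ (θ - b)) - 1 / (1 + ψ (θ + b)) =
      (ψ (θ + b) - ψ (θ - b)) * (1 / (1 + ψ (θ - b)) * (1 / (1 + ψ (θ + b)))) := by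
    field_simp; ring
  rw [e, abs_mul, abs_of_nonneg (by positivity : 0 ≤ 1 / (1 + ψ (θ - b)) * (1 / (1 + ψ (θ + b))))]
  exact mul_le_mul_of_nonneg_right (h.lip θ b) (by positivity)

lemma one_add_norm_rpow_neg_le (hα : 0 ≤ α) (θ b b' : Plane) (hb : ‖b'‖ = ‖b‖) :
    (1 + ‖θ + b'‖) ^ (-α) ≤ (1 + ‖b‖) ^ α * (1 + ‖θ‖) ^ (-α) := by
  have h1 : ‖θ‖ ≤ ‖θ + b'‖ + ‖b'‖ := by
    have := norm_sub_le (θ + b') b'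
    rwa [add_sub_cancel_right] at this
  have h2 : (1 + ‖θ‖) / (1 + ‖b‖) ≤ 1 + ‖θ + b'‖ := by
    rw [div_le_iff₀ (by positivity)]
    nlinarith [norm_nonneg b, norm_nonneg (θ + b')]
  refine (Real.rpow_le_rpow_of_nonpos (by positivity) h2 (by linarith)).trans (le_of_eq ?_)
  rw [Real.div_rpow (by positivity) (by positivity), Real.rpow_neg (by positivity : 0 ≤ 1 + ‖b‖),
    div_inv_eq_mul, mul_comm]

lemma abs_resolvent_sub_le (h : SymbolBound α c C ψ D) (hα : 1 < α) (hα2 : α < 2) (hc : 0 < c)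
    (hC : 0 ≤ C) {θ b : Plane} (h1 : θ - b ∈ D) (h2 : θ + b ∈ D) :
    |1 / (1 + ψ (θ - b)) - 1 / (1 + ψ (θ + b))| ≤
      C * ‖b‖ * (2 ^ α / min c 1 * (1 + ‖b‖) ^ α) ^ 2 * (1 + ‖θ‖) ^ (-(1 + α)) := by
  refine (abs_resolvent_sub h θ b).trans ?_
  have hα0 : 0 < α := by linarith
  have hc1 : 0 < min c 1 := lt_min hc one_pos
  have n1 := one_add_norm_rpow_neg_le hα0.le θ b (-b) (norm_neg b)
  have n2 := one_add_norm_rpow_neg_le hα0.le θ b b rfl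
  rw [← sub_eq_add_neg] at n1
  have m1 := (h.resolvent_le hα0 hα2 hc h1).trans (mul_le_mul_of_nonneg_left n1 (by positivity))
  have m2 := (h.resolvent_le hα0 hα2 hc h2).trans (mul_le_mul_of_nonneg_left n2 (by positivity))
  have m3 := mul_le_mul m1 m2 (resolvent_nonneg h _) (by positivity)
  have m4 : ‖θ‖ ^ (α - 1) ≤ (1 + ‖θ‖) ^ (α - 1) :=
    Real.rpow_le_rpow (norm_nonneg _) (by linarith) (by linarith)
  have e : (1 + ‖θ‖) ^ (-(1 + α)) =
      (1 + ‖θ‖) ^ (α - 1) * ((1 + ‖θ‖) ^ (-α) * (1 + ‖θ‖) ^ (-α)) := by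
    rw [← Real.rpow_add (by positivity), ← Real.rpow_add (by positivity)]; congr 1; ring
  rw [e]
  have n0 := resolvent_nonneg h (θ - b)
  have n0' := resolvent_nonneg h (θ + b)
  calc _ ≤ C * ‖b‖ * (1 + ‖θ‖) ^ (α - 1) * (2 ^ α / min c 1 * ((1 + ‖b‖) ^ α * (1 + ‖θ‖) ^ (-α)) *
        (2 ^ α / min c 1 * ((1 + ‖b‖) ^ α * (1 + ‖θ‖) ^ (-α)))) := by
        gcongr
    _ = _ := by ring

lemma integrable_one_add_norm_plane {p : ℝ} (hp : 2 < p) :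
    Integrable fun θ : Plane => (1 + ‖θ‖) ^ (-p) :=
  integrable_one_add_norm (by rw [finrank_plane]; exact_mod_cast hp)

/-- The limit of the cut-off oscillatory integrals of the resolvent symbol. -/
def oscLimit (ψ : Plane → ℝ) (x b : Plane) : ℝ :=
  1 / 2 * ∫ θ, Real.sin (inner ℝ θ x) * (1 / (1 + ψ (θ - b)) - 1 / (1 + ψ (θ + b)))

/-- The points of `D` that are moved out of `D` by the translation by `v`. -/
def exitSet (D : Set Plane) (v : Plane) : Set Plane := {θ | θ ∈ D ∧ θ + v ∉ D}

lemma measurableSet_exitSet (hD : MeasurableSet D) (v : Plane) : MeasurableSet (exitSet D v) :=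
  hD.inter ((measurable_add_const v) hD).compl

lemma measureReal_smul_plane (a : ℝ) (S : Set Plane) :
    volume.real (a • S) = a ^ 2 * volume.real S := by
  rw [measureReal_def, Measure.addHaar_smul, ENNReal.toReal_mul,
    ENNReal.toReal_ofReal (abs_nonneg _), finrank_plane, abs_of_nonneg (by positivity),
    measureReal_def]

lemma volume_smul_ne_top {S : Set Plane} (hSv : volume S ≠ ⊤) (a : ℝ) : volume (a • S) ≠ ⊤ := by
  rw [Measure.addHaar_smul]
  exact ENNReal.mul_ne_top ENNReal.ofReal_ne_top hSv

/-- Were the rescaled point in `(1-t)S`, convexity would allow adding any vector of `t B_s`, and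
`v/R` is one. The factor `2` in `t = 2‖v‖/(sR)` makes this inclusion strict. -/
lemma exitSet_smul_subset {S : Set Plane} (hS : Convex ℝ S) {s : ℝ} (hs : 0 < s)
    (hsS : Metric.ball 0 s ⊆ S) {R : ℝ} (hR : 0 < R) {v : Plane} (hv : 2 * ‖v‖ ≤ s * R) :
    exitSet (R • S) v ⊆ R • (S \ (1 - 2 * ‖v‖ / (s * R)) • S) := by
  rintro _ ⟨⟨x, hx, rfl⟩, hθ2⟩
  refine ⟨x, ⟨hx, ?_⟩, rfl⟩
  rintro ⟨y, hy, rfl⟩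
  apply hθ2
  rcases eq_or_ne v 0 with rfl | hv0
  · rw [add_zero]; exact ⟨_, hx, rfl⟩
  have hvn : 0 < ‖v‖ := norm_pos_iff.2 hv0
  obtain ⟨t, ht⟩ : ∃ t, t = 2 * ‖v‖ / (s * R) := ⟨_, rfl⟩
  have htpos : 0 < t := by rw [ht]; positivity
  have ht1 : t ≤ 1 := by rw [ht, div_le_one (by positivity)]; exact hv
  rw [← ht]
  refine ⟨(1 - t) • y + t • ((t * R)⁻¹ • v), ?_, ?_⟩
  · refine hS hy (hsS ?_) (by linarith) htpos.le (by ring)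
    rw [mem_ball_zero_iff, norm_smul, norm_inv, Real.norm_of_nonneg (by positivity),
      inv_mul_lt_iff₀ (by positivity), ht]
    have : 2 * ‖v‖ / (s * R) * R * s = 2 * ‖v‖ := by field_simp
    rw [this]; linarith
  · have e : R * (t * (t * R)⁻¹) = 1 := by field_simp
    change R • ((1 - t) • y + t • ((t * R)⁻¹ • v)) = R • ((1 - t) • y) + v
    rw [smul_add, smul_smul t, smul_smul R (t * (t * R)⁻¹), e, one_smul]

lemma volume_exitSet_le {S : Set Plane} (hS : Convex ℝ S) (hSm : MeasurableSet S)
    (hSv : volume S ≠ ⊤) {s : ℝ} (hs : 0 < s) (hsS : Metric.ball 0 s ⊆ S) {R : ℝ} (hR : 0 < R)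
    {v : Plane} (hv : 2 * ‖v‖ ≤ s * R) :
    volume.real (exitSet (R • S) v) ≤ 4 / s * volume.real S * (‖v‖ * R) := by
  have hsub := exitSet_smul_subset hS hs hsS hR hv
  obtain ⟨t, ht⟩ : ∃ t, t = 2 * ‖v‖ / (s * R) := ⟨_, rfl⟩
  have ht0 : 0 ≤ t := by rw [ht]; positivity
  have ht1 : t ≤ 1 := by rw [ht, div_le_one (by positivity)]; exact hv
  rw [← ht] at hsub
  have h0 : (0 : Plane) ∈ S := hsS (by simpa using hs)
  have hsub2 : (1 - t) • S ⊆ S := by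
    rintro _ ⟨x, hx, rfl⟩
    exact hS.smul_mem_of_zero_mem h0 hx ⟨by linarith, by linarith⟩
  have hfin : volume (R • (S \ (1 - t) • S)) ≠ ⊤ := volume_smul_ne_top
    ((measure_mono Set.sdiff_subset).trans_lt hSv.lt_top).ne R
  refine (measureReal_mono hsub hfin).trans ?_
  have hm : MeasurableSet ((1 - t) • S) := by
    rcases eq_or_ne (1 - t) 0 with h | h
    · rw [h, Set.zero_smul_set ⟨0, h0⟩]; exact measurableSet_singleton _
    · exact hSm.const_smul_of_ne_zero h
  rw [measureReal_smul_plane, measureReal_sdiff hsub2 hm hSv, measureReal_smul_plane]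
  have hV : 0 ≤ volume.real S := measureReal_nonneg
  generalize volume.real S = V at *
  have hsq : R ^ 2 * V * (2 * t) = 4 / s * V * (‖v‖ * R) := by rw [ht]; field_simp; ring
  rw [← hsq]
  have : 0 ≤ R ^ 2 * V * t ^ 2 := by positivity
  linarith

lemma norm_ge_of_mem_exitSet {s R : ℝ} {v θ : Plane} (hsD : Metric.ball 0 (s * R) ⊆ D)
    (hv : 2 * ‖v‖ ≤ s * R) (hθ : θ ∈ exitSet D v) : s * R / 2 ≤ ‖θ‖ := by
  have h1 : s * R ≤ ‖θ + v‖ := by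
    by_contra h
    exact hθ.2 (hsD (by simpa using h))
  have := norm_add_le θ v
  linarith

/-- Separates the genuine difference, where both translates stay in `D`, from the thin boundary
layers where only one of them does. -/
lemma indicator_resolvent_sub (D : Set Plane) (N : Plane → ℝ) (θ b : Plane) :
    D.indicator N (θ - b) - D.indicator N (θ + b) =
      {θ | θ - b ∈ D ∧ θ + b ∈ D}.indicator (fun θ => N (θ - b) - N (θ + b)) θ +
      (exitSet D ((2 : ℝ) • b)).indicator N (θ - b) -
      (exitSet D (-((2 : ℝ) • b))).indicator N (θ + b) := by
  have e1 : θ - b + (2 : ℝ) • b = θ + b := by module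
  have e2 : θ + b + -((2 : ℝ) • b) = θ - b := by module
  by_cases h1 : θ - b ∈ D <;> by_cases h2 : θ + b ∈ D <;>
    simp [Set.indicator, exitSet, h1, h2, e1, e2]

/-- Translation by `b` turns `cos` into `-sin`, and by `-b` into `sin`; averaging the two
expressions exhibits the difference of translated resolvents. It is an integration by parts that
needs no derivative of the symbol. -/
lemma oscillatory_identity (hα : 1 < α) (h : SymbolBound α c C ψ D) (hD : MeasurableSet D)
    (hDv : volume D ≠ ⊤) {x b : Plane} (hb : inner ℝ b x = Real.pi / 2) :
    ∫ θ in D, Real.cos (inner ℝ θ x) / (1 + ψ θ) = 1 / 2 * ∫ θ, Real.sin (inner ℝ θ x) *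
      (D.indicator (fun θ => 1 / (1 + ψ θ)) (θ - b) -
        D.indicator (fun θ => 1 / (1 + ψ θ)) (θ + b)) := by
  set N : Plane → ℝ := D.indicator fun θ => 1 / (1 + ψ θ) with hN
  have hNint : Integrable N := by
    refine IntegrableOn.integrable_indicator ?_ hD
    refine Measure.integrableOn_of_bounded (M := 1) hDv
      (resolvent_continuous h hα).aestronglyMeasurable (Eventually.of_forall fun θ => ?_)
    rw [Real.norm_of_nonneg (resolvent_nonneg h θ)]
    exact resolvent_le_one h θ
  have hsin : ∀ v : Plane, Integrable fun θ => Real.sin (inner ℝ θ x) * N (θ + v) := fun v => by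
    refine (hNint.comp_add_right v).bdd_mul (c := 1) (by fun_prop)
      (Eventually.of_forall fun θ => ?_)
    exact Real.abs_sin_le_one _
  have h0 : ∫ θ in D, Real.cos (inner ℝ θ x) / (1 + ψ θ) = ∫ θ, Real.cos (inner ℝ θ x) * N θ := by
    rw [← integral_indicator hD]
    congr 1
    funext θ
    by_cases hθ : θ ∈ D <;> simp [hN, hθ, div_eq_mul_inv]
  have h1 : ∫ θ, Real.cos (inner ℝ θ x) * N θ = -∫ θ, Real.sin (inner ℝ θ x) * N (θ + b) := by
    rw [← integral_add_right_eq_self _ b, ← integral_neg]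
    congr 1
    funext θ
    rw [inner_add_left, hb, Real.cos_add_pi_div_two]
    ring
  have h2 : ∫ θ, Real.cos (inner ℝ θ x) * N θ = ∫ θ, Real.sin (inner ℝ θ x) * N (θ - b) := by
    rw [← integral_sub_right_eq_self _ b]
    congr 1
    funext θ
    rw [inner_sub_left, hb, Real.cos_sub_pi_div_two]
  have h3 : ∫ θ, Real.sin (inner ℝ θ x) * (N (θ - b) - N (θ + b)) =
      (∫ θ, Real.sin (inner ℝ θ x) * N (θ - b)) - ∫ θ, Real.sin (inner ℝ θ x) * N (θ + b) := by
    simp only [mul_sub]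
    exact integral_sub (by simpa [sub_eq_add_neg] using hsin (-b)) (hsin b)
  rw [h3, h0]
  linarith

/-- The layer has area of order `‖v‖R` and the resolvent there is of order `R^{-α}`, so the
contribution `‖v‖ R^{1-α}` vanishes as `R` grows. -/
lemma integral_exitSet_le (h : SymbolBound α c C ψ D) (hα : 1 < α) (hα2 : α < 2) (hc : 0 < c)
    {S : Set Plane} (hS : Convex ℝ S) (hSm : MeasurableSet S)
    (hSv : volume S ≠ ⊤) {s : ℝ} (hs : 0 < s) (hsS : Metric.ball 0 s ⊆ S) {R : ℝ} (hR : 0 < R)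
    (hDS : D = R • S) {v : Plane} (hv : 2 * ‖v‖ ≤ s * R) :
    Integrable ((exitSet D v).indicator fun θ => 1 / (1 + ψ θ)) ∧
    ∫ θ, (exitSet D v).indicator (fun θ => 1 / (1 + ψ θ)) θ ≤
      2 ^ α / min c 1 * (s / 2) ^ (-α) * (4 / s * volume.real S) * (‖v‖ * R ^ (1 - α)) := by
  have hD : MeasurableSet D := by rw [hDS]; exact hSm.const_smul_of_ne_zero hR.ne'
  have hDv : volume D ≠ ⊤ := by
    rw [hDS, Measure.addHaar_smul]
    exact ENNReal.mul_ne_top ENNReal.ofReal_ne_top hSv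
  have hEm := measurableSet_exitSet hD v
  have hEv : volume (exitSet D v) ≠ ⊤ :=
    ((measure_mono fun θ hθ => hθ.1).trans_lt hDv.lt_top).ne
  have hsD : Metric.ball 0 (s * R) ⊆ D := by
    rw [hDS, mul_comm s R]
    intro θ hθ
    refine ⟨R⁻¹ • θ, hsS ?_, smul_inv_smul₀ hR.ne' θ⟩
    rw [mem_ball_zero_iff] at hθ ⊢
    rw [norm_smul, norm_inv, Real.norm_of_nonneg hR.le, inv_mul_lt_iff₀ hR]
    exact hθ
  have hc1 : 0 < min c 1 := lt_min hc one_pos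
  have hbd : ∀ θ ∈ exitSet D v, 1 / (1 + ψ θ) ≤ 2 ^ α / min c 1 * (s * R / 2) ^ (-α) := by
    intro θ hθ
    refine (h.resolvent_le (by linarith) hα2 hc hθ.1).trans ?_
    refine mul_le_mul_of_nonneg_left ?_ (by positivity)
    refine Real.rpow_le_rpow_of_nonpos (by positivity) ?_ (by linarith)
    linarith [norm_ge_of_mem_exitSet hsD hv hθ]
  have hint : IntegrableOn (fun θ => 1 / (1 + ψ θ)) (exitSet D v) := by
    refine Measure.integrableOn_of_bounded (M := 1) hEv
      (resolvent_continuous h hα).aestronglyMeasurable (Eventually.of_forall fun θ => ?_)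
    rw [Real.norm_of_nonneg (resolvent_nonneg h θ)]
    exact resolvent_le_one h θ
  refine ⟨hint.integrable_indicator hEm, ?_⟩
  rw [integral_indicator hEm]
  refine (setIntegral_mono_on hint (integrableOn_const hEv) hEm hbd).trans ?_
  rw [setIntegral_const, smul_eq_mul, mul_comm]
  have hvol := volume_exitSet_le hS hSm hSv hs hsS hR hv
  rw [← hDS] at hvol
  refine (mul_le_mul_of_nonneg_left hvol (by positivity)).trans (le_of_eq ?_)
  have e : (s * R / 2) ^ (-α) = (s / 2) ^ (-α) * R ^ (-α) := by
    rw [← Real.mul_rpow (by positivity) hR.le]; congr 1; ring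
  have e2 : R ^ (1 - α) = R * R ^ (-α) := by
    rw [sub_eq_add_neg, Real.rpow_add hR, Real.rpow_one]
  rw [e, e2]
  ring

/-- The interior difference converges by domination with `(1+|θ|)^{-(1+α)}`, the two boundary layers
vanish. Discs and squares are treated together as dilates of a convex set, so that both truncations
have the same limit. -/
theorem tendsto_oscillatory {ι : Type*} {l : Filter ι} [l.IsCountablyGenerated] (hα : 1 < α)
    (hα2 : α < 2) (hc : 0 < c) (hC : 0 ≤ C) {ψi : ι → Plane → ℝ} {Di : ι → Set Plane} {R : ι → ℝ}
    (hb1 : ∀ᶠ i in l, SymbolBound α c C (ψi i) (Di i))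
    (hlim : ∀ θ, Tendsto (fun i => ψi i θ) l (𝓝 (ψ θ))) (hψ : ∀ θ, 0 ≤ ψ θ)
    {S : Set Plane} (hS : Convex ℝ S) (hSm : MeasurableSet S)
    (hSv : volume S ≠ ⊤) {s : ℝ} (hs : 0 < s) (hsS : Metric.ball 0 s ⊆ S)
    (hR : Tendsto R l atTop) (hDS : ∀ᶠ i in l, Di i = R i • S) {x b : Plane}
    (hb : inner ℝ b x = Real.pi / 2) :
    Tendsto (fun i => ∫ θ in Di i, Real.cos (inner ℝ θ x) / (1 + ψi i θ)) l
      (𝓝 (oscLimit ψ x b)) := by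
  have hc1 : 0 < min c 1 := lt_min hc one_pos
  set N : ι → Plane → ℝ := fun i θ => 1 / (1 + ψi i θ) with hN
  set B : ι → Set Plane := fun i => {θ | θ - b ∈ Di i ∧ θ + b ∈ Di i} with hB
  have hRpos : ∀ᶠ i in l, 0 < R i := hR.eventually_gt_atTop 0
  have hDm : ∀ᶠ i in l, MeasurableSet (Di i) := by
    filter_upwards [hRpos, hDS] with i h1 h2
    rw [h2]; exact hSm.const_smul_of_ne_zero h1.ne'
  have hBm : ∀ᶠ i in l, MeasurableSet (B i) := by
    filter_upwards [hDm] with i h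
    exact ((measurable_sub_const b) h).inter ((measurable_add_const b) h)
  have hmemD : ∀ θ, ∀ᶠ i in l, θ ∈ Di i := by
    intro θ
    filter_upwards [hR.eventually_gt_atTop (‖θ‖ / s), hRpos, hDS] with i h1 h2 h3
    rw [h3]
    refine ⟨(R i)⁻¹ • θ, hsS ?_, smul_inv_smul₀ h2.ne' θ⟩
    rw [mem_ball_zero_iff, norm_smul, norm_inv, Real.norm_of_nonneg h2.le, inv_mul_lt_iff₀ h2]
    rwa [div_lt_iff₀ hs] at h1
  have hmain : Tendsto (fun i => ∫ θ, Real.sin (inner ℝ θ x) *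
      (B i).indicator (fun θ => N i (θ - b) - N i (θ + b)) θ) l
      (𝓝 (∫ θ, Real.sin (inner ℝ θ x) * (1 / (1 + ψ (θ - b)) - 1 / (1 + ψ (θ + b))))) := by
    refine tendsto_integral_filter_of_dominated_convergence (fun θ =>
      C * ‖b‖ * (2 ^ α / min c 1 * (1 + ‖b‖) ^ α) ^ 2 * (1 + ‖θ‖) ^ (-(1 + α))) ?_ ?_ ?_ ?_
    · filter_upwards [hb1, hBm] with i h1 h2
      have hNc : Continuous (N i) := resolvent_continuous h1 hα
      refine AEStronglyMeasurable.mul (by fun_prop) ?_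
      exact (AEStronglyMeasurable.indicator (by fun_prop) h2)
    · filter_upwards [hb1] with i h1
      refine Eventually.of_forall fun θ => ?_
      rw [norm_mul]
      refine (mul_le_of_le_one_left (norm_nonneg _) (Real.abs_sin_le_one _)).trans ?_
      by_cases hθ : θ ∈ B i
      · rw [Set.indicator_of_mem hθ]
        exact abs_resolvent_sub_le h1 hα hα2 hc hC hθ.1 hθ.2
      · rw [Set.indicator_of_notMem hθ, norm_zero]
        positivity
    · exact (integrable_one_add_norm_plane (by linarith)).const_mul _
    · refine Eventually.of_forall fun θ => Tendsto.const_mul _ ?_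
      have hq : ∀ v, Tendsto (fun i => N i v) l (𝓝 (1 / (1 + ψ v))) := fun v =>
        tendsto_const_nhds.div (tendsto_const_nhds.add (hlim v)) (by have := hψ v; positivity)
      refine ((hq (θ - b)).sub (hq (θ + b))).congr' ?_
      filter_upwards [hmemD (θ - b), hmemD (θ + b)] with i h1 h2
      rw [Set.indicator_of_mem (show θ ∈ B i from ⟨h1, h2⟩)]
  have hexit : ∀ v : Plane, Tendsto (fun i => ∫ θ, (exitSet (Di i) v).indicator (N i) θ) l (𝓝 0) := by
    intro v
    have h0 : Tendsto (fun i => 2 ^ α / min c 1 * (s / 2) ^ (-α) * (4 / s * volume.real S) *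
        (‖v‖ * (R i) ^ (1 - α))) l (𝓝 0) := by
      have := (((tendsto_rpow_neg_atTop (by linarith : 0 < α - 1)).comp hR).const_mul
        ‖v‖).const_mul (2 ^ α / min c 1 * (s / 2) ^ (-α) * (4 / s * volume.real S))
      simpa using this
    refine squeeze_zero' ?_ ?_ h0
    · filter_upwards [hb1] with i h1
      exact integral_nonneg fun θ => Set.indicator_nonneg (fun θ _ => resolvent_nonneg h1 θ) θ
    · filter_upwards [hb1, hRpos, hDS, hR.eventually_ge_atTop (2 * ‖v‖ / s)] with i h1 h2 h3 h4
      rw [div_le_iff₀ hs] at h4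
      exact (integral_exitSet_le h1 hα hα2 hc hS hSm hSv hs hsS h2 h3 (by linarith)).2
  have hsmall : ∀ v w : Plane, Tendsto (fun i => ∫ θ, Real.sin (inner ℝ θ x) *
      (exitSet (Di i) v).indicator (N i) (θ + w)) l (𝓝 0) := by
    intro v w
    refine squeeze_zero_norm' ?_ (hexit v)
    filter_upwards [hb1, hRpos, hDS, hR.eventually_ge_atTop (2 * ‖v‖ / s)] with i h1 h2 h3 h4
    rw [div_le_iff₀ hs] at h4
    have hi := (integral_exitSet_le h1 hα hα2 hc hS hSm hSv hs hsS h2 h3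
      (by linarith : 2 * ‖v‖ ≤ s * R i)).1
    rw [← integral_add_right_eq_self ((exitSet (Di i) v).indicator (N i)) w]
    refine (norm_integral_le_integral_norm _).trans ?_
    refine integral_mono_of_nonneg (Eventually.of_forall fun θ => norm_nonneg _)
      (hi.comp_add_right w) (Eventually.of_forall fun θ => ?_)
    have hnn : 0 ≤ (exitSet (Di i) v).indicator (N i) (θ + w) :=
      Set.indicator_nonneg (fun θ _ => resolvent_nonneg h1 θ) _
    simp only [norm_mul, Real.norm_of_nonneg hnn]
    exact mul_le_of_le_one_left hnn (Real.abs_sin_le_one _)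
  have hsum := ((hmain.add (hsmall ((2 : ℝ) • b) (-b))).sub
    (hsmall (-((2 : ℝ) • b)) b)).const_mul (1 / 2)
  rw [add_zero, sub_zero] at hsum
  refine hsum.congr' ?_
  filter_upwards [hb1, hRpos, hDS, hR.eventually_ge_atTop (2 * ‖(2 : ℝ) • b‖ / s), hDm, hBm]
    with i h1 h2 h3 h4 h5 h6
  rw [div_le_iff₀ hs] at h4
  have hDv : volume (Di i) ≠ ⊤ := by
    rw [h3, Measure.addHaar_smul]
    exact ENNReal.mul_ne_top ENNReal.ofReal_ne_top hSv
  have i1 : Integrable ((exitSet (Di i) ((2 : ℝ) • b)).indicator (N i)) :=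
    (integral_exitSet_le h1 hα hα2 hc hS hSm hSv hs hsS h2 h3
      (by linarith : 2 * ‖(2 : ℝ) • b‖ ≤ s * R i)).1
  have i2 : Integrable ((exitSet (Di i) (-((2 : ℝ) • b))).indicator (N i)) :=
    (integral_exitSet_le h1 hα hα2 hc hS hSm hSv hs hsS h2 h3
      (by rw [norm_neg]; linarith : 2 * ‖-((2 : ℝ) • b)‖ ≤ s * R i)).1
  have hsinb : ∀ f : Plane → ℝ, Integrable f →
      Integrable fun θ : Plane => Real.sin (inner ℝ θ x) * f θ := fun f hf =>
    hf.bdd_mul (c := 1) (by fun_prop) (Eventually.of_forall fun θ => Real.abs_sin_le_one _)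
  have i0 : Integrable ((B i).indicator (fun θ => N i (θ - b) - N i (θ + b))) := by
    have hNc : Continuous (N i) := resolvent_continuous h1 hα
    refine Integrable.mono' ((integrable_one_add_norm_plane
      (by linarith : 2 < 1 + α)).const_mul (C * ‖b‖ * (2 ^ α / min c 1 * (1 + ‖b‖) ^ α) ^ 2))
      (AEStronglyMeasurable.indicator (by fun_prop) h6) (Eventually.of_forall fun θ => ?_)
    by_cases hθ : θ ∈ B i
    · rw [Set.indicator_of_mem hθ]
      exact abs_resolvent_sub_le h1 hα hα2 hc hC hθ.1 hθ.2
    · rw [Set.indicator_of_notMem hθ, norm_zero]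
      positivity
  have j0 := hsinb _ i0
  have j1 := hsinb _ (i1.comp_add_right (-b))
  have j2 := hsinb _ (i2.comp_add_right b)
  have e1 := integral_add j0 j1
  have e2 := integral_sub (j0.add j1) j2
  simp only [Pi.add_apply] at e2
  rw [oscillatory_identity hα h1 h5 hDv hb, ← e1, ← e2]
  congr 2
  funext θ
  rw [indicator_resolvent_sub, ← sub_eq_add_neg]
  ring

end

/-! ### Bounds on the oscillatory integrals, uniform in the cut-off. -/

section
open scoped Pointwise
variable {α c C : ℝ} {ψ : Plane → ℝ}

lemma ball_eq_smul {R : ℝ} (hR : 0 < R) : Metric.ball (0 : Plane) R = R • Metric.ball (0 : Plane) 1 := by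
  rw [smul_ball hR.ne', smul_zero, Real.norm_of_nonneg hR.le, mul_one]

/-- A homogeneous form of the decay estimate, with a constant not depending on `b`; it produces the
correct power of `‖b‖` after integration. -/
lemma abs_resolvent_sub_le_far (h : SymbolBound α c C ψ Set.univ) (hα : 1 < α) (hα2 : α < 2)
    (hc : 0 < c) (hC : 0 ≤ C) {θ b : Plane} (hθ : 2 * ‖b‖ ≤ ‖θ‖) (hθ0 : 0 < ‖θ‖) :
    |1 / (1 + ψ (θ - b)) - 1 / (1 + ψ (θ + b))| ≤
      C * ‖b‖ * (2 ^ α / min c 1 * 2 ^ α) ^ 2 * ‖θ‖ ^ (-(1 + α)) := by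
  refine (abs_resolvent_sub h θ b).trans ?_
  have hc1 : 0 < min c 1 := lt_min hc one_pos
  have m : ∀ v : Plane, ‖v‖ = ‖b‖ → 1 / (1 + ψ (θ + v)) ≤
      2 ^ α / min c 1 * (2 ^ α * ‖θ‖ ^ (-α)) := by
    intro v hv
    refine (h.resolvent_le (by linarith) hα2 hc (Set.mem_univ _)).trans ?_
    refine mul_le_mul_of_nonneg_left ?_ (by positivity)
    have h1 : ‖θ‖ / 2 ≤ 1 + ‖θ + v‖ := by
      have := norm_sub_le (θ + v) v
      rw [add_sub_cancel_right] at this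
      linarith
    refine (Real.rpow_le_rpow_of_nonpos (by positivity) h1 (by linarith)).trans (le_of_eq ?_)
    rw [Real.div_rpow (norm_nonneg _) zero_le_two, Real.rpow_neg zero_le_two, div_inv_eq_mul,
      mul_comm]
  have m1 := m (-b) (norm_neg b)
  rw [← sub_eq_add_neg] at m1
  have m3 := mul_le_mul m1 (m b rfl) (resolvent_nonneg h _) (by positivity)
  have e : ‖θ‖ ^ (-(1 + α)) = ‖θ‖ ^ (α - 1) * (‖θ‖ ^ (-α) * ‖θ‖ ^ (-α)) := by
    rw [← Real.rpow_add hθ0, ← Real.rpow_add hθ0]; congr 1; ring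
  calc _ ≤ C * ‖b‖ * ‖θ‖ ^ (α - 1) * (2 ^ α / min c 1 * (2 ^ α * ‖θ‖ ^ (-α)) *
        (2 ^ α / min c 1 * (2 ^ α * ‖θ‖ ^ (-α)))) :=
        mul_le_mul_of_nonneg_left m3 (by positivity)
    _ = _ := by rw [e]; ring

lemma resolvent_le_rpow_neg (h : SymbolBound α c C ψ Set.univ) (hα : 0 < α) (hα2 : α < 2)
    (hc : 0 < c) {θ : Plane} (hθ : θ ≠ 0) :
    1 / (1 + ψ θ) ≤ 2 ^ α / min c 1 * ‖θ‖ ^ (-α) := by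
  have hc1 : 0 < min c 1 := lt_min hc one_pos
  refine (h.resolvent_le hα hα2 hc (Set.mem_univ _)).trans
    (mul_le_mul_of_nonneg_left ?_ (by positivity))
  exact Real.rpow_le_rpow_of_nonpos (norm_pos_iff.2 hθ) (by linarith) (by linarith)

lemma ae_forall_ne (v : Plane) : ∀ᵐ θ : Plane, θ ≠ v :=
  compl_mem_ae_iff.2 (measure_singleton v)

lemma integral_ball_resolvent_le (h : SymbolBound α c C ψ Set.univ) (hα : 0 < α) (hα2 : α < 2)
    (hc : 0 < c) {R : ℝ} (hR : 0 ≤ R) (x : Plane) :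
    |∫ θ in Metric.ball 0 R, Real.cos (inner ℝ θ x) / (1 + ψ θ)| ≤
      2 ^ α / min c 1 * (2 * Real.pi * (R ^ (2 - α) / (2 - α))) := by
  rw [← integral_ball_rpow hα2 hR, ← integral_const_mul, ← Real.norm_eq_abs]
  refine norm_integral_le_of_norm_le ((integrableOn_ball_rpow hα2 R).const_mul _) ?_
  filter_upwards [ae_restrict_of_ae (ae_forall_ne 0)] with θ hθ
  refine le_trans ?_ (resolvent_le_rpow_neg h hα hα2 hc hθ)
  have := h.nonneg θ
  rw [Real.norm_eq_abs, abs_div, abs_of_pos (by linarith : 0 < 1 + ψ θ)]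
  gcongr
  exact Real.abs_cos_le_one _

/-- The scale `‖b‖` separates the regimes. For `R ≤ 8‖b‖` the absolute bound `|θ|^{-α}` suffices.
Otherwise, in the translated formula, frequencies below `2‖b‖` are again estimated by `|θ ±
b|^{-α}`, frequencies above it by the far difference bound, and the boundary layers by `‖b‖R^{1-α} ≤
‖b‖^{2-α}`; every piece scales like `‖b‖^{2-α}`. -/
theorem exists_oscillatory_bound (h : SymbolBound α c C ψ Set.univ) (hα : 1 < α) (hα2 : α < 2)
    (hc : 0 < c) (hC : 0 ≤ C) : ∃ K, 0 ≤ K ∧ ∀ R > 0, ∀ x b : Plane, b ≠ 0 →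
      inner ℝ b x = Real.pi / 2 →
      |∫ θ in Metric.ball 0 R, Real.cos (inner ℝ θ x) / (1 + ψ θ)| ≤ K * ‖b‖ ^ (2 - α) := by
  have hc1 : 0 < min c 1 := lt_min hc one_pos
  have hα0 : 0 < α := by linarith
  have h2α : 0 < 2 - α := by linarith
  have hα1 : 0 < α - 1 := by linarith
  obtain ⟨A, hA⟩ : ∃ A, A = 2 ^ α / min c 1 := ⟨_, rfl⟩
  have hA0 : 0 < A := by rw [hA]; positivity
  obtain ⟨E, hE⟩ : ∃ E, E = A * (1 / 2) ^ (-α) * (4 * volume.real (Metric.ball (0 : Plane) 1)) :=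
    ⟨_, rfl⟩
  have hE0 : 0 ≤ E := by rw [hE]; positivity
  obtain ⟨F, hF⟩ : ∃ F, F = 2 * Real.pi * (3 ^ (2 - α) / (2 - α)) := ⟨_, rfl⟩
  have hF0 : 0 ≤ F := by rw [hF]; positivity
  obtain ⟨G, hG⟩ : ∃ G, G = C * (A * 2 ^ α) ^ 2 * (2 * Real.pi * (2 ^ (1 - α) / (α - 1))) :=
    ⟨_, rfl⟩
  have hG0 : 0 ≤ G := by rw [hG]; positivity
  refine ⟨A * (2 * Real.pi * (8 ^ (2 - α) / (2 - α))) + 2 * A * F + G + 4 * E,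
    by positivity, fun R hR x b hb0 hb => ?_⟩
  have hbn : 0 < ‖b‖ := norm_pos_iff.2 hb0
  have hbp : 0 < ‖b‖ ^ (2 - α) := by positivity
  rcases le_or_gt R (8 * ‖b‖) with hRb | hRb
  · refine (integral_ball_resolvent_le h hα0 hα2 hc hR.le x).trans ?_
    have h1 : R ^ (2 - α) ≤ 8 ^ (2 - α) * ‖b‖ ^ (2 - α) := by
      rw [← Real.mul_rpow (by norm_num) hbn.le]
      exact Real.rpow_le_rpow hR.le hRb h2α.le
    rw [← hA]
    calc A * (2 * Real.pi * (R ^ (2 - α) / (2 - α)))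
        ≤ A * (2 * Real.pi * (8 ^ (2 - α) * ‖b‖ ^ (2 - α) / (2 - α))) := by gcongr
      _ = A * (2 * Real.pi * (8 ^ (2 - α) / (2 - α))) * ‖b‖ ^ (2 - α) := by ring
      _ ≤ _ := by
        have : 0 ≤ (2 * A * F + G + 4 * E) * ‖b‖ ^ (2 - α) := by positivity
        linarith
  · set D : Set Plane := Metric.ball 0 R with hD
    have hDm : MeasurableSet D := Metric.isOpen_ball.measurableSet
    have hDv : volume D ≠ ⊤ := measure_ball_lt_top.ne
    have hD' : SymbolBound α c C ψ D := ⟨h.nonneg, fun θ _ => h.lower θ (Set.mem_univ _), h.lip⟩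
    set N : Plane → ℝ := fun θ => 1 / (1 + ψ θ) with hN
    have hN0 : ∀ θ, 0 ≤ N θ := resolvent_nonneg h
    have hex : ∀ v : Plane, ‖v‖ = 2 * ‖b‖ → Integrable ((exitSet D v).indicator N) ∧
        ∫ θ, (exitSet D v).indicator N θ ≤ 2 * E * ‖b‖ ^ (2 - α) := by
      intro v hv
      have h1 := integral_exitSet_le hD' hα hα2 hc (convex_ball (0 : Plane) 1)
        Metric.isOpen_ball.measurableSet measure_ball_lt_top.ne one_pos subset_rfl hR
        (ball_eq_smul hR) (v := v) (by rw [hv]; linarith)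
      refine ⟨h1.1, h1.2.trans ?_⟩
      rw [← hA, div_one, hv]
      have h2 : R ^ (1 - α) ≤ ‖b‖ ^ (1 - α) :=
        Real.rpow_le_rpow_of_nonpos hbn (by linarith) (by linarith)
      have h3 : ‖b‖ ^ (2 - α) = ‖b‖ * ‖b‖ ^ (1 - α) := by
        rw [show 2 - α = 1 + (1 - α) by ring, Real.rpow_add hbn, Real.rpow_one]
      rw [h3, hE]
      calc _ ≤ A * (1 / 2) ^ (-α) * (4 * volume.real (Metric.ball (0 : Plane) 1)) *
            (2 * ‖b‖ * ‖b‖ ^ (1 - α)) := by gcongr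
        _ = _ := by ring
    set f : Plane → ℝ := (Metric.ball (0 : Plane) (3 * ‖b‖)).indicator fun θ => ‖θ‖ ^ (-α) with hf
    set g : Plane → ℝ := (Metric.ball (0 : Plane) (2 * ‖b‖))ᶜ.indicator
      fun θ => ‖θ‖ ^ (-(1 + α)) with hg
    have hf0 : ∀ θ, 0 ≤ f θ := fun θ => Set.indicator_nonneg (fun _ _ => by positivity) _
    have hg0 : ∀ θ, 0 ≤ g θ := fun θ => Set.indicator_nonneg (fun _ _ => by positivity) _
    have hfi : Integrable f := (integrableOn_ball_rpow hα2 _).integrable_indicator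
      Metric.isOpen_ball.measurableSet
    have hgi : Integrable g := (integrableOn_compl_ball_rpow (by linarith)
      (by positivity)).integrable_indicator Metric.isOpen_ball.measurableSet.compl
    have hfI : ∫ θ, f θ = F * ‖b‖ ^ (2 - α) := by
      rw [hf, integral_indicator Metric.isOpen_ball.measurableSet, integral_ball_rpow hα2
        (by positivity), Real.mul_rpow (by norm_num) hbn.le, hF]
      ring
    have hgI : C * ‖b‖ * (A * 2 ^ α) ^ 2 * ∫ θ, g θ = G * ‖b‖ ^ (2 - α) := by
      rw [hg, integral_indicator Metric.isOpen_ball.measurableSet.compl,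
        integral_compl_ball_rpow (by linarith) (by positivity), Real.mul_rpow (by norm_num) hbn.le,
        hG, show 2 - (1 + α) = 1 - α by ring, show 1 + α - 2 = α - 1 by ring,
        show 2 - α = 1 + (1 - α) by ring, Real.rpow_add hbn, Real.rpow_one]
      ring
    obtain ⟨e1, e1'⟩ := hex ((2 : ℝ) • b) (by rw [norm_smul]; norm_num)
    obtain ⟨e2, e2'⟩ := hex (-((2 : ℝ) • b)) (by rw [norm_neg, norm_smul]; norm_num)
    have i1 := (hfi.comp_sub_right b).const_mul A
    have i2 := (hfi.comp_add_right b).const_mul A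
    have i3 := hgi.const_mul (C * ‖b‖ * (A * 2 ^ α) ^ 2)
    have i4 := e1.comp_sub_right b
    have i5 := e2.comp_add_right b
    have hpt : ∀ᵐ θ : Plane, ‖Real.sin (inner ℝ θ x) * (D.indicator N (θ - b) -
        D.indicator N (θ + b))‖ ≤ A * f (θ - b) + A * f (θ + b) +
        C * ‖b‖ * (A * 2 ^ α) ^ 2 * g θ + (exitSet D ((2 : ℝ) • b)).indicator N (θ - b) +
        (exitSet D (-((2 : ℝ) • b))).indicator N (θ + b) := by
      filter_upwards [ae_forall_ne b, ae_forall_ne (-b)] with θ hθ1 hθ2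
      rw [norm_mul]
      refine (mul_le_of_le_one_left (norm_nonneg _) (Real.abs_sin_le_one _)).trans ?_
      have p4 : 0 ≤ (exitSet D ((2 : ℝ) • b)).indicator N (θ - b) :=
        Set.indicator_nonneg (fun θ _ => hN0 θ) _
      have p5 : 0 ≤ (exitSet D (-((2 : ℝ) • b))).indicator N (θ + b) :=
        Set.indicator_nonneg (fun θ _ => hN0 θ) _
      rcases lt_or_ge ‖θ‖ (2 * ‖b‖) with hθ | hθ
      · have q : ∀ v, v ≠ 0 → ‖v‖ < 3 * ‖b‖ → |D.indicator N v| ≤ A * f v := by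
          intro v hv hvb
          have hfv : f v = ‖v‖ ^ (-α) := Set.indicator_of_mem (by simpa using hvb) _
          rw [abs_of_nonneg (Set.indicator_nonneg (fun θ _ => hN0 θ) _), hfv, hA]
          exact (Set.indicator_le_self' (fun _ _ => hN0 _) v).trans
            (resolvent_le_rpow_neg h hα0 hα2 hc hv)
        have q1 := q (θ - b) (sub_ne_zero.2 hθ1) (by have := norm_sub_le θ b; linarith)
        have q2 := q (θ + b) (fun h => hθ2 (eq_neg_of_add_eq_zero_left h))
          (by have := norm_add_le θ b; linarith)
        have q3 : 0 ≤ C * ‖b‖ * (A * 2 ^ α) ^ 2 * g θ := mul_nonneg (by positivity) (hg0 θ)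
        refine (norm_sub_le _ _).trans ?_
        rw [Real.norm_eq_abs, Real.norm_eq_abs]
        linarith
      · rw [indicator_resolvent_sub]
        have q1 : ‖{θ | θ - b ∈ D ∧ θ + b ∈ D}.indicator (fun θ => N (θ - b) - N (θ + b)) θ‖ ≤
            C * ‖b‖ * (A * 2 ^ α) ^ 2 * g θ := by
          refine (norm_indicator_le_norm_self _ _).trans ?_
          rw [hg, Set.indicator_of_mem (by simpa using hθ), hA]
          exact abs_resolvent_sub_le_far h hα hα2 hc hC hθ (by linarith)
        have q2 : 0 ≤ A * f (θ - b) := mul_nonneg hA0.le (hf0 _)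
        have q3 : 0 ≤ A * f (θ + b) := mul_nonneg hA0.le (hf0 _)
        refine (norm_sub_le _ _).trans ((add_le_add (norm_add_le _ _) le_rfl).trans ?_)
        rw [Real.norm_of_nonneg p4, Real.norm_of_nonneg p5]
        linarith
    rw [oscillatory_identity hα hD' hDm hDv hb, abs_mul, abs_of_pos (by norm_num : (0 : ℝ) < 1 / 2)]
    have hle := norm_integral_le_of_norm_le ((((i1.add i2).add i3).add i4).add i5) hpt
    rw [integral_add' (((i1.add i2).add i3).add i4) i5, integral_add' ((i1.add i2).add i3) i4,
      integral_add' (i1.add i2) i3, integral_add' i1 i2, integral_const_mul, integral_const_mul,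
      integral_const_mul, integral_sub_right_eq_self f b, integral_add_right_eq_self f b,
      integral_sub_right_eq_self ((exitSet D ((2 : ℝ) • b)).indicator N) b,
      integral_add_right_eq_self ((exitSet D (-((2 : ℝ) • b))).indicator N) b, hfI, hgI] at hle
    rw [Real.norm_eq_abs] at hle
    have hpos : 0 ≤ A * (2 * Real.pi * (8 ^ (2 - α) / (2 - α))) * ‖b‖ ^ (2 - α) := by positivity
    have hpos2 : 0 ≤ G * ‖b‖ ^ (2 - α) := by positivity
    have hpos3 : 0 ≤ A * F * ‖b‖ ^ (2 - α) := by positivity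
    have hpos4 : 0 ≤ E * ‖b‖ ^ (2 - α) := by positivity
    linarith

end

/-! ### Second differences -/

/-- Along `t ↦ f(x + ty) + f(x - ty)` the derivative compares `Df` at points `2t‖y‖` apart, and `Df`
is Lipschitz because `f` is `C²` with compact support. -/
lemma exists_second_difference_bound {f : Plane → ℝ} (hf : ContDiff ℝ 2 f)
    (hc : HasCompactSupport f) :
    ∃ K, 0 ≤ K ∧ ∀ x y, |f (x + y) + f (x - y) - 2 * f x| ≤ K * ‖y‖ ^ 2 := by
  have hf1 : ContDiff ℝ 1 (fderiv ℝ f) := hf.fderiv_right (by norm_num)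
  obtain ⟨L, hL⟩ := hf1.lipschitzWith_of_hasCompactSupport (hc.fderiv ℝ) one_ne_zero
  refine ⟨2 * L, by positivity, fun x y => ?_⟩
  have hd : ∀ t : ℝ, HasDerivAt (fun t : ℝ => f (x + t • y) + f (x - t • y))
      (fderiv ℝ f (x + t • y) y - fderiv ℝ f (x - t • y) y) t := by
    intro t
    have hdf : ∀ p, HasFDerivAt f (fderiv ℝ f p) p := fun p =>
      ((hf.differentiable (by norm_num)) p).hasFDerivAt
    have hl : HasDerivAt (fun t : ℝ => t • y) y t := by
      simpa using (hasDerivAt_id t).smul_const y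
    have h1 := (hdf (x + t • y)).comp_hasDerivAt t (hl.const_add x)
    have h2 := (hdf (x - t • y)).comp_hasDerivAt t (hl.const_sub x)
    have := h1.add h2
    rw [map_neg, ← sub_eq_add_neg] at this
    exact this
  have hb : ∀ t ∈ Set.Icc (0 : ℝ) 1,
      ‖fderiv ℝ f (x + t • y) y - fderiv ℝ f (x - t • y) y‖ ≤ 2 * L * ‖y‖ ^ 2 := by
    intro t ht
    rw [← sub_apply]
    refine (ContinuousLinearMap.le_opNorm _ _).trans ?_
    have h1 := hL.dist_le_mul (x + t • y) (x - t • y)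
    rw [dist_eq_norm, dist_eq_norm] at h1
    have e : x + t • y - (x - t • y) = (2 * t) • y := by module
    rw [e, norm_smul, Real.norm_of_nonneg (by linarith [ht.1])] at h1
    have h2 : 2 * t * ‖y‖ ≤ 2 * ‖y‖ := by nlinarith [norm_nonneg y, ht.2]
    calc _ ≤ (L * (2 * ‖y‖)) * ‖y‖ := by
          gcongr
          exact h1.trans (by gcongr)
      _ = _ := by ring
  have := (convex_Icc (0 : ℝ) 1).norm_image_sub_le_of_norm_hasDerivWithin_le
    (fun t _ => (hd t).hasDerivWithinAt) hb (Set.left_mem_Icc.2 zero_le_one)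
    (Set.right_mem_Icc.2 zero_le_one)
  simp only [one_smul, zero_smul, add_zero, sub_zero, norm_one, mul_one, Real.norm_eq_abs] at this
  rwa [← two_mul] at this

/-- A continuous function with bounded second differences, supported in the ball of radius `R`. -/
structure SourceBound (ρ : Plane → ℝ) (R B K : ℝ) : Prop where
  cont : Continuous ρ
  R_nonneg : 0 ≤ R
  supp : ∀ x, R < ‖x‖ → ρ x = 0
  bound : ∀ x, |ρ x| ≤ B
  second : ∀ x y, |ρ (x + y) + ρ (x - y) - 2 * ρ x| ≤ K * ‖y‖ ^ 2

lemma exists_sourceBound {ρ : Plane → ℝ} (hρ : ContDiff ℝ 2 ρ) (hc : HasCompactSupport ρ) :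
    ∃ R B K, SourceBound ρ R B K := by
  obtain ⟨K, -, hK⟩ := exists_second_difference_bound hρ hc
  obtain ⟨B, hB⟩ := hc.exists_bound_of_continuous hρ.continuous
  obtain ⟨R, hR⟩ := hc.isBounded.subset_closedBall 0
  refine ⟨max R 0, B, K, hρ.continuous, le_max_right _ _, fun x hx => ?_, hB, hK⟩
  by_contra h
  have h1 := hR (subset_tsupport ρ h)
  rw [mem_closedBall_zero_iff] at h1
  linarith [le_max_left R 0]

section
variable {ρ : Plane → ℝ} {R B K : ℝ} (hs : SourceBound ρ R B K)
include hs

lemma SourceBound.B_nonneg : 0 ≤ B := (abs_nonneg _).trans (hs.bound 0)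

lemma SourceBound.K_nonneg : 0 ≤ K := by
  have := (abs_nonneg _).trans (hs.second 0 (EuclideanSpace.single 0 1))
  simpa using this

end

/-! ### Lattice sums as integrals -/

lemma measureReal_rnd_eq {n : ℕ} (hn : 0 < n) (z : Idx) :
    volume.real {x : Plane | rnd n x = z} = 1 / (n : ℝ) ^ 2 := by
  have hn' : (0 : ℝ) < n := by exact_mod_cast hn
  rw [← measureReal_congr (cell_ae_eq hn z)]
  have e : cell n z = {y : Plane | ∀ i, y i ∈ Set.Icc ((z i : ℝ) / n - 1 / (2 * n))
      ((z i : ℝ) / n + 1 / (2 * n))} := by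
    ext x
    refine forall_congr' fun i => ?_
    rw [abs_le, Set.mem_Icc]
    constructor <;> rintro ⟨h1, h2⟩ <;> constructor <;> linarith
  rw [e, measureReal_def, volume_box]
  have e2 : ∀ i, ENNReal.ofReal ((z i : ℝ) / n + 1 / (2 * n) - ((z i : ℝ) / n - 1 / (2 * n))) =
      ENNReal.ofReal (1 / n) := fun i => by congr 1; field_simp; ring
  simp only [e2, Finset.prod_const, Finset.card_univ, Fintype.card_fin]
  rw [ENNReal.toReal_pow, ENNReal.toReal_ofReal (by positivity), div_pow, one_pow]

lemma sum_lattice_eq_integral {n : ℕ} (hn : 0 < n) (S : Finset Idx) (g : Idx → ℝ)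
    (hS : ∀ z ∉ S, g z = 0) : 1 / (n : ℝ) ^ 2 * ∑ z ∈ S, g z = ∫ y, g (rnd n y) := by
  have hn' : (0 : ℝ) < n := by exact_mod_cast hn
  have hA : {y : Plane | rnd n y ∈ S} = ⋃ z ∈ S, {y | rnd n y = z} := by ext; simp
  have hAm : MeasurableSet {y : Plane | rnd n y ∈ S} := (measurable_rnd n) S.measurableSet
  have hfin : ∀ z, volume {y : Plane | rnd n y = z} < ⊤ := fun z => by
    have := measureReal_rnd_eq hn z
    rw [lt_top_iff_ne_top]
    intro h
    rw [measureReal_def, h, ENNReal.toReal_top] at this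
    have : 0 < 1 / (n : ℝ) ^ 2 := by positivity
    linarith
  have hAv : volume {y : Plane | rnd n y ∈ S} ≠ ⊤ := by
    rw [hA]
    exact (measure_biUnion_lt_top S.finite_toSet fun z _ => hfin z).ne
  rw [← setIntegral_eq_integral_of_forall_compl_eq_zero (s := {y : Plane | rnd n y ∈ S})
    (fun y hy => hS _ hy), ← sum_volume_cell hn hAm hAv S (fun x hx => hx), Finset.mul_sum]
  refine Finset.sum_congr rfl fun z hz => ?_
  congr 1
  rw [measureReal_cell_inter hn, Set.inter_eq_left.2, measureReal_rnd_eq hn]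
  intro y (hy : rnd n y = z)
  change rnd n y ∈ S
  rwa [hy]

lemma card_latBox_le {R : ℝ} (hR : 0 ≤ R) {n : ℕ} (hn : 0 < n) :
    ((latBox R n).card : ℝ) ≤ n ^ 2 * (2 * R + 7) ^ 2 := by
  have hn' : (1 : ℝ) ≤ n := by exact_mod_cast hn
  rw [latBox, card_idxBox]
  have h := (Nat.ceil_lt_add_one (by positivity : 0 ≤ (n : ℝ) * (R + 2))).le
  push_cast
  rw [← mul_pow]
  gcongr
  nlinarith

/-! ### The lattice Fourier transform of the source -/

/-- The Riemann sum for the phase-shifted cosine transform of `ρ`. -/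
def latFourier (ρ : Plane → ℝ) (n : ℕ) (θ : Plane) (β : ℝ) : ℝ :=
  1 / (n : ℝ) ^ 2 * ∑' w : Idx, ρ (latticePt n w) * Real.cos (β - inner ℝ θ (latticePt n w))

/-- The phase-shifted cosine transform of `ρ`. -/
def contFourier (ρ : Plane → ℝ) (θ : Plane) (β : ℝ) : ℝ :=
  ∫ y, ρ y * Real.cos (β - inner ℝ θ y)

section
variable {ρ : Plane → ℝ} {R B K : ℝ} (hs : SourceBound ρ R B K) {n : ℕ} (hn : 0 < n)
include hs hn

lemma source_eq_zero {R' : ℝ} (hR : R ≤ R' + 2) {w : Idx} (hw : w ∉ latBox R' n) :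
    ρ (latticePt n w) = 0 := by
  apply hs.supp
  by_contra h
  exact hw (mem_latBox_of_norm_le hn (by linarith))

lemma latFourier_eq_sum (θ : Plane) (β : ℝ) : latFourier ρ n θ β = 1 / (n : ℝ) ^ 2 *
    ∑ w ∈ latBox R n, ρ (latticePt n w) * Real.cos (β - inner ℝ θ (latticePt n w)) := by
  rw [latFourier, tsum_eq_sum]
  intro w hw
  rw [source_eq_zero hs hn (by linarith) hw, zero_mul]

lemma latFourier_eq_integral (θ : Plane) (β : ℝ) : latFourier ρ n θ β =
    ∫ y, ρ (rp n y) * Real.cos (β - inner ℝ θ (rp n y)) := by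
  rw [latFourier_eq_sum hs hn, sum_lattice_eq_integral hn (latBox R n) (fun w =>
    ρ (latticePt n w) * Real.cos (β - inner ℝ θ (latticePt n w)))]
  · rfl
  · intro w hw
    rw [source_eq_zero hs hn (by linarith) hw, zero_mul]

lemma abs_latFourier_le (θ : Plane) (β : ℝ) : |latFourier ρ n θ β| ≤ B * (2 * R + 7) ^ 2 := by
  have hn' : (0 : ℝ) < n := by exact_mod_cast hn
  have hB := hs.B_nonneg
  rw [latFourier_eq_sum hs hn, abs_mul, abs_of_pos (by positivity : 0 < 1 / (n : ℝ) ^ 2)]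
  have h1 : |∑ w ∈ latBox R n, ρ (latticePt n w) * Real.cos (β - inner ℝ θ (latticePt n w))| ≤
      (latBox R n).card * B := by
    refine (Finset.abs_sum_le_sum_abs _ _).trans ?_
    rw [← nsmul_eq_mul]
    refine Finset.sum_le_card_nsmul _ _ _ fun w _ => ?_
    rw [abs_mul]
    exact (mul_le_of_le_one_right (abs_nonneg _) (Real.abs_cos_le_one _)).trans (hs.bound _)
  have h2 := card_latBox_le hs.R_nonneg hn
  calc _ ≤ 1 / (n : ℝ) ^ 2 * ((n ^ 2 * (2 * R + 7) ^ 2) * B) := by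
        refine mul_le_mul_of_nonneg_left (h1.trans ?_) (by positivity)
        gcongr
    _ = _ := by field_simp

/-- Summation by parts: the phase-shifted cosine is an eigenfunction of the second difference in
direction `i`, with eigenvalue `2 cos(θ i / n) - 2`. The box has radius `R + 1` to hold the shifted
support. -/
lemma latFourier_second_difference (θ : Plane) (β : ℝ) (i : Fin 2) :
    (2 * Real.cos (θ i / n) - 2) * latFourier ρ n θ β = 1 / (n : ℝ) ^ 2 *
      ∑ w ∈ latBox (R + 1) n, (ρ (latticePt n w + latticePt n (Pi.single i 1)) +
        ρ (latticePt n w - latticePt n (Pi.single i 1)) - 2 * ρ (latticePt n w)) *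
          Real.cos (β - inner ℝ θ (latticePt n w)) := by
  have hn' : (1 : ℝ) ≤ n := by exact_mod_cast hn
  set e : Idx := Pi.single i 1 with he
  set f : Idx → ℝ := fun w => ρ (latticePt n w) with hf
  set g : Idx → ℝ := fun w => Real.cos (β - inner ℝ θ (latticePt n w)) with hg
  have hnorm : ‖latticePt n e‖ ≤ 1 := by
    have : ‖latticePt n e‖ ^ 2 ≤ 1 := by
      rw [norm_sq_latticePt, div_le_one (by positivity)]
      have : (e 0 : ℝ) ^ 2 + (e 1 : ℝ) ^ 2 = 1 := by fin_cases i <;> simp [he]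
      rw [this]; nlinarith
    exact (sq_le_one_iff₀ (norm_nonneg _)).1 this
  have hinner : inner ℝ θ (latticePt n e) = θ i / n := by
    rw [inner_plane]
    fin_cases i <;> simp [he, div_eq_mul_inv]
  have hfz : ∀ v : Idx, ‖latticePt n v‖ ≤ 1 → ∀ w ∉ latBox (R + 1) n, f (w + v) = 0 := by
    intro v hv w hw
    apply hs.supp
    rw [latticePt_add]
    by_contra h
    apply hw
    apply mem_latBox_of_norm_le hn
    have := norm_sub_le (latticePt n w + latticePt n v) (latticePt n v)
    rw [add_sub_cancel_right] at this
    linarith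
  have hneg : ‖latticePt n (-e)‖ ≤ 1 := by rwa [latticePt_neg, norm_neg]
  have hsumm : ∀ v : Idx, ‖latticePt n v‖ ≤ 1 → ∀ h : Idx → ℝ,
      Summable fun w => f (w + v) * h w := fun v hv h =>
    summable_of_ne_finset_zero (s := latBox (R + 1) n) fun w hw => by rw [hfz v hv w hw, zero_mul]
  have hz : ‖latticePt n 0‖ ≤ 1 := by simp
  have hshift : ∀ v : Idx, ∑' w, f (w + v) * g w = ∑' w, f w * g (w - v) := by
    intro v
    rw [← (Equiv.addRight v).tsum_eq fun w => f w * g (w - v)]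
    simp
  have hcos : ∀ w, g (w - e) + g (w - -e) = 2 * Real.cos (θ i / n) * g w := by
    intro w
    simp only [hg, latticePt_sub, latticePt_neg, inner_sub_right, inner_neg_right, hinner]
    rw [show β - (inner ℝ θ (latticePt n w) - θ i / n) =
      (β - inner ℝ θ (latticePt n w)) + θ i / n by ring,
      show β - (inner ℝ θ (latticePt n w) - -(θ i / n)) =
      (β - inner ℝ θ (latticePt n w)) - θ i / n by ring]
    generalize β - inner ℝ θ (latticePt n w) = a
    rw [Real.cos_add, Real.cos_sub]
    ring
  have hs0 : ∀ h : Idx → ℝ, Summable fun w => f w * h w := fun h => by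
    simpa using hsumm 0 hz h
  have hL : ∑' w, (f (w + e) + f (w + -e) - 2 * f w) * g w =
      (2 * Real.cos (θ i / n) - 2) * ∑' w, f w * g w := by
    have e1 : ∀ w, (f (w + e) + f (w + -e) - 2 * f w) * g w =
        (f (w + e) * g w + f (w + -e) * g w) - 2 * (f w * g w) := fun w => by ring
    rw [tsum_congr e1, Summable.tsum_sub ((hsumm e hnorm g).add (hsumm (-e) hneg g))
      ((hs0 g).mul_left 2), Summable.tsum_add (hsumm e hnorm g) (hsumm (-e) hneg g), hshift, hshift,
      ← Summable.tsum_add (hs0 _) (hs0 _), tsum_mul_left, sub_mul, ← tsum_mul_left (a := 2 * _)]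
    congr 1
    refine tsum_congr fun w => ?_
    rw [← mul_add, hcos]; ring
  rw [latFourier, mul_left_comm, ← hL, tsum_eq_sum (s := latBox (R + 1) n)]
  · simp only [hf, hg, ← sub_eq_add_neg, latticePt_add, latticePt_sub]
  · intro w hw
    have h0 : f w = 0 := by simpa using hfz 0 hz w hw
    rw [hfz e hnorm w hw, hfz (-e) hneg w hw, h0]; simp

/-- On the frequency square the eigenvalue is at least `4 (θ i)²/(π² n²)` in modulus, while second
differences of `ρ` at mesh `1/n` are at most `K/n²`; the powers of `n` cancel. -/
lemma abs_latFourier_mul_sq_le {θ : Plane} (hθ : θ ∈ freqSquare n) (β : ℝ) (i : Fin 2) :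
    |latFourier ρ n θ β| * (θ i) ^ 2 ≤ Real.pi ^ 2 / 4 * (K * (2 * R + 9) ^ 2) := by
  have hn' : (1 : ℝ) ≤ n := by exact_mod_cast hn
  have hn0 : (0 : ℝ) < n := by linarith
  have hK := hs.K_nonneg
  have h := latFourier_second_difference hs hn θ β i
  set e : Idx := Pi.single i 1 with he
  have hnorm : ‖latticePt n e‖ ^ 2 = 1 / (n : ℝ) ^ 2 := by
    rw [norm_sq_latticePt]
    have : (e 0 : ℝ) ^ 2 + (e 1 : ℝ) ^ 2 = 1 := by fin_cases i <;> simp [he]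
    rw [this]
  have hsum : |∑ w ∈ latBox (R + 1) n, (ρ (latticePt n w + latticePt n e) +
        ρ (latticePt n w - latticePt n e) - 2 * ρ (latticePt n w)) *
          Real.cos (β - inner ℝ θ (latticePt n w))| ≤
      (latBox (R + 1) n).card * (K * (1 / (n : ℝ) ^ 2)) := by
    refine (Finset.abs_sum_le_sum_abs _ _).trans ?_
    rw [← nsmul_eq_mul]
    refine Finset.sum_le_card_nsmul _ _ _ fun w _ => ?_
    rw [abs_mul, ← hnorm]
    exact (mul_le_of_le_one_right (abs_nonneg _) (Real.abs_cos_le_one _)).trans (hs.second _ _)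
  have hcard := card_latBox_le (by linarith [hs.R_nonneg] : 0 ≤ R + 1) hn
  have hle : |θ i / n| ≤ Real.pi := by
    rw [abs_div, abs_of_pos hn0, div_le_iff₀ hn0, mul_comm]; exact hθ i
  have hq := two_div_pi_sq_mul_le hle
  have h1 : (4 / Real.pi ^ 2 * (θ i / n) ^ 2) * |latFourier ρ n θ β| ≤
      1 / (n : ℝ) ^ 2 * (K * (2 * R + 9) ^ 2) := by
    calc _ ≤ |2 * Real.cos (θ i / n) - 2| * |latFourier ρ n θ β| := by
          gcongr
          rw [abs_sub_comm, abs_of_nonneg (by linarith [Real.cos_le_one (θ i / n)])]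
          have : 4 / Real.pi ^ 2 * (θ i / n) ^ 2 = 2 * (2 / Real.pi ^ 2 * (θ i / n) ^ 2) := by ring
          linarith
      _ = 1 / (n : ℝ) ^ 2 * |∑ w ∈ latBox (R + 1) n, (ρ (latticePt n w + latticePt n e) +
        ρ (latticePt n w - latticePt n e) - 2 * ρ (latticePt n w)) *
          Real.cos (β - inner ℝ θ (latticePt n w))| := by
          rw [← abs_mul, h, abs_mul, abs_of_pos (by positivity : 0 < 1 / (n : ℝ) ^ 2)]
      _ ≤ 1 / (n : ℝ) ^ 2 * ((n ^ 2 * (2 * (R + 1) + 7) ^ 2) * (K * (1 / (n : ℝ) ^ 2))) := by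
          refine mul_le_mul_of_nonneg_left (hsum.trans ?_) (by positivity)
          gcongr
      _ = _ := by
        rw [show 2 * (R + 1) + 7 = 2 * R + 9 by ring]
        field_simp
  have hpi := Real.pi_pos
  have e3 : |latFourier ρ n θ β| * (θ i) ^ 2 = Real.pi ^ 2 / 4 * (n : ℝ) ^ 2 *
      ((4 / Real.pi ^ 2 * (θ i / n) ^ 2) * |latFourier ρ n θ β|) := by
    field_simp
  rw [e3]
  calc _ ≤ Real.pi ^ 2 / 4 * (n : ℝ) ^ 2 * (1 / (n : ℝ) ^ 2 * (K * (2 * R + 9) ^ 2)) := by gcongr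
    _ = _ := by field_simp

lemma latFourier_decay {θ : Plane} (hθ : θ ∈ freqSquare n) (β : ℝ) :
    |latFourier ρ n θ β| ≤ (2 * (B * (2 * R + 7) ^ 2) + Real.pi ^ 2 * (K * (2 * R + 9) ^ 2)) *
      (1 + ‖θ‖) ^ (-2 : ℝ) := by
  have h0 := abs_latFourier_le hs hn θ β
  have h1 := abs_latFourier_mul_sq_le hs hn hθ β 0
  have h2 := abs_latFourier_mul_sq_le hs hn hθ β 1
  rw [Real.rpow_neg (by positivity), Real.rpow_two, ← div_eq_mul_inv, le_div_iff₀ (by positivity)]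
  have h3 := norm_sq_plane θ
  have h4 : (1 + ‖θ‖) ^ 2 ≤ 2 + 2 * ‖θ‖ ^ 2 := by nlinarith [sq_nonneg (‖θ‖ - 1)]
  calc _ ≤ |latFourier ρ n θ β| * (2 + 2 * ‖θ‖ ^ 2) := by gcongr
    _ = 2 * |latFourier ρ n θ β| + 2 * (|latFourier ρ n θ β| * (θ 0) ^ 2) +
        2 * (|latFourier ρ n θ β| * (θ 1) ^ 2) := by rw [h3]; ring
    _ ≤ _ := by linarith

/-- A phase increment is again a cosine sum, times `2 sin(t/2)`. Lipschitz estimates thus keep the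
decay in `θ` of the sum itself. -/
lemma latFourier_shift (θ : Plane) (β t : ℝ) : latFourier ρ n θ (β + t) - latFourier ρ n θ β =
    2 * Real.sin (t / 2) * latFourier ρ n θ (β + t / 2 + Real.pi / 2) := by
  simp only [latFourier_eq_sum hs hn]
  rw [← mul_sub, mul_left_comm, Finset.mul_sum]
  congr 1
  refine (Finset.sum_sub_distrib _ _).symm.trans ?_
  refine Finset.sum_congr rfl fun w _ => ?_
  generalize inner ℝ θ (latticePt n w) = a
  rw [← mul_sub, show β + t / 2 + Real.pi / 2 - a = (β + t / 2 - a) + Real.pi / 2 by ring,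
    Real.cos_add_pi_div_two, Real.cos_sub_cos, show (β + t - a + (β - a)) / 2 = β + t / 2 - a by ring,
    show (β + t - a - (β - a)) / 2 = t / 2 by ring]
  ring

end

section
variable {ρ : Plane → ℝ} {R B K : ℝ} (hs : SourceBound ρ R B K)
include hs

lemma source_rounded_le {n : ℕ} (hn : 0 < n) (y : Plane) :
    |ρ (rp n y)| ≤ (Metric.ball (0 : Plane) (R + 2)).indicator (fun _ => B) y := by
  have hn' : (1 : ℝ) ≤ n := by exact_mod_cast hn
  by_cases hy : y ∈ Metric.ball (0 : Plane) (R + 2)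
  · rw [Set.indicator_of_mem hy]; exact hs.bound _
  · rw [Set.indicator_of_notMem hy, hs.supp, abs_zero]
    have h1 : R + 2 ≤ ‖y‖ := by simpa using hy
    have h2 := norm_sub_rp_le hn y
    have h3 : 1 / (n : ℝ) ≤ 1 := by rw [div_le_one (by linarith)]; exact hn'
    have h4 := norm_sub_norm_le y (rp n y)
    linarith

omit hs in
lemma integrable_indicator_ball (S C : ℝ) :
    Integrable ((Metric.ball (0 : Plane) S).indicator fun _ => C) :=
  (integrableOn_const measure_ball_lt_top.ne).integrable_indicator Metric.isOpen_ball.measurableSet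

lemma tendsto_latFourier {φ : ℕ → ℕ} (hφ : Tendsto φ atTop atTop) {β : ℕ → ℝ} {b : ℝ}
    (hβ : Tendsto β atTop (𝓝 b)) (θ : Plane) :
    Tendsto (fun k => latFourier ρ (φ k) θ (β k)) atTop (𝓝 (contFourier ρ θ b)) := by
  have h : Tendsto (fun k => ∫ y, ρ (rp (φ k) y) * Real.cos (β k - inner ℝ θ (rp (φ k) y))) atTop
      (𝓝 (contFourier ρ θ b)) := by
    refine tendsto_integral_filter_of_dominated_convergence
      ((Metric.ball (0 : Plane) (R + 2)).indicator fun _ => B) ?_ ?_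
      (integrable_indicator_ball _ _) ?_
    · refine Eventually.of_forall fun k => ?_
      have hc : Continuous fun y : Plane => ρ y * Real.cos (β k - inner ℝ θ y) :=
        hs.cont.mul (by fun_prop)
      exact (hc.measurable.comp (measurable_rp (φ k))).aestronglyMeasurable
    · filter_upwards [hφ.eventually_gt_atTop 0] with k hk
      refine Eventually.of_forall fun y => ?_
      rw [norm_mul]
      exact (mul_le_of_le_one_right (norm_nonneg _) (Real.abs_cos_le_one _)).trans
        (source_rounded_le hs hk y)
    · refine Eventually.of_forall fun y => ?_
      have hrp := rp_tendsto hφ y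
      exact ((hs.cont.tendsto y).comp hrp).mul ((Real.continuous_cos.tendsto _).comp
        (hβ.sub (tendsto_const_nhds.inner hrp)))
  refine h.congr' ?_
  filter_upwards [hφ.eventually_gt_atTop 0] with k hk
  exact (latFourier_eq_integral hs hk θ (β k)).symm

/-- Inherited from the lattice sums, whose bound is uniform in the scale on squares that exhaust the
plane. -/
lemma contFourier_decay (θ : Plane) (β : ℝ) :
    |contFourier ρ θ β| ≤ (2 * (B * (2 * R + 7) ^ 2) + Real.pi ^ 2 * (K * (2 * R + 9) ^ 2)) *
      (1 + ‖θ‖) ^ (-2 : ℝ) := by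
  refine le_of_tendsto (tendsto_latFourier hs tendsto_id (tendsto_const_nhds (x := β)) θ).abs ?_
  filter_upwards [eventually_gt_atTop 0, eventually_mem_freqSquare θ] with n hn hθ
  exact latFourier_decay hs hn hθ β

end

/-! ### Fourier integrals against the inverse symbol -/

lemma abs_cos_inner_sub_le (θ x y : Plane) : |Real.cos (inner ℝ θ x) - Real.cos (inner ℝ θ y)| ≤
    (2 + ‖x‖ ^ 2 + ‖y‖ ^ 2) * min 1 (‖θ‖ ^ 2) := by
  have h : ∀ v : Plane, 1 - Real.cos (inner ℝ θ v) ≤ ‖v‖ ^ 2 * ‖θ‖ ^ 2 := fun v => by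
    refine (one_sub_cos_le _).trans ?_
    have h1 := abs_real_inner_le_norm θ v
    have h2 : (inner ℝ θ v : ℝ) ^ 2 ≤ (‖θ‖ * ‖v‖) ^ 2 := sq_le_sq' (abs_le.1 h1).1 (abs_le.1 h1).2
    nlinarith [sq_nonneg (‖θ‖ * ‖v‖)]
  have h1 := Real.cos_le_one (inner ℝ θ x)
  have h2 := Real.cos_le_one (inner ℝ θ y)
  have h3 := Real.neg_one_le_cos (inner ℝ θ x)
  have h4 := Real.neg_one_le_cos (inner ℝ θ y)
  rcases min_cases 1 (‖θ‖ ^ 2) with ⟨e, -⟩ | ⟨e, -⟩ <;> rw [e, abs_le]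
  · constructor <;> nlinarith [sq_nonneg ‖x‖, sq_nonneg ‖y‖]
  · have hx := h x
    have hy := h y
    have : 0 ≤ ‖θ‖ ^ 2 := by positivity
    have hx' : 0 ≤ ‖x‖ ^ 2 * ‖θ‖ ^ 2 := by positivity
    have hy' : 0 ≤ ‖y‖ ^ 2 * ‖θ‖ ^ 2 := by positivity
    constructor <;> linarith

section
variable {α c C A : ℝ} {ψ : Plane → ℝ} {D : Set Plane}

/-- The splitting `1/ψ = 1/(ψ(1+ψ)) + 1/(1+ψ)` isolates the singularity at the origin from the slow
decay at infinity. At `θ = 0` the hypothesis on `w` forces the numerator to vanish. -/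
lemma div_symbol_eq_add (h : SymbolBound α c C ψ D) (hc : 0 < c) {θ : Plane} (hθ : θ ∈ D) {w : ℝ}
    (hw : |w| ≤ A * min 1 (‖θ‖ ^ 2)) : w / ψ θ = w / (ψ θ * (1 + ψ θ)) + w / (1 + ψ θ) := by
  rcases eq_or_ne θ 0 with rfl | h0
  · have : w = 0 := by simpa using hw
    simp [this]
  · have h1 := h.pos hc hθ h0
    field_simp

lemma abs_div_symbol_le (h : SymbolBound α c C ψ D) (hα : 0 < α) (hα2 : α < 2) (hc : 0 < c)
    (hA : 0 ≤ A) {θ : Plane} (hθ : θ ∈ D) {w : ℝ} (hw : |w| ≤ A * min 1 (‖θ‖ ^ 2)) :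
    |w / ψ θ| ≤ A * (2 ^ α / c) * (1 + ‖θ‖) ^ (-α) := by
  have h0 := h.nonneg θ
  rw [abs_div, abs_of_nonneg h0]
  calc |w| / ψ θ ≤ A * min 1 (‖θ‖ ^ 2) / ψ θ := by gcongr
    _ = A * (min 1 (‖θ‖ ^ 2) / ψ θ) := by ring
    _ ≤ A * (2 ^ α / c * (1 + ‖θ‖) ^ (-α)) := by gcongr; exact h.min_div_le hα hα2 hc hθ
    _ = _ := by ring

lemma abs_div_symbol_mul_le (h : SymbolBound α c C ψ D) (hα : 0 < α) (hα2 : α < 2) (hc : 0 < c)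
    (hA : 0 ≤ A) {θ : Plane} (hθ : θ ∈ D) {w : ℝ} (hw : |w| ≤ A * min 1 (‖θ‖ ^ 2)) :
    |w / (ψ θ * (1 + ψ θ))| ≤
      A * (2 ^ α / c) * (2 ^ α / min c 1) * (1 + ‖θ‖) ^ (-(2 * α)) := by
  have h1 := abs_div_symbol_le h hα hα2 hc hA hθ hw
  have h2 := h.resolvent_le hα hα2 hc hθ
  have h3 := resolvent_nonneg h θ
  rw [show w / (ψ θ * (1 + ψ θ)) = w / ψ θ * (1 / (1 + ψ θ)) by rw [div_mul_div_comm, mul_one],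
    abs_mul, abs_of_nonneg h3]
  have e : (1 + ‖θ‖) ^ (-(2 * α)) = (1 + ‖θ‖) ^ (-α) * (1 + ‖θ‖) ^ (-α) := by
    rw [← Real.rpow_add (by positivity)]; congr 1; ring
  refine (mul_le_mul h1 h2 h3 ((abs_nonneg _).trans h1)).trans (le_of_eq ?_)
  rw [e]; ring

lemma integrableOn_div_symbol (h : SymbolBound α c C ψ D) (hα : 1 < α) (hα2 : α < 2) (hc : 0 < c)
    (hA : 0 ≤ A) (hD : MeasurableSet D) (hDv : volume D ≠ ⊤) {W : Plane → ℝ} (hWm : Measurable W)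
    (hW : ∀ θ ∈ D, |W θ| ≤ A * min 1 (‖θ‖ ^ 2)) : IntegrableOn (fun θ => W θ / ψ θ) D := by
  refine Measure.integrableOn_of_bounded (M := A * (2 ^ α / c)) hDv
    (hWm.div (h.continuous hα).measurable).aestronglyMeasurable ?_
  refine (ae_restrict_iff' hD).2 (Eventually.of_forall fun θ hθ => ?_)
  refine (abs_div_symbol_le h (by linarith) hα2 hc hA hθ (hW θ hθ)).trans ?_
  refine mul_le_of_le_one_right (by positivity) ?_
  exact Real.rpow_le_one_of_one_le_of_nonpos (by linarith [norm_nonneg θ]) (by linarith)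

lemma integrableOn_div_one_add (h : SymbolBound α c C ψ D) (hα : 1 < α) (hD : MeasurableSet D)
    (hDv : volume D ≠ ⊤) {T : Plane → ℝ} (hTm : Measurable T) (hT : ∀ θ ∈ D, |T θ| ≤ A) :
    IntegrableOn (fun θ => T θ / (1 + ψ θ)) D := by
  refine Measure.integrableOn_of_bounded (M := A) hDv
    (hTm.div ((h.continuous hα).measurable.const_add 1)).aestronglyMeasurable ?_
  refine (ae_restrict_iff' hD).2 (Eventually.of_forall fun θ hθ => ?_)
  rw [div_eq_mul_one_div, norm_mul, Real.norm_of_nonneg (resolvent_nonneg h θ)]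
  exact (mul_le_of_le_one_right (norm_nonneg _) (resolvent_le_one h θ)).trans (hT θ hθ)

lemma integrableOn_div_symbol_mul (h : SymbolBound α c C ψ D) (hα : 1 < α) (hα2 : α < 2)
    (hc : 0 < c) (hA : 0 ≤ A) (hD : MeasurableSet D) {W : Plane → ℝ}
    (hWm : Measurable W) (hW : ∀ θ ∈ D, |W θ| ≤ A * min 1 (‖θ‖ ^ 2)) :
    IntegrableOn (fun θ => W θ / (ψ θ * (1 + ψ θ))) D := by
  have hψ := (h.continuous hα).measurable
  refine Integrable.mono' ((integrable_one_add_norm_plane (by linarith : 2 < 2 * α)).const_mul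
    (A * (2 ^ α / c) * (2 ^ α / min c 1))).integrableOn
    (hWm.div (hψ.mul (hψ.const_add 1))).aestronglyMeasurable ?_
  exact (ae_restrict_iff' hD).2 (Eventually.of_forall fun θ hθ =>
    abs_div_symbol_mul_le h (by linarith) hα2 hc hA hθ (hW θ hθ))

end

lemma tendsto_setIntegral_of_dominated {ι : Type*} {l : Filter ι} [l.IsCountablyGenerated]
    {F : ι → Plane → ℝ} {f g : Plane → ℝ} {D : ι → Set Plane} (hD : ∀ᶠ i in l, MeasurableSet (D i))
    (hmem : ∀ θ, ∀ᶠ i in l, θ ∈ D i) (hF : ∀ᶠ i in l, Measurable (F i)) (hg : Integrable g)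
    (hg0 : ∀ θ, 0 ≤ g θ) (hFg : ∀ᶠ i in l, ∀ θ ∈ D i, |F i θ| ≤ g θ)
    (hlim : ∀ θ, θ ≠ 0 → Tendsto (fun i => F i θ) l (𝓝 (f θ))) :
    Tendsto (fun i => ∫ θ in D i, F i θ) l (𝓝 (∫ θ, f θ)) := by
  have h : Tendsto (fun i => ∫ θ, (D i).indicator (F i) θ) l (𝓝 (∫ θ, f θ)) := by
    refine tendsto_integral_filter_of_dominated_convergence g ?_ ?_ hg ?_
    · filter_upwards [hD, hF] with i h1 h2
      exact (h2.indicator h1).aestronglyMeasurable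
    · filter_upwards [hFg] with i hi
      refine Eventually.of_forall fun θ => ?_
      by_cases hθ : θ ∈ D i
      · rw [Set.indicator_of_mem hθ]; exact hi θ hθ
      · rw [Set.indicator_of_notMem hθ, norm_zero]; exact hg0 θ
    · filter_upwards [ae_forall_ne 0] with θ hθ
      refine (hlim θ hθ).congr' ?_
      filter_upwards [hmem θ] with i hi
      rw [Set.indicator_of_mem hi]
  refine h.congr' ?_
  filter_upwards [hD] with i hi
  rw [integral_indicator hi]

/-- A family of symbols satisfying uniform bounds on domains that exhaust the plane. -/
structure SymbolFamily {ι : Type*} (l : Filter ι) (α c C : ℝ) (ψi : ι → Plane → ℝ)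
    (D : ι → Set Plane) (ψ : Plane → ℝ) : Prop where
  one_lt : 1 < α
  lt_two : α < 2
  c_pos : 0 < c
  C_nonneg : 0 ≤ C
  bound : ∀ᶠ i in l, SymbolBound α c C (ψi i) (D i)
  lim : ∀ θ, Tendsto (fun i => ψi i θ) l (𝓝 (ψ θ))
  limBound : SymbolBound α c C ψ Set.univ
  meas : ∀ i, MeasurableSet (D i)
  finite : ∀ i, volume (D i) ≠ ⊤
  mem : ∀ θ, ∀ᶠ i in l, θ ∈ D i
  osc : ∀ x b : Plane, inner ℝ b x = Real.pi / 2 →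
    Tendsto (fun i => ∫ θ in D i, Real.cos (inner ℝ θ x) / (1 + ψi i θ)) l (𝓝 (oscLimit ψ x b))

section
variable {ι : Type*} {l : Filter ι} [l.IsCountablyGenerated] {α c C A : ℝ} {ψi : ι → Plane → ℝ}
  {D : ι → Set Plane} {ψ : Plane → ℝ} (h : SymbolFamily l α c C ψi D ψ)
include h

lemma tendsto_integral_div_symbol_mul (hA : 0 ≤ A) {W : ι → Plane → ℝ} {w : Plane → ℝ}
    (hWm : ∀ᶠ i in l, Measurable (W i))
    (hW : ∀ᶠ i in l, ∀ θ ∈ D i, |W i θ| ≤ A * min 1 (‖θ‖ ^ 2))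
    (hlim : ∀ θ, Tendsto (fun i => W i θ) l (𝓝 (w θ))) :
    Tendsto (fun i => ∫ θ in D i, W i θ / (ψi i θ * (1 + ψi i θ))) l
      (𝓝 (∫ θ, w θ / (ψ θ * (1 + ψ θ)))) := by
  have hα := h.one_lt
  have hc := h.c_pos
  have hc1 : 0 < min c 1 := lt_min hc one_pos
  refine tendsto_setIntegral_of_dominated (Eventually.of_forall h.meas) h.mem ?_
    ((integrable_one_add_norm_plane (by linarith : 2 < 2 * α)).const_mul
      (A * (2 ^ α / c) * (2 ^ α / min c 1))) (fun θ => by positivity) ?_ ?_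
  · filter_upwards [hWm, h.bound] with i h1 h2
    have := (h2.continuous hα).measurable
    exact h1.div (this.mul (this.const_add 1))
  · filter_upwards [hW, h.bound] with i h1 h2 θ hθ
    exact abs_div_symbol_mul_le h2 (by linarith) h.lt_two hc hA hθ (h1 θ hθ)
  · intro θ hθ
    have h1 := h.limBound.pos hc (Set.mem_univ θ) hθ
    exact (hlim θ).div ((h.lim θ).mul ((h.lim θ).const_add 1)) (by positivity)

lemma tendsto_integral_div_one_add (hA : 0 ≤ A) {T : ι → Plane → ℝ} {t : Plane → ℝ}
    (hTm : ∀ᶠ i in l, Measurable (T i))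
    (hT : ∀ᶠ i in l, ∀ θ ∈ D i, |T i θ| ≤ A * (1 + ‖θ‖) ^ (-2 : ℝ))
    (hlim : ∀ θ, Tendsto (fun i => T i θ) l (𝓝 (t θ))) :
    Tendsto (fun i => ∫ θ in D i, T i θ / (1 + ψi i θ)) l (𝓝 (∫ θ, t θ / (1 + ψ θ))) := by
  have hα := h.one_lt
  have hc := h.c_pos
  have hc1 : 0 < min c 1 := lt_min hc one_pos
  refine tendsto_setIntegral_of_dominated (Eventually.of_forall h.meas) h.mem ?_
    ((integrable_one_add_norm_plane (by linarith : 2 < 2 + α)).const_mul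
      (A * (2 ^ α / min c 1))) (fun θ => by positivity) ?_ ?_
  · filter_upwards [hTm, h.bound] with i h1 h2
    exact h1.div ((h2.continuous hα).measurable.const_add 1)
  · filter_upwards [hT, h.bound] with i h1 h2 θ hθ
    rw [div_eq_mul_one_div, abs_mul, abs_of_nonneg (resolvent_nonneg h2 θ)]
    refine (mul_le_mul (h1 θ hθ) (h2.resolvent_le (by linarith) h.lt_two hc hθ)
      (resolvent_nonneg h2 θ) (by positivity)).trans (le_of_eq ?_)
    rw [neg_add, Real.rpow_add (by positivity)]; ring
  · intro θ hθ
    have h1 := h.limBound.nonneg θ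
    exact (hlim θ).div ((h.lim θ).const_add 1) (by positivity)

/-- The limit of the Green integrals of a point source. -/
lemma tendsto_integral_point_source {x x₀ b b₀ : Plane} (hb : inner ℝ b x = Real.pi / 2)
    (hb₀ : inner ℝ b₀ x₀ = Real.pi / 2) :
    Tendsto (fun i => ∫ θ in D i, (Real.cos (inner ℝ θ x) - Real.cos (inner ℝ θ x₀)) / ψi i θ) l
      (𝓝 ((∫ θ, (Real.cos (inner ℝ θ x) - Real.cos (inner ℝ θ x₀)) / (ψ θ * (1 + ψ θ))) +
        (oscLimit ψ x b - oscLimit ψ x₀ b₀))) := by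
  have hW : ∀ θ, _ := fun θ => abs_cos_inner_sub_le θ x x₀
  have hA : (0 : ℝ) ≤ 2 + ‖x‖ ^ 2 + ‖x₀‖ ^ 2 := by positivity
  have hWm : Measurable fun θ : Plane => Real.cos (inner ℝ θ x) - Real.cos (inner ℝ θ x₀) := by
    fun_prop
  refine ((tendsto_integral_div_symbol_mul h hA (W := fun _ θ => Real.cos (inner ℝ θ x) -
    Real.cos (inner ℝ θ x₀)) (Eventually.of_forall fun _ => hWm)
    (Eventually.of_forall fun _ θ _ => hW θ) (fun θ => tendsto_const_nhds)).add
    ((h.osc x b hb).sub (h.osc x₀ b₀ hb₀))).congr' ?_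
  filter_upwards [h.bound] with i hi
  have hint : ∀ y : Plane, IntegrableOn (fun θ => Real.cos (inner ℝ θ y) / (1 + ψi i θ)) (D i) :=
    fun y => integrableOn_div_one_add (A := 1) hi h.one_lt (h.meas i) (h.finite i) (by fun_prop)
      fun θ _ => Real.abs_cos_le_one _
  rw [← integral_sub (hint x) (hint x₀)]
  refine (integral_add (integrableOn_div_symbol_mul hi h.one_lt h.lt_two h.c_pos hA (h.meas i) hWm
    fun θ _ => hW θ) ((hint x).sub (hint x₀))).symm.trans ?_
  refine setIntegral_congr_fun (h.meas i) fun θ hθ => ?_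
  rw [div_symbol_eq_add hi h.c_pos hθ (hW θ), sub_div _ _ (1 + ψi i θ)]
  rfl

/-- The limit of the Green integrals of a spread-out source. -/
lemma tendsto_integral_smooth_source (hA : 0 ≤ A) {T : ι → Plane → ℝ} {t : Plane → ℝ} {m : ι → ℝ}
    {m₀ : ℝ} {x₀ b₀ : Plane} (hb₀ : inner ℝ b₀ x₀ = Real.pi / 2) (hTm : ∀ᶠ i in l, Measurable (T i))
    (hT : ∀ᶠ i in l, ∀ θ ∈ D i, |T i θ| ≤ A * (1 + ‖θ‖) ^ (-2 : ℝ))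
    (hW : ∀ᶠ i in l, ∀ θ ∈ D i, |T i θ - m i * Real.cos (inner ℝ θ x₀)| ≤ A * min 1 (‖θ‖ ^ 2))
    (hlim : ∀ θ, Tendsto (fun i => T i θ) l (𝓝 (t θ))) (hm : Tendsto m l (𝓝 m₀)) :
    Tendsto (fun i => ∫ θ in D i, (T i θ - m i * Real.cos (inner ℝ θ x₀)) / ψi i θ) l
      (𝓝 ((∫ θ, (t θ - m₀ * Real.cos (inner ℝ θ x₀)) / (ψ θ * (1 + ψ θ))) +
        ((∫ θ, t θ / (1 + ψ θ)) - m₀ * oscLimit ψ x₀ b₀))) := by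
  have hcm : Measurable fun θ : Plane => Real.cos (inner ℝ θ x₀) := by fun_prop
  refine ((tendsto_integral_div_symbol_mul h hA (W := fun i θ => T i θ - m i *
    Real.cos (inner ℝ θ x₀)) (hTm.mono fun i hi => hi.sub (hcm.const_mul _)) hW
    (fun θ => (hlim θ).sub (hm.mul_const _))).add
    ((tendsto_integral_div_one_add h hA hTm hT hlim).sub (hm.mul (h.osc x₀ b₀ hb₀)))).congr' ?_
  filter_upwards [h.bound, hTm, hT, hW] with i hi hTi hT hW
  have h1 : IntegrableOn (fun θ => T i θ / (1 + ψi i θ)) (D i) :=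
    integrableOn_div_one_add (A := A) hi h.one_lt (h.meas i) (h.finite i) hTi fun θ hθ => by
      refine (hT θ hθ).trans (mul_le_of_le_one_right hA ?_)
      exact Real.rpow_le_one_of_one_le_of_nonpos (by linarith [norm_nonneg θ]) (by norm_num)
  have h2 : IntegrableOn (fun θ => m i * (Real.cos (inner ℝ θ x₀) / (1 + ψi i θ))) (D i) :=
    (integrableOn_div_one_add (A := 1) hi h.one_lt (h.meas i) (h.finite i) hcm
      fun θ _ => Real.abs_cos_le_one _).const_mul _
  rw [← integral_const_mul, ← integral_sub h1 h2]
  refine (integral_add (integrableOn_div_symbol_mul hi h.one_lt h.lt_two h.c_pos hA (h.meas i)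
    (hTi.sub (hcm.const_mul _)) hW) (h1.sub h2)).symm.trans ?_
  refine setIntegral_congr_fun (h.meas i) fun θ hθ => ?_
  rw [div_symbol_eq_add hi h.c_pos hθ (hW θ hθ), sub_div _ _ (1 + ψi i θ), mul_div_assoc]
  rfl

end

/-! ### The two families -/

section
open scoped Pointwise

lemma freqSquare_eq_smul {n : ℕ} (hn : 0 < n) : freqSquare n = (n : ℝ) • freqSquare 1 := by
  have hn' : (0 : ℝ) < n := by exact_mod_cast hn
  ext θ
  rw [Set.mem_smul_set_iff_inv_smul_mem₀ hn'.ne']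
  refine forall_congr' fun i => ?_
  rw [PiLp.smul_apply, smul_eq_mul, abs_mul, abs_of_pos (inv_pos.2 hn'), Nat.cast_one, one_mul,
    inv_mul_le_iff₀ hn']

lemma freqSquare_eq_box (n : ℕ) : freqSquare n =
    {θ : Plane | ∀ i, θ i ∈ Set.Icc (-(n * Real.pi)) (n * Real.pi)} := by
  ext θ
  exact forall_congr' fun i => by rw [abs_le, Set.mem_Icc]

lemma measurableSet_freqSquare (n : ℕ) : MeasurableSet (freqSquare n) := by
  rw [freqSquare_eq_box]; exact measurableSet_box _ _

lemma volume_freqSquare_ne_top (n : ℕ) : volume (freqSquare n) ≠ ⊤ := by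
  rw [freqSquare_eq_box, volume_box]
  exact ENNReal.prod_ne_top fun i _ => ENNReal.ofReal_ne_top

lemma convex_freqSquare (n : ℕ) : Convex ℝ (freqSquare n) := by
  intro x hx y hy a b ha hb hab i
  have h1 := hx i
  have h2 := hy i
  calc |(a • x + b • y) i| = |a * x i + b * y i| := by simp
    _ ≤ a * |x i| + b * |y i| := by
      refine (abs_add_le _ _).trans ?_
      rw [abs_mul, abs_mul, abs_of_nonneg ha, abs_of_nonneg hb]
    _ ≤ a * (n * Real.pi) + b * (n * Real.pi) := by gcongr
    _ = _ := by rw [← add_mul, hab, one_mul]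

lemma ball_subset_freqSquare : Metric.ball (0 : Plane) 1 ⊆ freqSquare 1 := by
  intro x hx i
  have h1 := abs_apply_le_norm x i
  have h2 : ‖x‖ < 1 := by simpa using hx
  have := Real.pi_gt_three
  push_cast
  linarith

variable {α r M : ℝ} (hp : Params α r M)
include hp

/-- The same constants serve the fixed continuum symbol cut off by discs and the discrete symbols on
frequency squares. Since the limits depend only on the continuum symbol, this is what identifies the
two Green functions. -/
theorem exists_symbolFamily : ∃ c C,
    SymbolFamily atTop α c C (fun _ : ℝ => symbol α r M) (fun R => Metric.ball 0 R)
      (symbol α r M) ∧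
    ∀ φ : ℕ → ℕ, Tendsto φ atTop atTop →
      SymbolFamily atTop α c C (fun k => discSymbol α r M (φ k)) (fun k => freqSquare (φ k))
        (symbol α r M) := by
  obtain ⟨c, hc, C, hC, h1, h2⟩ := exists_symbolBound hp
  have hball : ∀ R : ℝ, SymbolBound α c C (symbol α r M) (Metric.ball 0 R) := fun R =>
    ⟨h2.nonneg, fun θ _ => h2.lower θ (Set.mem_univ _), h2.lip⟩
  refine ⟨c, C, ⟨hp.one_lt, hp.lt_two, hc, hC, Eventually.of_forall hball,
    fun θ => tendsto_const_nhds, h2, fun R => Metric.isOpen_ball.measurableSet,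
    fun R => measure_ball_lt_top.ne, fun θ => ?_, fun x b hb => ?_⟩, fun φ hφ => ?_⟩
  · filter_upwards [eventually_gt_atTop ‖θ‖] with R hR
    simpa using hR
  · refine tendsto_oscillatory hp.one_lt hp.lt_two hc hC (R := id) (Eventually.of_forall hball)
      (fun θ => tendsto_const_nhds) h2.nonneg (convex_ball 0 1) Metric.isOpen_ball.measurableSet
      measure_ball_lt_top.ne one_pos subset_rfl tendsto_id ?_ hb
    filter_upwards [eventually_gt_atTop 0] with R hR
    exact ball_eq_smul hR
  · have hl : ∀ θ, Tendsto (fun k => discSymbol α r M (φ k) θ) atTop (𝓝 (symbol α r M θ)) :=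
      fun θ => (tendsto_discSymbol hp θ).comp hφ
    refine ⟨hp.one_lt, hp.lt_two, hc, hC, hφ.eventually h1, hl, h2,
      fun k => measurableSet_freqSquare _, fun k => volume_freqSquare_ne_top _,
      fun θ => hφ.eventually (eventually_mem_freqSquare θ), fun x b hb => ?_⟩
    refine tendsto_oscillatory hp.one_lt hp.lt_two hc hC (R := fun k => (φ k : ℝ))
      (hφ.eventually h1) hl h2.nonneg (convex_freqSquare 1) (measurableSet_freqSquare 1)
      (volume_freqSquare_ne_top 1) one_pos ball_subset_freqSquare
      (tendsto_natCast_atTop_atTop.comp hφ) ?_ hb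
    filter_upwards [hφ.eventually_gt_atTop 0] with k hk
    exact freqSquare_eq_smul hk

/-- The integrals defining the discrete Green's function converge absolutely. -/
theorem eventually_integrableOn_discGreen (x₀ : Plane) : ∀ᶠ n in atTop, ∀ x : Plane,
    IntegrableOn (fun θ => (Real.cos (inner ℝ θ x) - Real.cos (inner ℝ θ x₀)) /
      discSymbol α r M n θ) (freqSquare n) := by
  obtain ⟨c, C, -, h⟩ := exists_symbolFamily hp
  have h := h id tendsto_id
  filter_upwards [h.bound] with n hn x
  exact integrableOn_div_symbol hn h.one_lt h.lt_two h.c_pos (by positivity)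
    (measurableSet_freqSquare _) (volume_freqSquare_ne_top _) (by fun_prop)
    fun θ _ => abs_cos_inner_sub_le θ x x₀

end

/-! ### The continuum Green's function -/

/-- The vector parallel to `x` whose inner product with `x` is `π / 2`. -/
def halfVec (x : Plane) : Plane := (Real.pi / (2 * ‖x‖ ^ 2)) • x

lemma inner_halfVec {x : Plane} (hx : x ≠ 0) : inner ℝ (halfVec x) x = Real.pi / 2 := by
  have : 0 < ‖x‖ := norm_pos_iff.2 hx
  rw [halfVec, inner_smul_left, real_inner_self_eq_norm_sq]
  simp; field_simp

lemma norm_halfVec {x : Plane} (hx : x ≠ 0) : ‖halfVec x‖ = Real.pi / 2 * ‖x‖⁻¹ := by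
  have : 0 < ‖x‖ := norm_pos_iff.2 hx
  have := Real.pi_pos
  rw [halfVec, norm_smul, Real.norm_of_nonneg (by positivity)]
  field_simp

lemma halfVec_ne_zero {x : Plane} (hx : x ≠ 0) : halfVec x ≠ 0 := by
  intro h
  have := inner_halfVec hx
  rw [h, inner_zero_left] at this
  linarith [Real.pi_pos]

section
variable {α r M : ℝ} (hp : Params α r M) {x₀ : Plane} (hx₀ : x₀ ≠ 0)
include hp hx₀

theorem tendsto_cutoffGreen {x : Plane} (hx : x ≠ 0) :
    Tendsto (fun R => cutoffGreen α r M x₀ R x) atTop (𝓝 (green α r M x₀ x)) := by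
  obtain ⟨c, C, h, -⟩ := exists_symbolFamily hp
  exact tendsto_nhds_limUnder ⟨_, (tendsto_integral_point_source h (inner_halfVec hx)
    (inner_halfVec hx₀)).const_mul (1 / (2 * Real.pi) ^ 2)⟩

/-- Taking `b = halfVec x`, of norm `π/(2‖x‖)`, turns the oscillatory bound into the singularity
`‖x‖^{-(2-α)}`, locally integrable in the plane. Uniformity in the cut-off gives a dominating
function for integration against `ρ`. -/
lemma exists_cutoffGreen_bound : ∃ E, 0 ≤ E ∧ ∀ R > 0, ∀ x : Plane, x ≠ 0 →
    |cutoffGreen α r M x₀ R x| ≤ E * (1 + ‖x‖ ^ 2) + E * ‖x‖ ^ (-(2 - α)) := by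
  obtain ⟨c, C, h, -⟩ := exists_symbolFamily hp
  have hα := h.one_lt
  have hα2 := h.lt_two
  have hc := h.c_pos
  have hc1 : 0 < min c 1 := lt_min hc one_pos
  obtain ⟨K, hK, hosc⟩ := exists_oscillatory_bound h.limBound hα hα2 hc h.C_nonneg
  set ψ := symbol α r M
  have hint := integrable_one_add_norm_plane (by linarith : 2 < 2 * α)
  obtain ⟨I, hI⟩ : ∃ I, I = (2 ^ α / c) * (2 ^ α / min c 1) *
    ∫ θ : Plane, (1 + ‖θ‖) ^ (-(2 * α)) := ⟨_, rfl⟩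
  have hI0 : 0 ≤ I := by
    rw [hI]
    exact mul_nonneg (by positivity) (integral_nonneg fun θ => by positivity)
  obtain ⟨J, hJ⟩ : ∃ J, J = K * ‖halfVec x₀‖ ^ (2 - α) := ⟨_, rfl⟩
  have hJ0 : 0 ≤ J := by rw [hJ]; positivity
  refine ⟨1 / (2 * Real.pi) ^ 2 * ((2 + ‖x₀‖ ^ 2) * I + J + K * (Real.pi / 2) ^ (2 - α)),
    by positivity, fun R hR x hx => ?_⟩
  have hi : SymbolBound α c C ψ (Metric.ball 0 R) :=
    ⟨h.limBound.nonneg, fun θ _ => h.limBound.lower θ (Set.mem_univ _), h.limBound.lip⟩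
  have hDm : MeasurableSet (Metric.ball (0 : Plane) R) := h.meas R
  have hDv : volume (Metric.ball (0 : Plane) R) ≠ ⊤ := h.finite R
  have hW : ∀ θ, _ := fun θ => abs_cos_inner_sub_le θ x x₀
  have hA : (0 : ℝ) ≤ 2 + ‖x‖ ^ 2 + ‖x₀‖ ^ 2 := by positivity
  have hWm : Measurable fun θ : Plane => Real.cos (inner ℝ θ x) - Real.cos (inner ℝ θ x₀) := by
    fun_prop
  have hint1 : ∀ y : Plane, IntegrableOn (fun θ => Real.cos (inner ℝ θ y) / (1 + ψ θ))
      (Metric.ball 0 R) := fun y => integrableOn_div_one_add (A := 1) hi hα hDm hDv (by fun_prop)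
      fun θ _ => Real.abs_cos_le_one _
  have hreg := integrableOn_div_symbol_mul hi hα hα2 hc hA hDm hWm fun θ _ => hW θ
  have hsplit : cutoffGreen α r M x₀ R x = 1 / (2 * Real.pi) ^ 2 *
      ((∫ θ in Metric.ball 0 R, (Real.cos (inner ℝ θ x) - Real.cos (inner ℝ θ x₀)) /
        (ψ θ * (1 + ψ θ))) + ((∫ θ in Metric.ball 0 R, Real.cos (inner ℝ θ x) / (1 + ψ θ)) -
        ∫ θ in Metric.ball 0 R, Real.cos (inner ℝ θ x₀) / (1 + ψ θ))) := by
    rw [cutoffGreen, ← integral_sub (hint1 x) (hint1 x₀)]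
    congr 1
    refine Eq.trans ?_ (integral_add hreg ((hint1 x).sub (hint1 x₀)))
    refine setIntegral_congr_fun hDm fun θ hθ => ?_
    rw [div_symbol_eq_add hi hc hθ (hW θ), sub_div _ _ (1 + ψ θ)]
  have h1 : |∫ θ in Metric.ball 0 R, (Real.cos (inner ℝ θ x) - Real.cos (inner ℝ θ x₀)) /
        (ψ θ * (1 + ψ θ))| ≤ (2 + ‖x‖ ^ 2 + ‖x₀‖ ^ 2) * I := by
    have h2 : |∫ θ in Metric.ball 0 R, (Real.cos (inner ℝ θ x) - Real.cos (inner ℝ θ x₀)) /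
        (ψ θ * (1 + ψ θ))| ≤ ∫ θ in Metric.ball (0 : Plane) R, (2 + ‖x‖ ^ 2 + ‖x₀‖ ^ 2) * (2 ^ α / c) *
          (2 ^ α / min c 1) * (1 + ‖θ‖) ^ (-(2 * α)) := by
      rw [← Real.norm_eq_abs]
      exact norm_integral_le_of_norm_le (hint.const_mul _).integrableOn
        ((ae_restrict_iff' hDm).2 (Eventually.of_forall fun θ hθ =>
          abs_div_symbol_mul_le hi (by linarith) hα2 hc hA hθ (hW θ)))
    refine h2.trans ((setIntegral_le_integral (hint.const_mul _)
      (Eventually.of_forall fun θ => by positivity)).trans (le_of_eq ?_))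
    rw [integral_const_mul, hI]; ring
  have h3 := hosc R hR x _ (halfVec_ne_zero hx) (inner_halfVec hx)
  have h4 := hosc R hR x₀ _ (halfVec_ne_zero hx₀) (inner_halfVec hx₀)
  rw [norm_halfVec hx, Real.mul_rpow (by positivity) (by positivity), Real.inv_rpow (norm_nonneg _),
    ← Real.rpow_neg (norm_nonneg _)] at h3
  rw [← hJ] at h4
  rw [hsplit, abs_mul, abs_of_nonneg (by positivity : 0 ≤ 1 / (2 * Real.pi) ^ 2), mul_assoc,
    mul_assoc, ← mul_add]
  refine mul_le_mul_of_nonneg_left ?_ (by positivity)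
  refine (abs_add_le _ _).trans ((add_le_add h1 ((abs_sub _ _).trans (add_le_add h3 h4))).trans ?_)
  have p1 : 0 ≤ ‖x‖ ^ (-(2 - α)) := by positivity
  have p2 : 0 ≤ ‖x‖ ^ 2 := by positivity
  have p3 : 0 ≤ (Real.pi / 2) ^ (2 - α) := by positivity
  nlinarith [mul_nonneg p2 hI0, mul_nonneg p2 hJ0, mul_nonneg p1 hI0, mul_nonneg p1 hJ0,
    mul_nonneg (mul_nonneg hK p3) p2, mul_nonneg hK p3, mul_nonneg (mul_nonneg (sq_nonneg ‖x₀‖) hI0) p2,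
    mul_nonneg (mul_nonneg (sq_nonneg ‖x₀‖) hI0) p1]

/-- The potential of `ρ` as a Fourier integral. -/
def potential (α r M : ℝ) (x₀ : Plane) (ρ : Plane → ℝ) (x : Plane) : ℝ :=
  1 / (2 * Real.pi) ^ 2 * ((∫ θ, (contFourier ρ θ (inner ℝ θ x) - contFourier ρ 0 0 *
      Real.cos (inner ℝ θ x₀)) / (symbol α r M θ * (1 + symbol α r M θ))) +
    ((∫ θ, contFourier ρ θ (inner ℝ θ x) / (1 + symbol α r M θ)) -
      contFourier ρ 0 0 * oscLimit (symbol α r M) x₀ (halfVec x₀)))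

section
variable {ρ : Plane → ℝ} {R B K : ℝ} (hs : SourceBound ρ R B K)
include hs

omit hp hx₀ in
lemma SourceBound.integrable_mul {g : Plane → ℝ} (hg : Continuous g) :
    Integrable fun y => g y * ρ y := by
  refine (hg.mul hs.cont).integrable_of_hasCompactSupport (HasCompactSupport.mul_left ?_)
  refine HasCompactSupport.intro (isCompact_closedBall (0 : Plane) R) fun y hy => hs.supp y ?_
  simpa using hy

omit hp hx₀ in
lemma contFourier_sub_eq (x₀ x θ : Plane) :
    contFourier ρ θ (inner ℝ θ x) - contFourier ρ 0 0 * Real.cos (inner ℝ θ x₀) =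
      ∫ y, (Real.cos (inner ℝ θ (x - y)) - Real.cos (inner ℝ θ x₀)) * ρ y := by
  rw [contFourier, contFourier, ← integral_mul_const, ← integral_sub]
  · refine integral_congr_ae (Eventually.of_forall fun y => ?_)
    simp [inner_sub_right]; ring
  · simpa only [mul_comm] using hs.integrable_mul
      (g := fun y => Real.cos (inner ℝ θ x - inner ℝ θ y)) (by fun_prop)
  · have := (hs.integrable_mul (g := fun _ => 1) continuous_const).mul_const
      (Real.cos (inner ℝ θ x₀))
    simpa using this

omit hp hx₀ in
lemma abs_contFourier_sub_le (x₀ x θ : Plane) :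
    |contFourier ρ θ (inner ℝ θ x) - contFourier ρ 0 0 * Real.cos (inner ℝ θ x₀)| ≤
      (∫ y, (2 + ‖x - y‖ ^ 2 + ‖x₀‖ ^ 2) * |ρ y|) * min 1 (‖θ‖ ^ 2) := by
  rw [contFourier_sub_eq hs, ← integral_mul_const, ← Real.norm_eq_abs]
  refine norm_integral_le_of_norm_le (Integrable.mul_const ?_ _) (Eventually.of_forall fun y => ?_)
  · have := (hs.integrable_mul (g := fun y => 2 + ‖x - y‖ ^ 2 + ‖x₀‖ ^ 2) (by fun_prop)).abs
    refine this.congr (Eventually.of_forall fun y => ?_)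
    simp only [abs_mul]
    rw [abs_of_nonneg (by positivity : 0 ≤ 2 + ‖x - y‖ ^ 2 + ‖x₀‖ ^ 2)]
  · rw [norm_mul, mul_right_comm]
    exact mul_le_mul_of_nonneg_right (abs_cos_inner_sub_le θ (x - y) x₀) (abs_nonneg _)

omit hx₀ in
-- At finite cut-off, dividing by the symbol leaves a bounded function of `θ`, with polynomial
-- growth in `y`, so Fubini applies before the cut-off is removed.
lemma integral_cutoffGreen (T : ℝ) (x : Plane) : ∫ y, cutoffGreen α r M x₀ T (x - y) * ρ y =
    1 / (2 * Real.pi) ^ 2 * ∫ θ in Metric.ball 0 T, (contFourier ρ θ (inner ℝ θ x) -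
      contFourier ρ 0 0 * Real.cos (inner ℝ θ x₀)) / symbol α r M θ := by
  obtain ⟨c, C, h, -⟩ := exists_symbolFamily hp
  have hc := h.c_pos
  have hψ := h.limBound.continuous h.one_lt
  have hswap := integral_integral_swap (μ := (volume : Measure Plane))
    (ν := volume.restrict (Metric.ball (0 : Plane) T)) (f := fun y θ =>
      (Real.cos (inner ℝ θ (x - y)) - Real.cos (inner ℝ θ x₀)) * ρ y / symbol α r M θ) (by
    have hi := ((hs.integrable_mul (g := fun y => 2 + ‖x - y‖ ^ 2 + ‖x₀‖ ^ 2) (by fun_prop)).abs).mul_prod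
      (integrableOn_const (C := 2 ^ α / c) (h.finite T) : IntegrableOn _ _ _)
    refine hi.mono' ?_ (Eventually.of_forall fun p => ?_)
    · have hρ := hs.cont
      refine Measurable.aestronglyMeasurable (Measurable.div ?_ (hψ.measurable.comp measurable_snd))
      exact Continuous.measurable (by fun_prop)
    · simp only [Function.uncurry]
      have h1 : |(Real.cos (inner ℝ p.2 (x - p.1)) - Real.cos (inner ℝ p.2 x₀)) /
          symbol α r M p.2| ≤ (2 + ‖x - p.1‖ ^ 2 + ‖x₀‖ ^ 2) * (2 ^ α / c) := by
        refine (abs_div_symbol_le h.limBound (by linarith [h.one_lt]) h.lt_two hc (by positivity)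
          (Set.mem_univ p.2) (abs_cos_inner_sub_le p.2 (x - p.1) x₀)).trans ?_
        refine mul_le_of_le_one_right (by positivity) ?_
        exact Real.rpow_le_one_of_one_le_of_nonpos (by linarith [norm_nonneg p.2])
          (by linarith [h.one_lt])
      rw [mul_div_right_comm, norm_mul, abs_mul, abs_of_nonneg (by positivity :
        0 ≤ 2 + ‖x - p.1‖ ^ 2 + ‖x₀‖ ^ 2), mul_right_comm]
      exact mul_le_mul_of_nonneg_right h1 (abs_nonneg _))
  calc _ = 1 / (2 * Real.pi) ^ 2 * ∫ y, ∫ θ in Metric.ball 0 T,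
        (Real.cos (inner ℝ θ (x - y)) - Real.cos (inner ℝ θ x₀)) * ρ y / symbol α r M θ := by
        rw [← integral_const_mul]
        refine integral_congr_ae (Eventually.of_forall fun y => ?_)
        simp only [cutoffGreen]
        rw [mul_assoc, ← integral_mul_const]
        congr 2
        ext θ
        ring
    _ = _ := by
        rw [hswap]
        congr 1
        refine integral_congr_ae (Eventually.of_forall fun θ => ?_)
        simp only
        rw [integral_div, ← contFourier_sub_eq hs]

lemma tendsto_integral_cutoffGreen (x : Plane) :
    Tendsto (fun T => ∫ y, cutoffGreen α r M x₀ T (x - y) * ρ y) atTop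
      (𝓝 (potential α r M x₀ ρ x)) := by
  obtain ⟨c, C, h, -⟩ := exists_symbolFamily hp
  simp only [integral_cutoffGreen hp hs]
  refine Tendsto.const_mul _ ?_
  have hcm : Measurable fun θ => contFourier ρ θ (inner ℝ θ x) := by
    have hρ := hs.cont
    have : StronglyMeasurable (fun p : Plane × Plane =>
      ρ p.2 * Real.cos (inner ℝ p.1 x - inner ℝ p.1 p.2)) :=
      Continuous.stronglyMeasurable (by fun_prop)
    exact this.integral_prod_right'.measurable
  obtain ⟨A, hA⟩ : ∃ A, A = max (2 * (B * (2 * R + 7) ^ 2) + Real.pi ^ 2 * (K * (2 * R + 9) ^ 2))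
    (∫ y, (2 + ‖x - y‖ ^ 2 + ‖x₀‖ ^ 2) * |ρ y|) := ⟨_, rfl⟩
  have hA0 : 0 ≤ A := by
    rw [hA]
    exact le_max_of_le_right (integral_nonneg fun y => by positivity)
  refine tendsto_integral_smooth_source h hA0 (inner_halfVec hx₀)
    (T := fun _ θ => contFourier ρ θ (inner ℝ θ x)) (m := fun _ => contFourier ρ 0 0)
    (Eventually.of_forall fun _ => hcm)
    (Eventually.of_forall fun _ θ _ => (contFourier_decay hs θ _).trans ?_)
    (Eventually.of_forall fun _ θ _ => (abs_contFourier_sub_le hs x₀ x θ).trans ?_)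
    (fun θ => tendsto_const_nhds) tendsto_const_nhds
  · rw [hA]; gcongr; exact le_max_left _ _
  · rw [hA]; gcongr; exact le_max_right _ _

lemma exists_green_majorant (x : Plane) : ∃ g : Plane → ℝ, Integrable g ∧
    ∀ᵐ y, ∀ T > 0, |cutoffGreen α r M x₀ T (x - y) * ρ y| ≤ g y := by
  obtain ⟨E, hE0, hE⟩ := exists_cutoffGreen_bound hp hx₀
  have hα2 := hp.lt_two
  have hα := hp.one_lt
  have hB := hs.B_nonneg
  have hm : MeasurableSet (Metric.ball (0 : Plane) (‖x‖ + R + 1)) := Metric.isOpen_ball.measurableSet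
  refine ⟨fun y => E * ((1 + ‖x - y‖ ^ 2) * |ρ y|) +
    E * B * (Metric.ball (0 : Plane) (‖x‖ + R + 1)).indicator (fun v => ‖v‖ ^ (-(2 - α))) (x - y),
    ?_, ?_⟩
  · refine Integrable.add (Integrable.const_mul ?_ _) (Integrable.const_mul ?_ _)
    · refine (hs.integrable_mul (g := fun y => 1 + ‖x - y‖ ^ 2) (by fun_prop)).abs.congr
        (Eventually.of_forall fun y => ?_)
      simp only [abs_mul]
      rw [abs_of_nonneg (by positivity : 0 ≤ 1 + ‖x - y‖ ^ 2)]
    · exact ((integrableOn_ball_rpow (by linarith : 2 - α < 2) _).integrable_indicator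
        hm).comp_sub_left x
  · filter_upwards [ae_forall_ne x] with y hy T hT
    by_cases hyR : R < ‖y‖
    · rw [hs.supp y hyR, mul_zero, abs_zero, mul_zero, mul_zero, zero_add]
      exact mul_nonneg (by positivity) (Set.indicator_nonneg (fun _ _ => by positivity) _)
    · rw [Set.indicator_of_mem (by
        have := norm_sub_le x y
        rw [mem_ball_zero_iff]; linarith [not_lt.1 hyR]), abs_mul]
      calc _ ≤ (E * (1 + ‖x - y‖ ^ 2) + E * ‖x - y‖ ^ (-(2 - α))) * |ρ y| := by
            gcongr
            exact hE T hT _ (sub_ne_zero.2 hy.symm)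
        _ ≤ E * ((1 + ‖x - y‖ ^ 2) * |ρ y|) + E * ‖x - y‖ ^ (-(2 - α)) * B := by
            rw [add_mul, mul_assoc]
            gcongr
            exact hs.bound y
        _ = _ := by ring

omit hx₀ hs in
lemma measurable_cutoffGreen (T : ℝ) : Measurable (cutoffGreen α r M x₀ T) := by
  obtain ⟨c, C, h, -⟩ := exists_symbolFamily hp
  have hψ := (h.limBound.continuous h.one_lt).measurable
  have : Measurable (fun p : Plane × Plane =>
      (Real.cos (inner ℝ p.2 p.1) - Real.cos (inner ℝ p.2 x₀)) / symbol α r M p.2) :=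
    Measurable.div (Continuous.measurable (by fun_prop)) (hψ.comp measurable_snd)
  exact (this.stronglyMeasurable.integral_prod_right'
    (ν := volume.restrict (Metric.ball (0 : Plane) T))).measurable.const_mul _

omit hs in
lemma tendsto_cutoffGreen_mul (x : Plane) : ∀ᵐ y, Tendsto (fun T =>
    cutoffGreen α r M x₀ T (x - y) * ρ y) atTop (𝓝 (green α r M x₀ (x - y) * ρ y)) := by
  filter_upwards [ae_forall_ne x] with y hy
  exact (tendsto_cutoffGreen hp hx₀ (sub_ne_zero.2 hy.symm)).mul_const _

omit hx₀ in
lemma aestronglyMeasurable_cutoffGreen_mul (x : Plane) (T : ℝ) :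
    AEStronglyMeasurable (fun y => cutoffGreen α r M x₀ T (x - y) * ρ y) volume :=
  (((measurable_cutoffGreen hp T).comp (measurable_const.sub measurable_id)).mul
    hs.cont.measurable).aestronglyMeasurable

theorem integrable_green_mul (x : Plane) : Integrable fun y => green α r M x₀ (x - y) * ρ y := by
  obtain ⟨g, hg, hle⟩ := exists_green_majorant hp hx₀ hs x
  have hlim := tendsto_cutoffGreen_mul hp hx₀ (ρ := ρ) x
  refine hg.mono' (aestronglyMeasurable_of_tendsto_ae atTop
    (aestronglyMeasurable_cutoffGreen_mul hp hs x) hlim) ?_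
  filter_upwards [hle, hlim] with y h1 h2
  refine le_of_tendsto h2.abs ?_
  filter_upwards [eventually_gt_atTop 0] with T hT
  exact h1 T hT

/-- Both sides are the limit of the cut-off integrals: one by dominated convergence in space, the
other by Fubini and convergence in frequency. -/
theorem integral_green_mul (x : Plane) :
    ∫ y, green α r M x₀ (x - y) * ρ y = potential α r M x₀ ρ x := by
  obtain ⟨g, hg, hle⟩ := exists_green_majorant hp hx₀ hs x
  refine tendsto_nhds_unique (tendsto_integral_filter_of_dominated_convergence g
    (Eventually.of_forall (aestronglyMeasurable_cutoffGreen_mul hp hs x)) ?_ hg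
    (tendsto_cutoffGreen_mul hp hx₀ x)) (tendsto_integral_cutoffGreen hp hx₀ hs x)
  filter_upwards [eventually_gt_atTop 0] with T hT
  filter_upwards [hle] with y hy
  exact hy T hT

end

end

/-! ### The discrete potential -/

/-- The discrete potential of `ρ`. -/
def discPotential (α r M : ℝ) (x₀ : Plane) (ρ : Plane → ℝ) (n : ℕ) (x : Plane) : ℝ :=
  1 / (n : ℝ) ^ 2 * ∑ᶠ w : Idx, discGreen α r M x₀ n (x - latticePt n w) * ρ (latticePt n w)

lemma discObstacle_eq (α r M : ℝ) (x₀ : Plane) (ρ : Plane → ℝ) (n : ℕ) (z : Idx) :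
    discObstacle α r M x₀ ρ n z =
      -(‖latticePt n z‖ ^ 2 / discSigmaSq α r M n) - discPotential α r M x₀ ρ n (latticePt n z) :=
  rfl

section
variable {α r M : ℝ} {ρ : Plane → ℝ} {R B K : ℝ} (hs : SourceBound ρ R B K) {n : ℕ} (hn : 0 < n)
include hs hn

lemma latFourier_sub_eq (x₀ x θ : Plane) :
    latFourier ρ n θ (inner ℝ θ x) - latFourier ρ n 0 0 * Real.cos (inner ℝ θ x₀) =
      1 / (n : ℝ) ^ 2 * ∑ w ∈ latBox R n, (Real.cos (inner ℝ θ (x - latticePt n w)) -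
        Real.cos (inner ℝ θ x₀)) * ρ (latticePt n w) := by
  rw [latFourier_eq_sum hs hn, latFourier_eq_sum hs hn, mul_assoc, ← mul_sub, Finset.sum_mul]
  congr 1
  refine (Finset.sum_sub_distrib _ _).symm.trans (Finset.sum_congr rfl fun w _ => ?_)
  simp only [inner_sub_right, inner_zero_left, sub_zero, Real.cos_zero]
  ring

lemma abs_latFourier_sub_le (x₀ x θ : Plane) :
    |latFourier ρ n θ (inner ℝ θ x) - latFourier ρ n 0 0 * Real.cos (inner ℝ θ x₀)| ≤
      (2 + (‖x‖ + R) ^ 2 + ‖x₀‖ ^ 2) * (B * (2 * R + 7) ^ 2) * min 1 (‖θ‖ ^ 2) := by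
  have hn' : (0 : ℝ) < n := by exact_mod_cast hn
  have hB := hs.B_nonneg
  have hR := hs.R_nonneg
  have hm : 0 ≤ min 1 (‖θ‖ ^ 2) := by positivity
  rw [latFourier_sub_eq hs hn, abs_mul, abs_of_pos (by positivity : 0 < 1 / (n : ℝ) ^ 2)]
  have h1 : |∑ w ∈ latBox R n, (Real.cos (inner ℝ θ (x - latticePt n w)) -
        Real.cos (inner ℝ θ x₀)) * ρ (latticePt n w)| ≤
      (latBox R n).card * ((2 + (‖x‖ + R) ^ 2 + ‖x₀‖ ^ 2) * min 1 (‖θ‖ ^ 2) * B) := by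
    refine (Finset.abs_sum_le_sum_abs _ _).trans ?_
    rw [← nsmul_eq_mul]
    refine Finset.sum_le_card_nsmul _ _ _ fun w _ => ?_
    rcases lt_or_ge R ‖latticePt n w‖ with h | h
    · rw [hs.supp _ h, mul_zero, abs_zero]; positivity
    · rw [abs_mul]
      refine mul_le_mul ((abs_cos_inner_sub_le θ _ x₀).trans ?_) (hs.bound _) (abs_nonneg _)
        (by positivity)
      have := norm_sub_le x (latticePt n w)
      gcongr
      linarith
  have h2 := card_latBox_le hs.R_nonneg hn
  calc _ ≤ 1 / (n : ℝ) ^ 2 * ((n ^ 2 * (2 * R + 7) ^ 2) *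
        ((2 + (‖x‖ + R) ^ 2 + ‖x₀‖ ^ 2) * min 1 (‖θ‖ ^ 2) * B)) := by
        refine mul_le_mul_of_nonneg_left (h1.trans ?_) (by positivity)
        gcongr
    _ = _ := by field_simp

lemma continuous_latFourier {g : Plane → ℝ} (hg : Continuous g) :
    Continuous fun θ => latFourier ρ n θ (g θ) := by
  simp only [latFourier_eq_sum hs hn]
  fun_prop

lemma discPotential_eq {x₀ : Plane} (hint : ∀ x : Plane, IntegrableOn (fun θ =>
      (Real.cos (inner ℝ θ x) - Real.cos (inner ℝ θ x₀)) / discSymbol α r M n θ) (freqSquare n))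
    (x : Plane) : discPotential α r M x₀ ρ n x = 1 / (2 * Real.pi) ^ 2 * ∫ θ in freqSquare n,
      (latFourier ρ n θ (inner ℝ θ x) - latFourier ρ n 0 0 * Real.cos (inner ℝ θ x₀)) /
        discSymbol α r M n θ := by
  simp only [latFourier_sub_eq hs hn]
  rw [discPotential, finsum_eq_sum_of_support_subset (s := latBox R n)]
  · have e : ∀ θ, (1 / (n : ℝ) ^ 2 * ∑ w ∈ latBox R n, (Real.cos (inner ℝ θ (x - latticePt n w)) -
        Real.cos (inner ℝ θ x₀)) * ρ (latticePt n w)) / discSymbol α r M n θ =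
        1 / (n : ℝ) ^ 2 * ∑ w ∈ latBox R n, (Real.cos (inner ℝ θ (x - latticePt n w)) -
        Real.cos (inner ℝ θ x₀)) / discSymbol α r M n θ * ρ (latticePt n w) := fun θ => by
      rw [mul_div_assoc, Finset.sum_div]
      congr 1
      exact Finset.sum_congr rfl fun w _ => by ring
    simp only [e]
    rw [integral_const_mul, integral_finsetSum _ fun w _ => (hint _).mul_const _, mul_left_comm,
      Finset.mul_sum _ _ (1 / (2 * Real.pi) ^ 2)]
    congr 1
    refine Finset.sum_congr rfl fun w _ => ?_
    rw [integral_mul_const, discGreen]; ring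
  · intro w hw
    by_contra h
    exact hw (by simp [source_eq_zero hs hn (by linarith) (Finset.mem_coe.not.1 h)])

/-- Cosines are eigenfunctions of symmetric second differences; summing `2(cos t - 1)` over the
jumps will reproduce minus the symbol. -/
lemma latFourier_add_add_sub (θ : Plane) (β t : ℝ) :
    latFourier ρ n θ (β + t) + latFourier ρ n θ (β - t) - 2 * latFourier ρ n θ β =
      2 * (Real.cos t - 1) * latFourier ρ n θ β := by
  have e : ∀ a : ℝ, Real.cos (β + t - a) + Real.cos (β - t - a) - 2 * Real.cos (β - a) =
      2 * (Real.cos t - 1) * Real.cos (β - a) := fun a => by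
    rw [show β + t - a = (β - a) + t by ring, show β - t - a = (β - a) - t by ring, Real.cos_add,
      Real.cos_sub (β - a)]
    ring
  calc _ = 1 / (n : ℝ) ^ 2 * ∑ w ∈ latBox R n, ρ (latticePt n w) *
        (Real.cos (β + t - inner ℝ θ (latticePt n w)) +
          Real.cos (β - t - inner ℝ θ (latticePt n w)) -
          2 * Real.cos (β - inner ℝ θ (latticePt n w))) := by
        simp only [latFourier_eq_sum hs hn, mul_sub, mul_add, Finset.sum_sub_distrib,
          Finset.sum_add_distrib, mul_left_comm _ (2 : ℝ), ← Finset.mul_sum]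
    _ = _ := by
        simp only [e, latFourier_eq_sum hs hn, Finset.mul_sum]
        exact Finset.sum_congr rfl fun w _ => by ring

end

/-! ### Orthogonality of lattice cosines on the frequency square. -/

lemma integral_cos_mul_eq_zero {n : ℕ} (hn : 0 < n) {u : ℤ} (hu : u ≠ 0) :
    ∫ s in Set.Icc (-(n * Real.pi)) (n * Real.pi), Real.cos (s * ((u : ℝ) / n)) = 0 := by
  have hn' : (0 : ℝ) < n := by exact_mod_cast hn
  have hu' : (u : ℝ) ≠ 0 := by exact_mod_cast hu
  have hpi := Real.pi_pos
  rw [integral_Icc_eq_integral_Ioc, ← intervalIntegral.integral_of_le (by nlinarith),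
    intervalIntegral.integral_comp_mul_right _ (div_ne_zero hu' hn'.ne'), integral_cos,
    show (n : ℝ) * Real.pi * (u / n) = u * Real.pi by field_simp,
    show -((n : ℝ) * Real.pi) * (u / n) = -(u * Real.pi) by field_simp, Real.sin_neg,
    Real.sin_int_mul_pi]
  simp

lemma integral_sin_mul_eq_zero (a b : ℝ) :
    ∫ s in Set.Icc (-a) a, Real.sin (s * b) = 0 := by
  rcases le_or_gt 0 a with ha | ha
  · rw [integral_Icc_eq_integral_Ioc, ← intervalIntegral.integral_of_le (by linarith)]
    have h := intervalIntegral.integral_comp_neg (a := -a) (b := a) fun s => Real.sin (s * b)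
    simp only [neg_mul, Real.sin_neg, intervalIntegral.integral_neg, neg_neg] at h
    linarith
  · rw [Set.Icc_eq_empty (by linarith), setIntegral_empty]

lemma integral_box_cos (a : ℝ) (v : Plane) :
    ∫ θ in {θ : Plane | ∀ i, θ i ∈ Set.Icc (-a) a}, Real.cos (inner ℝ θ v) =
      (∫ s in Set.Icc (-a) a, Real.cos (s * v 0)) * ∫ s in Set.Icc (-a) a, Real.cos (s * v 1) := by
  have hmp := (volume_preserving_finTwoArrow ℝ).comp (PiLp.volume_preserving_ofLp (Fin 2))
  have hme : MeasurableEmbedding (MeasurableEquiv.finTwoArrow ∘ (@WithLp.ofLp 2 (Fin 2 → ℝ))) :=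
    (MeasurableEquiv.finTwoArrow.measurableEmbedding).comp
      (MeasurableEquiv.toLp 2 (Fin 2 → ℝ)).symm.measurableEmbedding
  have h := hmp.setIntegral_preimage_emb hme
    (fun p : ℝ × ℝ => Real.cos (p.1 * v 0 + p.2 * v 1)) (Set.Icc (-a) a ×ˢ Set.Icc (-a) a)
  have e1 : (MeasurableEquiv.finTwoArrow ∘ (@WithLp.ofLp 2 (Fin 2 → ℝ))) ⁻¹'
      (Set.Icc (-a) a ×ˢ Set.Icc (-a) a) = {θ : Plane | ∀ i, θ i ∈ Set.Icc (-a) a} := by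
    ext θ; simp only [Set.mem_preimage, Set.mem_prod]
    exact ⟨fun h i => by fin_cases i <;> [exact h.1; exact h.2], fun h => ⟨h 0, h 1⟩⟩
  rw [e1] at h
  simp only [inner_plane]
  refine h.trans ?_
  simp only [Real.cos_add]
  have hc : ∀ w : ℝ, IntegrableOn (fun s => Real.cos (s * w)) (Set.Icc (-a) a) := fun w =>
    Continuous.integrableOn_Icc (by fun_prop)
  have hsn : ∀ w : ℝ, IntegrableOn (fun s => Real.sin (s * w)) (Set.Icc (-a) a) := fun w =>
    Continuous.integrableOn_Icc (by fun_prop)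
  rw [Measure.volume_eq_prod, integral_sub]
  · rw [setIntegral_prod_mul (fun s => Real.cos (s * v 0)) (fun s => Real.cos (s * v 1)),
      setIntegral_prod_mul (fun s => Real.sin (s * v 0)) (fun s => Real.sin (s * v 1)),
      integral_sin_mul_eq_zero, zero_mul, sub_zero]
  · rw [← Measure.prod_restrict]; exact (hc _).mul_prod (hc _)
  · rw [← Measure.prod_restrict]; exact (hsn _).mul_prod (hsn _)

lemma integral_freqSquare_cos {n : ℕ} (hn : 0 < n) (u : Idx) :
    ∫ θ in freqSquare n, Real.cos (inner ℝ θ (latticePt n u)) =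
      if u = 0 then (2 * Real.pi * n) ^ 2 else 0 := by
  have hn' : (0 : ℝ) < n := by exact_mod_cast hn
  have hpi := Real.pi_pos
  rw [freqSquare_eq_box, integral_box_cos]
  simp only [latticePt_apply]
  split_ifs with h
  · simp only [h, Pi.zero_apply, Int.cast_zero, zero_div, mul_zero, Real.cos_zero]
    rw [setIntegral_const, Measure.real, Real.volume_Icc, ENNReal.toReal_ofReal (by have := mul_pos hn' hpi; linarith)]
    simp; ring
  · have : u 0 ≠ 0 ∨ u 1 ≠ 0 := by
      by_contra! h'
      exact h (funext fun i => by fin_cases i <;> [exact h'.1; exact h'.2])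
    rcases this with h | h
    · rw [integral_cos_mul_eq_zero hn h, zero_mul]
    · rw [integral_cos_mul_eq_zero hn h, mul_zero]

/-! ### Convergence, Lipschitz bound and Poisson equation for the discrete potentials. -/

section
variable {α r M : ℝ} (hp : Params α r M) {x₀ : Plane} (hx₀ : x₀ ≠ 0) {ρ : Plane → ℝ} {R B K : ℝ}
  (hs : SourceBound ρ R B K)
include hp hs

include hx₀ in
/-- Convergence of the discrete potentials along convergent sequences. -/
theorem tendsto_discPotential {φ : ℕ → ℕ} (hφ : Tendsto φ atTop atTop) {x : ℕ → Plane} {y : Plane}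
    (hx : Tendsto x atTop (𝓝 y)) :
    Tendsto (fun k => discPotential α r M x₀ ρ (φ k) (x k)) atTop
      (𝓝 (∫ w, green α r M x₀ (y - w) * ρ w)) := by
  rw [integral_green_mul hp hx₀ hs]
  obtain ⟨c, C, -, h⟩ := exists_symbolFamily hp
  have h := h φ hφ
  have hB := hs.B_nonneg
  have hR := hs.R_nonneg
  have hK := hs.K_nonneg
  obtain ⟨A, hA⟩ : ∃ A, A = max (2 * (B * (2 * R + 7) ^ 2) + Real.pi ^ 2 * (K * (2 * R + 9) ^ 2))
    ((2 + (‖y‖ + 1 + R) ^ 2 + ‖x₀‖ ^ 2) * (B * (2 * R + 7) ^ 2)) := ⟨_, rfl⟩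
  have hA0 : 0 ≤ A := by rw [hA]; exact le_max_of_le_right (by positivity)
  have hpos := hφ.eventually_gt_atTop 0
  have hxb : ∀ᶠ k in atTop, ‖x k‖ ≤ ‖y‖ + 1 := by
    filter_upwards [hx.norm.eventually_lt_const (lt_add_one ‖y‖)] with k hk using hk.le
  have key := tendsto_integral_smooth_source h hA0 (inner_halfVec hx₀)
    (T := fun k θ => latFourier ρ (φ k) θ (inner ℝ θ (x k)))
    (t := fun θ => contFourier ρ θ (inner ℝ θ y))
    (m := fun k => latFourier ρ (φ k) 0 0) (m₀ := contFourier ρ 0 0) ?_ ?_ ?_ ?_ ?_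
  · refine (key.const_mul (1 / (2 * Real.pi) ^ 2)).congr' ?_
    filter_upwards [hpos, hφ.eventually (eventually_integrableOn_discGreen hp x₀)] with k h1 h2
    exact (discPotential_eq hs h1 h2 (x k)).symm
  · filter_upwards [hpos] with k hk
    exact (continuous_latFourier hs hk (by fun_prop)).measurable
  · filter_upwards [hpos] with k hk θ hθ
    refine (latFourier_decay hs hk hθ _).trans ?_
    rw [hA]; gcongr; exact le_max_left _ _
  · filter_upwards [hpos, hxb] with k hk hxk θ hθ
    refine (abs_latFourier_sub_le hs hk x₀ (x k) θ).trans ?_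
    rw [hA]; gcongr
    refine le_trans ?_ (le_max_right _ _)
    gcongr
  · exact fun θ => tendsto_latFourier hs hφ (tendsto_const_nhds.inner hx) θ
  · exact tendsto_latFourier hs hφ tendsto_const_nhds 0

/-- The discrete potentials are Lipschitz, uniformly in the scale. -/
theorem exists_discPotential_lipschitz (x₀ : Plane) : ∃ L, 0 ≤ L ∧ ∀ᶠ n in atTop, ∀ x v : Plane,
    |discPotential α r M x₀ ρ n (x + v) - discPotential α r M x₀ ρ n x| ≤ L * ‖v‖ := by
  obtain ⟨c, C, -, h⟩ := exists_symbolFamily hp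
  have h := h id tendsto_id
  have hc := h.c_pos
  have hα := h.one_lt
  have hα2 := h.lt_two
  have hB := hs.B_nonneg
  have hR := hs.R_nonneg
  have hK := hs.K_nonneg
  obtain ⟨A, hA⟩ : ∃ A, A = 2 * (B * (2 * R + 7) ^ 2) + Real.pi ^ 2 * (K * (2 * R + 9) ^ 2) :=
    ⟨_, rfl⟩
  have hA0 : 0 ≤ A := by rw [hA]; positivity
  -- A majorant for `|θ|(1+|θ|)^{-2}/ψ`: near the origin `ψ ≥ c|θ|²` leaves `|θ|^{-1}`, and at
  -- infinity the decay is `|θ|^{-(1+α)}`. The factor `|θ|` comes from the phase increment.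
  set g : Plane → ℝ := fun θ => 2 ^ α / c * (1 + ‖θ‖) ^ (-(1 + α)) +
    1 / c * (Metric.ball (0 : Plane) 1).indicator (fun θ => ‖θ‖ ^ (-1 : ℝ)) θ with hg
  have hgi : Integrable g :=
    ((integrable_one_add_norm_plane (by linarith)).const_mul _).add
      (((integrableOn_ball_rpow (by norm_num) 1).integrable_indicator
        Metric.isOpen_ball.measurableSet).const_mul _)
  have hg0 : ∀ θ, 0 ≤ g θ := fun θ => add_nonneg (by positivity)
    (mul_nonneg (by positivity) (Set.indicator_nonneg (fun _ _ => by positivity) _))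
  refine ⟨1 / (2 * Real.pi) ^ 2 * (A * ∫ θ, g θ), mul_nonneg (by positivity)
    (mul_nonneg hA0 (integral_nonneg hg0)), ?_⟩
  filter_upwards [h.bound, eventually_gt_atTop 0, eventually_integrableOn_discGreen hp x₀]
    with n hb hn hint x v
  change SymbolBound α c C (discSymbol α r M n) (freqSquare n) at hb
  have hDm := measurableSet_freqSquare n
  have hI : ∀ y : Plane, IntegrableOn (fun θ => (latFourier ρ n θ (inner ℝ θ y) -
      latFourier ρ n 0 0 * Real.cos (inner ℝ θ x₀)) / discSymbol α r M n θ) (freqSquare n) :=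
    fun y => integrableOn_div_symbol hb hα hα2 hc (by positivity) hDm (volume_freqSquare_ne_top n)
      ((continuous_latFourier hs hn (by fun_prop)).sub (by fun_prop)).measurable
      fun θ _ => abs_latFourier_sub_le hs hn x₀ y θ
  rw [discPotential_eq hs hn hint, discPotential_eq hs hn hint, ← mul_sub,
    ← integral_sub (hI _) (hI _), abs_mul, abs_of_pos (by positivity), mul_assoc]
  refine mul_le_mul_of_nonneg_left ?_ (by positivity)
  rw [← Real.norm_eq_abs, mul_right_comm, ← integral_const_mul]
  refine (norm_integral_le_of_norm_le (g := fun θ => A * ‖v‖ * g θ) (hgi.const_mul _).integrableOn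
    ((ae_restrict_iff' hDm).2 ?_)).trans (setIntegral_le_integral (hgi.const_mul _)
      (Eventually.of_forall fun θ => mul_nonneg (by positivity) (hg0 θ)))
  filter_upwards [ae_forall_ne 0] with θ hθ0 hθ
  have hψ := hb.pos hc hθ hθ0
  have hθn : 0 < ‖θ‖ := norm_pos_iff.2 hθ0
  have e : (latFourier ρ n θ (inner ℝ θ (x + v)) - latFourier ρ n 0 0 * Real.cos (inner ℝ θ x₀)) /
      discSymbol α r M n θ - (latFourier ρ n θ (inner ℝ θ x) - latFourier ρ n 0 0 *
        Real.cos (inner ℝ θ x₀)) / discSymbol α r M n θ =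
      2 * Real.sin (inner ℝ θ v / 2) * latFourier ρ n θ (inner ℝ θ x + inner ℝ θ v / 2 +
        Real.pi / 2) / discSymbol α r M n θ := by
    rw [← latFourier_shift hs hn, inner_add_right, ← sub_div]; congr 1; ring
  rw [e, norm_div, norm_mul, Real.norm_of_nonneg hψ.le]
  have h1 : ‖2 * Real.sin (inner ℝ θ v / 2)‖ ≤ ‖θ‖ * ‖v‖ := by
    rw [norm_mul, Real.norm_two, Real.norm_eq_abs]
    have h2 := Real.abs_sin_le_abs (x := inner ℝ θ v / 2)
    rw [abs_div, abs_two] at h2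
    linarith [abs_real_inner_le_norm θ v]
  have h2 : ‖latFourier ρ n θ (inner ℝ θ x + inner ℝ θ v / 2 + Real.pi / 2)‖ ≤
      A * (1 + ‖θ‖) ^ (-2 : ℝ) := by
    rw [hA]; exact latFourier_decay hs hn hθ _
  have h3 : ‖θ‖ * (1 + ‖θ‖) ^ (-2 : ℝ) / discSymbol α r M n θ ≤ g θ := by
    rw [hg]
    rcases lt_or_ge ‖θ‖ 1 with ht | ht
    · refine le_trans ?_ (le_add_of_nonneg_left (by positivity))
      rw [Set.indicator_of_mem (by simpa using ht), Real.rpow_neg_one, div_le_iff₀ hψ]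
      have h4 := hb.lower θ hθ
      rw [min_eq_left (by
        rw [← Real.rpow_two]
        exact Real.rpow_le_rpow_of_exponent_ge hθn ht.le hα2.le)] at h4
      calc ‖θ‖ * (1 + ‖θ‖) ^ (-2 : ℝ) ≤ ‖θ‖ := mul_le_of_le_one_right hθn.le
            (Real.rpow_le_one_of_one_le_of_nonpos (by linarith) (by norm_num))
        _ = 1 / c * ‖θ‖⁻¹ * (c * ‖θ‖ ^ 2) := by field_simp
        _ ≤ _ := by gcongr
    · refine le_trans ?_ (le_add_of_nonneg_right (mul_nonneg (by positivity)
        (Set.indicator_nonneg (fun _ _ => by positivity) _)))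
      have h4 := hb.min_div_le (by linarith) hα2 hc hθ
      rw [min_eq_left (one_le_pow₀ ht)] at h4
      have h5 : ‖θ‖ * (1 + ‖θ‖) ^ (-2 : ℝ) ≤ (1 + ‖θ‖) ^ (-1 : ℝ) := by
        calc _ ≤ (1 + ‖θ‖) * (1 + ‖θ‖) ^ (-2 : ℝ) := by gcongr; linarith
          _ = _ := by
            rw [← Real.rpow_one_add' (by positivity) (by norm_num)]; norm_num
      calc _ = (‖θ‖ * (1 + ‖θ‖) ^ (-2 : ℝ)) * (1 / discSymbol α r M n θ) := by ring
        _ ≤ (1 + ‖θ‖) ^ (-1 : ℝ) * (2 ^ α / c * (1 + ‖θ‖) ^ (-α)) := by gcongr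
        _ = _ := by
          rw [neg_add, Real.rpow_add (by positivity)]; ring
  calc _ ≤ (‖θ‖ * ‖v‖) * (A * (1 + ‖θ‖) ^ (-2 : ℝ)) / discSymbol α r M n θ := by gcongr
    _ = A * ‖v‖ * (‖θ‖ * (1 + ‖θ‖) ^ (-2 : ℝ) / discSymbol α r M n θ) := by ring
    _ ≤ _ := by gcongr

/-- The discrete potential solves the discrete Poisson equation. -/
theorem eventually_discLap_discPotential (x₀ : Plane) : ∀ᶠ n in atTop, ∀ z : Idx,
    discLap α r M n (fun w => discPotential α r M x₀ ρ n (latticePt n w)) z =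
      -ρ (latticePt n z) := by
  obtain ⟨c, C, -, h⟩ := exists_symbolFamily hp
  have h := h id tendsto_id
  have hB := hs.B_nonneg
  have hR := hs.R_nonneg
  have hc := h.c_pos
  filter_upwards [h.bound, eventually_goodScale hp, eventually_integrableOn_discGreen hp x₀]
    with n hb hg hint z
  change SymbolBound α c C (discSymbol α r M n) (freqSquare n) at hb
  have hn := hg.pos
  have hn' : (0 : ℝ) < n := by exact_mod_cast hn
  have hpi := Real.pi_pos
  have hDm := measurableSet_freqSquare n
  set F : Idx → Plane → ℝ := fun w θ => (latFourier ρ n θ (inner ℝ θ (latticePt n w)) -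
      latFourier ρ n 0 0 * Real.cos (inner ℝ θ x₀)) / discSymbol α r M n θ with hF
  have hI : ∀ w, IntegrableOn (F w) (freqSquare n) :=
    fun w => integrableOn_div_symbol hb h.one_lt h.lt_two hc (by positivity) hDm
      (volume_freqSquare_ne_top n)
      ((continuous_latFourier hs hn (by fun_prop)).sub (by fun_prop)).measurable
      fun θ _ => abs_latFourier_sub_le hs hn x₀ _ θ
  rw [sum_kern_symm hg]
  simp only [discPotential_eq hs hn hint]
  have hI2 : ∀ v, IntegrableOn (fun θ => F (z + v) θ + F (z - v) θ) (freqSquare n) :=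
    fun v => (hI _).add (hI _)
  have hI3 : ∀ v, IntegrableOn (fun θ => kern α r M n v *
      ((F (z + v) θ + F (z - v) θ - 2 * F z θ) / 2)) (freqSquare n) :=
    fun v => (((hI2 v).sub ((hI _).const_mul 2)).div_const 2).const_mul _
  have e1 : ∀ v, kern α r M n v * ((1 / (2 * Real.pi) ^ 2 * (∫ θ in freqSquare n, F (z + v) θ) +
      1 / (2 * Real.pi) ^ 2 * (∫ θ in freqSquare n, F (z - v) θ) -
      2 * (1 / (2 * Real.pi) ^ 2 * ∫ θ in freqSquare n, F z θ)) / 2) =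
      1 / (2 * Real.pi) ^ 2 * ∫ θ in freqSquare n,
        kern α r M n v * ((F (z + v) θ + F (z - v) θ - 2 * F z θ) / 2) := by
    intro v
    rw [integral_const_mul, integral_div, integral_sub (hI2 v) ((hI _).const_mul 2),
      integral_add (hI _) (hI _), integral_const_mul]
    ring
  refine (Finset.sum_congr rfl fun v _ => e1 v).trans ?_
  rw [← Finset.mul_sum, ← integral_finsetSum _ fun v _ => hI3 v]
  -- The normalising `cos(θ·x₀)` cancels in second differences, and summation over the jumps
  -- produces the factor `-ψ`, which cancels the denominator away from `θ = 0`.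
  have e2 : ∀ᵐ θ ∂(volume.restrict (freqSquare n)), ∑ v ∈ latBox M n,
      kern α r M n v * ((F (z + v) θ + F (z - v) θ - 2 * F z θ) / 2) =
      -latFourier ρ n θ (inner ℝ θ (latticePt n z)) := by
    refine (ae_restrict_iff' hDm).2 ?_
    filter_upwards [ae_forall_ne 0] with θ hθ0 hθ
    have hψ := hb.pos hc hθ hθ0
    have e3 : ∀ v, kern α r M n v * ((F (z + v) θ + F (z - v) θ - 2 * F z θ) / 2) =
        kern α r M n v * (1 - Real.cos (inner ℝ θ (latticePt n v))) *
          (-latFourier ρ n θ (inner ℝ θ (latticePt n z)) / discSymbol α r M n θ) := by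
      intro v
      have e4 := latFourier_add_add_sub hs hn θ (inner ℝ θ (latticePt n z))
        (inner ℝ θ (latticePt n v))
      have e5 : F (z + v) θ + F (z - v) θ - 2 * F z θ =
          (2 * (Real.cos (inner ℝ θ (latticePt n v)) - 1) *
            latFourier ρ n θ (inner ℝ θ (latticePt n z))) / discSymbol α r M n θ := by
        rw [← e4]
        simp only [hF, latticePt_add, latticePt_sub, inner_add_right, inner_sub_right]
        ring
      rw [e5]; ring
    rw [Finset.sum_congr rfl fun v _ => e3 v, ← Finset.sum_mul, ← discSymbol_eq hg]
    field_simp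
  rw [integral_congr_ae e2, integral_neg]
  -- Fourier inversion on the lattice: orthogonality of the cosines keeps only the term `w = z`. The
  -- box is enlarged by `‖latticePt n z‖` so that it contains `z`.
  have e6 : ∀ θ, latFourier ρ n θ (inner ℝ θ (latticePt n z)) = 1 / (n : ℝ) ^ 2 *
      ∑ w ∈ latBox (R + ‖latticePt n z‖) n,
        ρ (latticePt n w) * Real.cos (inner ℝ θ (latticePt n (z - w))) := by
    intro θ
    rw [latFourier, tsum_eq_sum (s := latBox (R + ‖latticePt n z‖) n)]
    · simp only [latticePt_sub, inner_sub_right]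
    · intro w hw
      rw [source_eq_zero hs hn (by linarith [norm_nonneg (latticePt n z)]) hw, zero_mul]
  simp only [e6]
  rw [integral_const_mul, integral_finsetSum]
  · simp only [integral_const_mul, integral_freqSquare_cos hn, sub_eq_zero, eq_comm (a := z)]
    simp only [mul_ite, mul_zero]
    rw [Finset.sum_ite_eq' _ z, if_pos (mem_latBox_of_norm_le hn (by linarith))]
    field_simp
  · intro w _
    have hcos : IntegrableOn (fun θ => Real.cos (inner ℝ θ (latticePt n (z - w)))) (freqSquare n) :=
      Measure.integrableOn_of_bounded (M := 1) (volume_freqSquare_ne_top n)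
        (Continuous.aestronglyMeasurable (by fun_prop))
        (Eventually.of_forall fun θ => Real.abs_cos_le_one _)
    exact hcos.const_mul _

end

/-! ### The discrete operator on explicit functions -/

lemma norm_latticePt_le_of_mem_latBox {M : ℝ} (hM : 0 ≤ M) {n : ℕ} (hn : 0 < n) {z : Idx}
    (hz : z ∈ latBox M n) : ‖latticePt n z‖ ≤ 2 * (M + 3) := by
  have hn' : (1 : ℝ) ≤ n := by exact_mod_cast hn
  have h1 : ∀ i, (latticePt n z i) ^ 2 ≤ (M + 3) ^ 2 := fun i => by
    have h2 : |(z i : ℝ)| ≤ (⌈(n : ℝ) * (M + 2)⌉₊ : ℝ) := by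
      exact_mod_cast mem_idxBox.1 hz i
    have h3 := (Nat.ceil_lt_add_one (by positivity : 0 ≤ (n : ℝ) * (M + 2))).le
    rw [sq_le_sq, abs_of_nonneg (by linarith : 0 ≤ M + 3), latticePt_apply, abs_div,
      abs_of_pos (by linarith : (0 : ℝ) < n), div_le_iff₀ (by linarith)]
    nlinarith
  have h := norm_sq_plane (latticePt n z)
  nlinarith [h1 0, h1 1, norm_nonneg (latticePt n z), sq_nonneg (M + 3)]

section
variable {α r M : ℝ} (hp : Params α r M) {n : ℕ} (hn : GoodScale α r M n)
include hn

lemma discLap_add (f g : Idx → ℝ) (z : Idx) :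
    discLap α r M n (fun w => f w + g w) z = discLap α r M n f z + discLap α r M n g z := by
  simp only [discLap_eq hn]
  rw [← Finset.sum_add_distrib]
  exact Finset.sum_congr rfl fun v _ => by ring

lemma discLap_const_mul (a : ℝ) (f : Idx → ℝ) (z : Idx) :
    discLap α r M n (fun w => a * f w) z = a * discLap α r M n f z := by
  simp only [discLap_eq hn]
  rw [Finset.mul_sum]
  exact Finset.sum_congr rfl fun v _ => by ring

lemma discLap_const (a : ℝ) (z : Idx) : discLap α r M n (fun _ => a) z = 0 := by
  simp [discLap_eq hn]

lemma discLap_translate (f : Idx → ℝ) (z w : Idx) :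
    discLap α r M n (fun u => f (u + w)) z = discLap α r M n f (z + w) := by
  simp only [discLap_eq hn, add_right_comm]

lemma discSigmaSq_eq_sum : discSigmaSq α r M n =
    ∑ v ∈ latBox M n, kern α r M n v * ‖latticePt n v‖ ^ 2 := by
  rw [discSigmaSq, discLap_eq hn]
  simp

lemma discLap_normSq (z : Idx) :
    discLap α r M n (fun w => ‖latticePt n w‖ ^ 2) z = discSigmaSq α r M n := by
  rw [sum_kern_symm hn, discSigmaSq_eq_sum hn]
  refine Finset.sum_congr rfl fun v _ => ?_
  rw [latticePt_add, latticePt_sub, @norm_add_sq_real, @norm_sub_sq_real]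
  ring

lemma discLap_inner (b : Plane) (z : Idx) :
    discLap α r M n (fun w => inner ℝ b (latticePt n w)) z = 0 := by
  rw [sum_kern_symm hn]
  refine Finset.sum_eq_zero fun v _ => ?_
  rw [latticePt_add, latticePt_sub, inner_add_right, inner_sub_right]
  ring

include hp in
lemma discLap_mono {f g : Idx → ℝ} {z : Idx} (hz : f z = g z)
    (h : ∀ v ∈ latBox M n, f (z + v) ≤ g (z + v)) :
    discLap α r M n f z ≤ discLap α r M n g z := by
  rw [discLap_eq hn, discLap_eq hn, hz]
  refine Finset.sum_le_sum fun v hv => ?_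
  exact mul_le_mul_of_nonneg_left (by linarith [h v hv]) (kern_nonneg hp hn v)

include hp in
lemma discLap_le_of_second_difference {f : Idx → ℝ} {z : Idx} {b : ℝ}
    (h : ∀ v ∈ latBox M n, f (z + v) + f (z - v) - 2 * f z ≤ 2 * b * ‖latticePt n v‖ ^ 2) :
    discLap α r M n f z ≤ b * discSigmaSq α r M n := by
  rw [sum_kern_symm hn, discSigmaSq_eq_sum hn, Finset.mul_sum]
  refine Finset.sum_le_sum fun v hv => ?_
  calc _ ≤ kern α r M n v * ((2 * b * ‖latticePt n v‖ ^ 2) / 2) :=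
        mul_le_mul_of_nonneg_left (by linarith [h v hv]) (kern_nonneg hp hn v)
    _ = _ := by ring

end

/-! ### The barrier -/

/-- The function `√(1 + |x|²)`. -/
def bracket (x : Plane) : ℝ := √(1 + ‖x‖ ^ 2)

lemma bracket_sq (x : Plane) : bracket x ^ 2 = 1 + ‖x‖ ^ 2 := Real.sq_sqrt (by positivity)

lemma one_le_bracket (x : Plane) : 1 ≤ bracket x := Real.one_le_sqrt.2 (by simp)

lemma norm_le_bracket (x : Plane) : ‖x‖ ≤ bracket x := Real.le_sqrt_of_sq_le (by simp)

lemma bracket_le (x : Plane) : bracket x ≤ 1 + ‖x‖ :=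
  Real.sqrt_le_iff.2 ⟨by positivity, by nlinarith [norm_nonneg x]⟩

lemma bracket_add_le (x v : Plane) : bracket (x + v) ≤ bracket x + ‖v‖ := by
  have h0 := one_le_bracket x
  refine Real.sqrt_le_iff.2 ⟨by positivity, ?_⟩
  have h1 := norm_add_le x v
  have h2 := bracket_sq x
  have h3 := norm_le_bracket x
  nlinarith [norm_nonneg x, norm_nonneg v, norm_nonneg (x + v)]

lemma abs_bracket_sub_le (x v : Plane) : |bracket (x + v) - bracket x| ≤ ‖v‖ := by
  have h1 := bracket_add_le x v
  have h2 := bracket_add_le (x + v) (-v)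
  rw [add_neg_cancel_right, norm_neg] at h2
  rw [abs_le]; constructor <;> linarith

/-- Quantitative convexity of `√(1+|x|²)`. After squaring, Cauchy–Schwarz with `‖x‖² = t² - 1`
instead of `t²` leaves a spare `‖v‖²`, out of which the quadratic gain `c‖v‖²` is paid; the
hypothesis says that this is enough. For `c = 0` it is plain convexity. -/
lemma bracket_lower {c : ℝ} (hc : 0 ≤ c) {x v : Plane}
    (h : (2 * c * (bracket x + ‖v‖) + c ^ 2 * ‖v‖ ^ 2) * bracket x ^ 2 ≤ 1) :
    bracket x + inner ℝ x v / bracket x + c * ‖v‖ ^ 2 ≤ bracket (x + v) := by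
  refine Real.le_sqrt_of_sq_le ?_
  have ht := one_le_bracket x
  have ht2 := bracket_sq x
  have hin := abs_real_inner_le_norm x v
  have hx := norm_le_bracket x
  rw [@norm_add_sq_real]
  set t := bracket x with htdef
  set i : ℝ := inner ℝ x v
  obtain ⟨j, hj⟩ : ∃ j, j = i / t := ⟨_, rfl⟩
  have hi : i = j * t := by rw [hj]; field_simp
  have hj1 : |j| ≤ ‖v‖ := by
    rw [hj, abs_div, abs_of_pos (by linarith : 0 < t), div_le_iff₀ (by linarith), mul_comm]
    exact hin.trans (by gcongr)
  have hj2 : j ^ 2 * t ^ 2 ≤ (t ^ 2 - 1) * ‖v‖ ^ 2 := by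
    have : i ^ 2 ≤ (‖x‖ * ‖v‖) ^ 2 := sq_le_sq' (abs_le.1 hin).1 (abs_le.1 hin).2
    rw [hi] at this
    have e : ‖x‖ ^ 2 = t ^ 2 - 1 := by linarith
    nlinarith
  rw [← hj]
  have h1 : 0 < t ^ 2 := by positivity
  have h2 : (t + j + c * ‖v‖ ^ 2) ^ 2 * t ^ 2 ≤ (1 + (‖x‖ ^ 2 + 2 * i + ‖v‖ ^ 2)) * t ^ 2 := by
    have e : (1 + (‖x‖ ^ 2 + 2 * i + ‖v‖ ^ 2)) * t ^ 2 - (t + j + c * ‖v‖ ^ 2) ^ 2 * t ^ 2 =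
        ((t ^ 2 - 1) * ‖v‖ ^ 2 - j ^ 2 * t ^ 2) + ‖v‖ ^ 2 * (1 - (2 * c * (t + j) +
          c ^ 2 * ‖v‖ ^ 2) * t ^ 2) := by rw [hi]; linear_combination (-t ^ 2) * ht2
    have h3 : (2 * c * (t + j) + c ^ 2 * ‖v‖ ^ 2) * t ^ 2 ≤ 1 := by
      refine le_trans ?_ h
      gcongr
      exact (le_abs_self j).trans hj1
    have h4 := mul_nonneg (sq_nonneg ‖v‖) (sub_nonneg.2 h3)
    linarith
  exact le_of_mul_le_mul_right h2 h1

/-- The squared positive part has second derivative at most `2`, hence the `2ν²`; the first-order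
term enters only through `max a 0`, with the favourable sign. -/
lemma max_sq_second_difference_le {a p q ν d : ℝ} (hp : |p| ≤ ν) (hq : |q| ≤ ν) (hpq : 2 * d ≤ p + q) : max (a - p) 0 ^ 2 + max (a - q) 0 ^ 2 - 2 * max a 0 ^ 2 ≤
      2 * ν ^ 2 - 4 * max a 0 * d := by
  have hν : 0 ≤ ν := (abs_nonneg p).trans hp
  rcases le_or_gt 0 a with ha | ha
  · have h : ∀ u, |u| ≤ ν → max (a - u) 0 ^ 2 ≤ a ^ 2 - 2 * a * u + ν ^ 2 := fun u hu => by
      have h1 : max (a - u) 0 ^ 2 ≤ (a - u) ^ 2 := by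
        rw [sq_le_sq, abs_of_nonneg (le_max_right _ _)]
        exact max_le (le_abs_self _) (abs_nonneg _)
      have h2 : u ^ 2 ≤ ν ^ 2 := sq_le_sq' (abs_le.1 hu).1 (abs_le.1 hu).2
      linarith
    rw [max_eq_left ha]
    nlinarith [h p hp, h q hq]
  · have h : ∀ u, |u| ≤ ν → max (a - u) 0 ^ 2 ≤ ν ^ 2 := fun u hu => by
      refine pow_le_pow_left₀ (le_max_right _ _) (max_le ?_ hν) 2
      linarith [(abs_le.1 hu).1]
    rw [max_eq_right ha.le]
    nlinarith [h p hp, h q hq]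

/-- The barrier `(T - √(1 + |x|²))₊²`. -/
def barrier (T : ℝ) (x : Plane) : ℝ := max (T - bracket x) 0 ^ 2

lemma barrier_nonneg (T : ℝ) (x : Plane) : 0 ≤ barrier T x := by unfold barrier; positivity

lemma barrier_le {T : ℝ} (hT : 0 ≤ T) (x : Plane) : barrier T x ≤ T ^ 2 :=
  pow_le_pow_left₀ (le_max_right _ _) (max_le (by linarith [one_le_bracket x]) hT) 2

lemma barrier_eq_zero {T : ℝ} {x : Plane} (hx : T ≤ ‖x‖) : barrier T x = 0 := by
  rw [barrier, max_eq_right (by linarith [norm_le_bracket x])]; norm_num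

lemma barrier_second_difference_le {T c : ℝ} (hc : 0 ≤ c) {x v : Plane}
    (h : (2 * c * (bracket x + ‖v‖) + c ^ 2 * ‖v‖ ^ 2) * bracket x ^ 2 ≤ 1) :
    barrier T (x + v) + barrier T (x - v) - 2 * barrier T x ≤
      2 * (1 - 2 * max (T - bracket x) 0 * c) * ‖v‖ ^ 2 := by
  have h1 := bracket_lower hc h
  have h2 := bracket_lower hc (x := x) (v := -v) (by rwa [norm_neg])
  have h3 := abs_bracket_sub_le x v
  have h4 := abs_bracket_sub_le x (-v)
  rw [norm_neg, ← sub_eq_add_neg] at h2 h4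
  rw [inner_neg_right, neg_div] at h2
  have h5 := max_sq_second_difference_le (a := T - bracket x) (d := c * ‖v‖ ^ 2) h3 h4 (by linarith)
  have e : ∀ y, T - bracket x - (bracket y - bracket x) = T - bracket y := fun y => by ring
  rw [e, e] at h5
  unfold barrier
  linarith

/-! ### The obstacle problem at a fixed scale -/

/-- The properties of the obstacle at a fixed scale that are uniform in the scale. -/
structure ObstacleBound (α r M : ℝ) (x₀ : Plane) (ρ : Plane → ℝ) (L T : ℝ) (n : ℕ) : Prop where
  good : GoodScale α r M n
  T_nonneg : 0 ≤ T
  lip : ∀ x v : Plane, |discPotential α r M x₀ ρ n (x + v) - discPotential α r M x₀ ρ n x| ≤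
    L * ‖v‖
  admissible : (fun z => discObstacle α r M x₀ ρ n z + 1 / discSigmaSq α r M n *
    barrier T (latticePt n z)) ∈ discAdmissible α r M x₀ ρ n

/-- The discrete Laplacian of the obstacle is `ρ - 1`. That of the barrier divided by `σ_n²` is at
most `1` everywhere, by convexity of the bracket, and at most `1 - B` on the ball of radius `R`
supporting `ρ`, where the convexity is strict and `T` is large. The sum is nonpositive. -/
theorem exists_obstacleBound {α r M : ℝ} (hp : Params α r M) (x₀ : Plane) {ρ : Plane → ℝ}
    {R B K : ℝ} (hs : SourceBound ρ R B K) :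
    ∃ L T, 0 ≤ L ∧ ∀ᶠ n in atTop, ObstacleBound α r M x₀ ρ L T n := by
  obtain ⟨L, hL, hlip⟩ := exists_discPotential_lipschitz hp hs x₀
  have hR := hs.R_nonneg
  have hB := hs.B_nonneg
  have hM := hp.M_pos
  obtain ⟨V, hV⟩ : ∃ V, V = 2 * (M + 3) := ⟨_, rfl⟩
  have hV0 : 0 ≤ V := by rw [hV]; positivity
  -- Chosen so that the hypothesis of `bracket_lower` holds whenever `‖x‖ ≤ R` and `‖v‖ ≤ V`, using
  -- `bracket x ≤ 1 + R` and `c² ≤ c`; `V` bounds every jump in the box.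
  obtain ⟨c, hc⟩ : ∃ c, c = 1 / ((1 + R) ^ 2 * (2 * (1 + R + V) + V ^ 2)) := ⟨_, rfl⟩
  have hc0 : 0 < c := by rw [hc]; positivity
  have hc1 : c ≤ 1 := by
    rw [hc, div_le_one (by positivity)]
    nlinarith [mul_nonneg hR hR, mul_nonneg hR hV0, mul_nonneg (mul_nonneg hR hR) hV0]
  have hc2 : c * ((1 + R) ^ 2 * (2 * (1 + R + V) + V ^ 2)) = 1 := by rw [hc]; field_simp
  -- With this `T` one has `T - bracket x ≥ B/(2c)` on the ball of radius `R`, so the strict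
  -- convexity there compensates `ρ ≤ B`.
  refine ⟨L, 1 + R + B / (2 * c), hL, ?_⟩
  filter_upwards [hlip, eventually_goodScale hp, eventually_discLap_discPotential hp hs x₀]
    with n h1 hn h2
  have hσ := discSigmaSq_pos hp hn
  refine ⟨hn, by positivity, h1, fun z => ?_, fun z => ?_⟩
  · have e : (fun w => discObstacle α r M x₀ ρ n w + 1 / discSigmaSq α r M n *
        barrier (1 + R + B / (2 * c)) (latticePt n w)) = fun w =>
        ((-(1 / discSigmaSq α r M n)) * ‖latticePt n w‖ ^ 2 +
          (-1) * discPotential α r M x₀ ρ n (latticePt n w)) + 1 / discSigmaSq α r M n *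
        barrier (1 + R + B / (2 * c)) (latticePt n w) := by
      funext w
      rw [discObstacle_eq]; ring
    rw [e, discLap_add hn, discLap_add hn, discLap_const_mul hn, discLap_const_mul hn,
      discLap_const_mul hn, discLap_normSq hn, h2 z]
    have hbar : ∀ d : ℝ, 0 ≤ d → (∀ v ∈ latBox M n, (2 * d * (bracket (latticePt n z) +
        ‖latticePt n v‖) + d ^ 2 * ‖latticePt n v‖ ^ 2) * bracket (latticePt n z) ^ 2 ≤ 1) →
        1 / discSigmaSq α r M n * discLap α r M n (fun w => barrier (1 + R + B / (2 * c))
          (latticePt n w)) z ≤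
          1 - 2 * max (1 + R + B / (2 * c) - bracket (latticePt n z)) 0 * d := by
      intro d hd h
      rw [one_div_mul_eq_div, div_le_iff₀ hσ]
      refine discLap_le_of_second_difference hp hn fun v hv => ?_
      rw [latticePt_add, latticePt_sub]
      exact barrier_second_difference_le hd (h v hv)
    have e2 : -(1 / discSigmaSq α r M n) * discSigmaSq α r M n = -1 := by field_simp
    rw [e2]
    rcases lt_or_ge R ‖latticePt n z‖ with hz | hz
    · rw [hs.supp _ hz]
      have := hbar 0 le_rfl (by simp)
      linarith
    · have hb1 := bracket_le (latticePt n z)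
      have hb2 := one_le_bracket (latticePt n z)
      have := hbar c hc0.le fun v hv => by
        have hv := norm_latticePt_le_of_mem_latBox hM.le hn.pos hv
        rw [← hV] at hv
        rw [← hc2]
        calc _ ≤ (2 * c * (1 + R + V) + c * 1 * V ^ 2) * (1 + R) ^ 2 := by
              rw [sq c]
              gcongr <;> linarith
          _ = _ := by ring
      have hm : B / (2 * c) ≤ max (1 + R + B / (2 * c) - bracket (latticePt n z)) 0 :=
        le_max_of_le_left (by linarith)
      have h3 : B ≤ 2 * max (1 + R + B / (2 * c) - bracket (latticePt n z)) 0 * c := by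
        rw [div_le_iff₀ (by positivity)] at hm
        linarith
      have := (abs_le.1 (hs.bound (latticePt n z))).2
      linarith
  · exact le_add_of_nonneg_right (mul_nonneg (by positivity) (barrier_nonneg _ _))

/-! ### Regularity and comparison for the discrete majorant. -/

section
variable {α r M : ℝ} {x₀ : Plane} {ρ : Plane → ℝ} {L T : ℝ} {n : ℕ}
  (h : ObstacleBound α r M x₀ ρ L T n)
include h

lemma ObstacleBound.isGLB (z : Idx) : IsGLB ((fun f => f z) '' discAdmissible α r M x₀ ρ n)
    (discMajorant α r M x₀ ρ n z) := by
  refine isGLB_csInf (Set.Nonempty.image _ ⟨_, h.admissible⟩) ⟨discObstacle α r M x₀ ρ n z, ?_⟩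
  rintro _ ⟨f, hf, rfl⟩
  exact hf.2 z

lemma ObstacleBound.majorant_le {f : Idx → ℝ} (hf : f ∈ discAdmissible α r M x₀ ρ n) (z : Idx) :
    discMajorant α r M x₀ ρ n z ≤ f z := (h.isGLB z).1 ⟨f, hf, rfl⟩

lemma ObstacleBound.obstacle_le (z : Idx) :
    discObstacle α r M x₀ ρ n z ≤ discMajorant α r M x₀ ρ n z := by
  refine (h.isGLB z).2 ?_
  rintro _ ⟨f, hf, rfl⟩
  exact hf.2 z

/-- The barrier vanishes beyond `T`, so obstacle and majorant touch there; the radius does not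
depend on the scale. -/
lemma ObstacleBound.majorant_eq {z : Idx} (hz : T ≤ ‖latticePt n z‖) :
    discMajorant α r M x₀ ρ n z = discObstacle α r M x₀ ρ n z := by
  refine le_antisymm ?_ (h.obstacle_le z)
  have := h.majorant_le h.admissible z
  simpa only [barrier_eq_zero hz, mul_zero, add_zero] using this

variable (hp : Params α r M)
include hp

lemma ObstacleBound.majorant_le_obstacle_add (z : Idx) :
    discMajorant α r M x₀ ρ n z ≤ discObstacle α r M x₀ ρ n z + 2 * T ^ 2 / sigmaSq α r M := by
  have hσ := hp.sigmaSq_pos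
  have h1 := (discSigmaSq_bounds hp h.good).1
  refine (h.majorant_le h.admissible z).trans ?_
  have h2 := barrier_le h.T_nonneg (latticePt n z)
  have h3 : 1 / discSigmaSq α r M n * barrier T (latticePt n z) ≤
      1 / (sigmaSq α r M / 2) * T ^ 2 := by
    have := barrier_nonneg T (latticePt n z)
    gcongr
  have e : 1 / (sigmaSq α r M / 2) * T ^ 2 = 2 * T ^ 2 / sigmaSq α r M := by field_simp
  linarith

/-- An infimum of superharmonic functions is superharmonic because the off-centre weights are
nonnegative. -/
lemma ObstacleBound.discLap_majorant_nonpos (z : Idx) :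
    discLap α r M n (discMajorant α r M x₀ ρ n) z ≤ 0 := by
  have hk : 0 ≤ ∑ v ∈ latBox M n, kern α r M n v :=
    Finset.sum_nonneg fun v _ => kern_nonneg hp h.good v
  set κ := ∑ v ∈ latBox M n, kern α r M n v with hκ
  have e : ∀ f : Idx → ℝ, discLap α r M n f z =
      (∑ v ∈ latBox M n, kern α r M n v * f (z + v)) - κ * f z := fun f => by
    rw [discLap_eq h.good, hκ, Finset.sum_mul, ← Finset.sum_sub_distrib]
    exact Finset.sum_congr rfl fun v _ => by ring
  have h1 : ∀ f ∈ discAdmissible α r M x₀ ρ n,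
      ∑ v ∈ latBox M n, kern α r M n v * discMajorant α r M x₀ ρ n (z + v) ≤ κ * f z := by
    intro f hf
    have h2 := hf.1 z
    rw [e] at h2
    have h3 : ∑ v ∈ latBox M n, kern α r M n v * discMajorant α r M x₀ ρ n (z + v) ≤
        ∑ v ∈ latBox M n, kern α r M n v * f (z + v) := Finset.sum_le_sum fun v _ =>
      mul_le_mul_of_nonneg_left (h.majorant_le hf _) (kern_nonneg hp h.good v)
    linarith
  rw [e, sub_nonpos]
  -- The infimum at `z` is only approached, so a near-minimiser is used; `κ + 1` avoids a division
  -- by zero.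
  refine le_of_forall_pos_le_add fun ε hε => ?_
  obtain ⟨_, ⟨f, hf, rfl⟩, hlt⟩ := (isGLB_lt_iff (h.isGLB z)).1
    (lt_add_of_pos_right (discMajorant α r M x₀ ρ n z) (div_pos hε (by linarith : 0 < κ + 1)))
  have h4 : κ * f z ≤ κ * (discMajorant α r M x₀ ρ n z + ε / (κ + 1)) :=
    mul_le_mul_of_nonneg_left hlt.le hk
  have h5 : κ * (ε / (κ + 1)) ≤ ε := by
    rw [mul_div_assoc', div_le_iff₀ (by linarith)]; nlinarith
  linarith [h1 f hf]

/-- Shifting the obstacle problem by a lattice vector. -/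
lemma ObstacleBound.majorant_sub_le (z w : Idx) :
    discMajorant α r M x₀ ρ n w - discMajorant α r M x₀ ρ n z ≤
      (L + 4 * ‖latticePt n z‖ / sigmaSq α r M) * ‖latticePt n w - latticePt n z‖ := by
  have hσ := hp.sigmaSq_pos
  have hσn := discSigmaSq_pos hp h.good
  have hb := (discSigmaSq_bounds hp h.good).1
  set v : Idx := w - z with hv
  have hvp : latticePt n w - latticePt n z = latticePt n v := (latticePt_sub n w z).symm
  rw [hvp]
  set y := latticePt n v with hy
  set σ := discSigmaSq α r M n with hσdef
  set k : ℝ := L * ‖y‖ - ‖y‖ ^ 2 / σ with hk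
  -- The translated majorant plus a discretely harmonic affine function. The linear part corrects
  -- the change of `|x|²/σ` under translation, and `k` absorbs the Lipschitz variation of the
  -- potential, so that `f` lies above the obstacle.
  set f : Idx → ℝ := fun u => (discMajorant α r M x₀ ρ n (u + -v) +
    (-(2 / σ)) * inner ℝ y (latticePt n u)) + (k + 2 / σ * ‖y‖ ^ 2) with hf
  have hadm : f ∈ discAdmissible α r M x₀ ρ n := by
    refine ⟨fun u => ?_, fun u => ?_⟩
    · rw [hf, discLap_add h.good, discLap_add h.good, discLap_const h.good,
        discLap_const_mul h.good, discLap_inner h.good, discLap_translate h.good]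
      linarith [h.discLap_majorant_nonpos hp (u + -v)]
    · have h1 := h.obstacle_le (u + -v)
      have h2 := (abs_le.1 (h.lip (latticePt n (u + -v)) y)).1
      have e1 : latticePt n (u + -v) = latticePt n u - y := by
        rw [latticePt_add, latticePt_neg, hy, sub_eq_add_neg]
      rw [discObstacle_eq] at h1 ⊢
      rw [e1] at h1 h2
      rw [sub_add_cancel] at h2
      rw [@norm_sub_sq_real] at h1
      rw [real_inner_comm] at h1
      simp only [hf, hk]
      have e2 : -((‖latticePt n u‖ ^ 2 - 2 * inner ℝ y (latticePt n u) + ‖y‖ ^ 2) / σ) =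
          -(‖latticePt n u‖ ^ 2 / σ) + 2 / σ * inner ℝ y (latticePt n u) - ‖y‖ ^ 2 / σ := by ring
      have e3 : 2 / σ * ‖y‖ ^ 2 = 2 * (‖y‖ ^ 2 / σ) := by ring
      linarith
  have h3 := h.majorant_le hadm w
  have e4 : w + -v = z := by rw [hv]; abel
  have e5 : latticePt n w = latticePt n z + y := by rw [← hvp]; abel
  simp only [hf, hk, e4, e5, inner_add_right, real_inner_self_eq_norm_sq] at h3
  have h4 : -(2 / σ) * inner ℝ y (latticePt n z) ≤
      4 * ‖latticePt n z‖ / sigmaSq α r M * ‖y‖ := by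
    have h5 := (abs_le.1 (abs_real_inner_le_norm y (latticePt n z))).1
    calc -(2 / σ) * inner ℝ y (latticePt n z) = 2 / σ * (-inner ℝ y (latticePt n z)) := by ring
      _ ≤ 2 / (sigmaSq α r M / 2) * (‖y‖ * ‖latticePt n z‖) := by
        refine (mul_le_mul_of_nonneg_left (by linarith) (by positivity) :
          _ ≤ 2 / σ * (‖y‖ * ‖latticePt n z‖)).trans ?_
        gcongr
      _ = _ := by field_simp; ring
  have e6 : 0 ≤ ‖y‖ ^ 2 / σ := by positivity
  have e7 : 2 / σ * ‖y‖ ^ 2 = 2 * (‖y‖ ^ 2 / σ) := by ring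
  have e8 : -(2 / σ) * (inner ℝ y (latticePt n z) + ‖y‖ ^ 2) =
    -(2 / σ) * inner ℝ y (latticePt n z) - 2 * (‖y‖ ^ 2 / σ) := by ring
  rw [e7, e8] at h3
  linarith

/-- A function that is superharmonic on a disc and lies above the obstacle in a neighbourhood of
the disc dominates the majorant on the disc. -/
lemma ObstacleBound.majorant_le_of_local {T' : ℝ} (hT : T ≤ T') {f : Idx → ℝ}
    (hf : ∀ z, ‖latticePt n z‖ < T' → discLap α r M n f z ≤ 0)
    (hγ : ∀ z, ‖latticePt n z‖ ≤ T' + 2 * (M + 3) → discObstacle α r M x₀ ρ n z ≤ f z)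
    {z : Idx} (hz : ‖latticePt n z‖ < T') : discMajorant α r M x₀ ρ n z ≤ f z := by
  have hM := hp.M_pos
  set s := discMajorant α r M x₀ ρ n with hs
  -- Gluing: in the collar outside the disc the majorant equals the obstacle and so lies below `f`.
  -- Hence `g ≤ f` at every point reached by a jump from inside, which preserves superharmonicity
  -- where `f` is the smaller function.
  set g : Idx → ℝ := fun w => if ‖latticePt n w‖ < T' then min (s w) (f w) else s w with hg
  have hgs : ∀ w, g w ≤ s w := fun w => by
    simp only [hg]; split_ifs
    · exact min_le_left _ _
    · exact le_rfl
  have hgf : ∀ w, ‖latticePt n w‖ ≤ T' + 2 * (M + 3) → g w ≤ f w := fun w hw => by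
    simp only [hg]; split_ifs with h1
    · exact min_le_right _ _
    · rw [hs, h.majorant_eq (by linarith)]; exact hγ w hw
  have hadm : g ∈ discAdmissible α r M x₀ ρ n := by
    refine ⟨fun w => ?_, fun w => ?_⟩
    · by_cases hw : ‖latticePt n w‖ < T' ∧ f w < s w
      · refine (discLap_mono hp h.good ?_ fun v hv => ?_).trans (hf w hw.1)
        · simp only [hg, if_pos hw.1, min_eq_right hw.2.le]
        · apply hgf
          have h1 := norm_latticePt_le_of_mem_latBox hM.le h.good.pos hv
          have h2 := norm_add_le (latticePt n w) (latticePt n v)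
          rw [latticePt_add]
          linarith [hw.1]
      · refine (discLap_mono hp h.good ?_ fun v _ => hgs _).trans (h.discLap_majorant_nonpos hp w)
        simp only [hg]
        split_ifs with h1
        · exact min_eq_left (not_lt.1 fun h2 => hw ⟨h1, h2⟩)
        · rfl
    · simp only [hg]
      split_ifs with h1
      · exact le_min (h.obstacle_le w) (hγ w (by linarith))
      · exact h.obstacle_le w
  exact (h.majorant_le hadm z).trans (hgf z (by linarith))

end

/-! ### Mollification of superharmonic functions -/

/-- The mollification of `f` by the kernel `κ`. -/
def mollify (κ f : Plane → ℝ) (x : Plane) : ℝ := ∫ u, f u * κ (x - u)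

section
variable {χ : Plane → ℝ} {R B K : ℝ} (hs : SourceBound χ R B K) {f : Plane → ℝ} (hf : Continuous f)
include hs

lemma SourceBound.comp_sub_left (x : Plane) : SourceBound (fun u => χ (x - u)) (‖x‖ + R) B K := by
  have hc := hs.cont
  refine ⟨by fun_prop, add_nonneg (norm_nonneg _) hs.R_nonneg, fun u hu => hs.supp _ ?_,
    fun u => hs.bound _, fun u y => ?_⟩
  · have := norm_sub_le x (x - u)
    rw [sub_sub_cancel] at this
    linarith
  · have := hs.second (x - u) y
    rwa [sub_add, sub_sub, add_comm (χ _)] at this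

lemma SourceBound.abs_second_le {W : ℝ} {u y : Plane} (hy : ‖y‖ ≤ W) :
    |χ (u + y) + χ (u - y) - 2 * χ u| ≤
      K * ‖y‖ ^ 2 * (Metric.ball (0 : Plane) (R + W + 1)).indicator (fun _ => 1) u := by
  by_cases hu : u ∈ Metric.ball (0 : Plane) (R + W + 1)
  · rw [Set.indicator_of_mem hu, mul_one]; exact hs.second u y
  · have h1 : R + W + 1 ≤ ‖u‖ := by simpa using hu
    have h2 := norm_sub_le (u + y) y
    have h3 := norm_add_le (u - y) y
    have h4 := norm_nonneg y
    rw [add_sub_cancel_right] at h2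
    rw [sub_add_cancel] at h3
    rw [Set.indicator_of_notMem hu, hs.supp _ (by linarith), hs.supp _ (by linarith),
      hs.supp _ (by linarith)]
    simp

include hf

omit hs in
lemma integrable_mul_indicator_ball (S : ℝ) :
    Integrable fun u => |f u| * (Metric.ball (0 : Plane) S).indicator (fun _ => 1) u := by
  have : IntegrableOn (fun u => |f u|) (Metric.ball (0 : Plane) S) :=
    (hf.abs.continuousOn.integrableOn_compact (isCompact_closedBall (0 : Plane) S)).mono_set
      Metric.ball_subset_closedBall
  refine (this.integrable_indicator Metric.isOpen_ball.measurableSet).congr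
    (Eventually.of_forall fun u => ?_)
  by_cases hu : u ∈ Metric.ball (0 : Plane) S
  · simp only [Set.indicator_of_mem hu, mul_one]
  · simp only [Set.indicator_of_notMem hu, mul_zero]

/-- Fubini holds because the second differences of `χ` are at most `K|y|²` and live in a ball fixed
for all `|y| < M`, which leaves the integrable weight `|y|^{-α}`. -/
lemma integral_second_difference_swap {α M : ℝ} (hα : 0 < α) (hα2 : α < 2) :
    ∫ y in Metric.ball (0 : Plane) M,
        (∫ u, f u * (χ (u + y) + χ (u - y) - 2 * χ u)) / ‖y‖ ^ (2 + α) =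
      ∫ u, f u * ∫ y in Metric.ball (0 : Plane) M,
        (χ (u + y) + χ (u - y) - 2 * χ u) / ‖y‖ ^ (2 + α) := by
  have hc := hs.cont
  have hswap := integral_integral_swap (μ := volume.restrict (Metric.ball (0 : Plane) M))
    (ν := (volume : Measure Plane))
    (f := fun y u => f u * (χ (u + y) + χ (u - y) - 2 * χ u) / ‖y‖ ^ (2 + α)) (by
    have hi := ((integrableOn_ball_rpow hα2 M).const_mul K).mul_prod
      (integrable_mul_indicator_ball hf (R + M + 1))
    refine hi.mono' ?_ ?_
    · exact Measurable.aestronglyMeasurable (Measurable.div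
        (Continuous.measurable (by fun_prop)) (by fun_prop))
    · have hball : ∀ᵐ p ∂((volume.restrict (Metric.ball (0 : Plane) M)).prod
          (volume : Measure Plane)), p.1 ∈ Metric.ball (0 : Plane) M :=
        Measure.quasiMeasurePreserving_fst.ae (ae_restrict_mem Metric.isOpen_ball.measurableSet)
      filter_upwards [hball] with p hpM
      have hy : ‖p.1‖ ≤ M := by simpa using (mem_ball_zero_iff.1 hpM).le
      have h1 := hs.abs_second_le (u := p.2) hy
      simp only [Function.uncurry]
      have hpos : 0 ≤ (Metric.ball (0 : Plane) (R + M + 1)).indicator (fun _ => (1 : ℝ)) p.2 :=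
        Set.indicator_nonneg (fun _ _ => zero_le_one) _
      rw [norm_div, norm_mul, Real.norm_of_nonneg (by positivity : 0 ≤ ‖p.1‖ ^ (2 + α)),
        Real.norm_eq_abs, Real.norm_eq_abs]
      rcases eq_or_ne p.1 0 with h0 | h0
      · rw [h0, norm_zero, Real.zero_rpow (by linarith), div_zero]
        rw [Real.zero_rpow (by linarith)]
        simp
      · have hn : 0 < ‖p.1‖ := norm_pos_iff.2 h0
        have e : ‖p.1‖ ^ (-α) = ‖p.1‖ ^ 2 / ‖p.1‖ ^ (2 + α) := by
          rw [eq_div_iff (by positivity), ← Real.rpow_add hn, ← Real.rpow_two]; congr 1; ring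
        rw [e]
        calc _ ≤ |f p.2| * (K * ‖p.1‖ ^ 2 *
              (Metric.ball (0 : Plane) (R + M + 1)).indicator (fun _ => 1) p.2) /
                ‖p.1‖ ^ (2 + α) := by gcongr
          _ = _ := by ring)
  simp only [← integral_div, ← integral_const_mul]
  rw [hswap]
  simp only [mul_div_assoc]

lemma integrable_mul_source : Integrable fun u => f u * χ u := hs.integrable_mul hf

lemma mollify_second_difference (x y : Plane) :
    mollify χ f (x + y) + mollify χ f (x - y) - 2 * mollify χ f x =
      ∫ u, f u * (χ (x - (u + y)) + χ (x - (u - y)) - 2 * χ (x - u)) := by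
  have h : ∀ v, Integrable fun u => f u * χ (v - u) := fun v =>
    integrable_mul_source (hs.comp_sub_left v) hf
  have e : ∀ u, f u * (χ (x - (u + y)) + χ (x - (u - y)) - 2 * χ (x - u)) =
      f u * χ (x + y - u) + f u * χ (x - y - u) - 2 * (f u * χ (x - u)) := fun u => by
    rw [show x - (u + y) = x - y - u by abel, show x - (u - y) = x + y - u by abel]; ring
  simp only [e]
  have h1 : Integrable fun u => f u * χ (x + y - u) + f u * χ (x - y - u) := (h _).add (h _)
  rw [integral_sub h1 ((h x).const_mul 2), integral_add (h _) (h _), integral_const_mul]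
  rfl

lemma exists_mollify_second_difference_bound (S W : ℝ) : ∃ C, ∀ x y : Plane, ‖x‖ ≤ S → ‖y‖ ≤ W →
    |mollify χ f (x + y) + mollify χ f (x - y) - 2 * mollify χ f x| ≤ C * ‖y‖ ^ 2 := by
  refine ⟨K * ∫ u, |f u| * (Metric.ball (0 : Plane) (S + R + W + 1)).indicator (fun _ => 1) u,
    fun x y hx hy => ?_⟩
  have hK := hs.K_nonneg
  rw [mollify_second_difference hs hf, mul_right_comm, ← integral_const_mul, ← Real.norm_eq_abs]
  refine norm_integral_le_of_norm_le ((integrable_mul_indicator_ball hf _).const_mul _)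
    (Eventually.of_forall fun u => ?_)
  rw [norm_mul]
  have h1 := (hs.comp_sub_left x).abs_second_le (u := u) hy
  have h2 : (Metric.ball (0 : Plane) (‖x‖ + R + W + 1)).indicator (fun _ => (1 : ℝ)) u ≤
      (Metric.ball (0 : Plane) (S + R + W + 1)).indicator (fun _ => 1) u :=
    Set.indicator_le_indicator_of_subset (Metric.ball_subset_ball (by linarith))
      (fun _ => zero_le_one) u
  calc _ ≤ |f u| * (K * ‖y‖ ^ 2 *
        (Metric.ball (0 : Plane) (S + R + W + 1)).indicator (fun _ => 1) u) := by
        refine mul_le_mul_of_nonneg_left (h1.trans ?_) (abs_nonneg _)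
        gcongr
    _ = _ := by ring

/-- By translation invariance and symmetry, `L_M` applied to the mollification at `x` is `f` tested
against `L_M` of `u ↦ χ(x - u)`, an admissible test function. -/
lemma truncLap_mollify_nonpos {α r M : ℝ} (hp : Params α r M)
    (hsh : IsSuperharmonicOn α r M f Set.univ) (hχ : ContDiff ℝ ∞ χ) (hχ0 : ∀ x, 0 ≤ χ x)
    (x : Plane) : truncLap α r M (mollify χ f) x ≤ 0 := by
  have hsx := hs.comp_sub_left x
  have h := hsh.2 (fun u => χ (x - u)) (hχ.comp (contDiff_const.sub contDiff_id))
    (HasCompactSupport.intro (isCompact_closedBall (0 : Plane) (‖x‖ + R)) fun u hu =>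
      hsx.supp u (by simpa using hu)) (fun u => hχ0 _) (Set.subset_univ _)
  refine le_trans (le_of_eq ?_) h
  rw [truncLap]
  simp only [mollify_second_difference hs hf]
  rw [integral_second_difference_swap hsx hf hp.α_pos hp.lt_two, ← integral_const_mul]
  refine integral_congr_ae (Eventually.of_forall fun u => ?_)
  simp only [truncLap]
  ring

end

/-- Continuous superharmonic functions are approximated, uniformly on a disc, by continuous
functions with bounded second differences on which the operator is nonpositive pointwise. -/
theorem exists_smooth_superharmonic {α r M : ℝ} (hp : Params α r M) {f : Plane → ℝ}
    (hf : Continuous f) (hsh : IsSuperharmonicOn α r M f Set.univ) (S : ℝ) {ε : ℝ} (hε : 0 < ε) :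
    ∃ g : Plane → ℝ, Continuous g ∧ (∀ x, ‖x‖ ≤ S → |g x - f x| ≤ ε) ∧
      (∀ x, truncLap α r M g x ≤ 0) ∧ ∃ C, ∀ x y : Plane, ‖x‖ ≤ S → ‖y‖ ≤ M + 1 →
        |g (x + y) + g (x - y) - 2 * g x| ≤ C * ‖y‖ ^ 2 := by
  have huc := (isCompact_closedBall (0 : Plane) (S + 1)).uniformContinuousOn_of_continuous
    hf.continuousOn
  obtain ⟨δ, hδ, hδf⟩ := Metric.uniformContinuousOn_iff.1 huc ε hε
  have hm : 0 < min δ 1 := lt_min hδ one_pos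
  -- Radius at most `δ` gives the error `ε`; radius at most `1` keeps the averaging inside the ball
  -- of radius `S + 1` where uniform continuity was taken.
  let b : ContDiffBump (0 : Plane) := ⟨min δ 1 / 2, min δ 1, by positivity, by linarith⟩
  have hb : ContDiff ℝ ∞ (b.normed volume) := b.contDiff_normed
  have hbc : HasCompactSupport (b.normed volume) := b.hasCompactSupport_normed
  obtain ⟨R, B, K, hs⟩ := exists_sourceBound (by exact_mod_cast contDiff_infty.1 hb 2) hbc
  have hconv : mollify (b.normed volume) f =
      convolution (b.normed volume) f (ContinuousLinearMap.lsmul ℝ ℝ) volume := by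
    funext x
    rw [convolution_eq_swap, mollify]
    exact integral_congr_ae (Eventually.of_forall fun u => by simp [mul_comm])
  refine ⟨mollify (b.normed volume) f, ?_, fun x hx => ?_, truncLap_mollify_nonpos hs hf hp hsh hb
    fun x => b.nonneg_normed x, exists_mollify_second_difference_bound hs hf S (M + 1)⟩
  · rw [hconv]
    exact hbc.continuous_convolution_left _ hb.continuous hf.locallyIntegrable
  · rw [hconv, ← Real.dist_eq]
    refine b.dist_normed_convolution_le hf.aestronglyMeasurable fun y hy => ?_
    have hy' : dist y x < min δ 1 := hy
    refine (hδf y ?_ x ?_ (hy'.trans_le (min_le_left _ _))).le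
    · have h1 := norm_le_norm_add_norm_sub' y x
      have h2 := hy'.trans_le (min_le_right _ _)
      rw [dist_eq_norm] at h2
      rw [mem_closedBall_zero_iff]
      linarith
    · rw [mem_closedBall_zero_iff]; linarith

/-! ### Passing to the limit along lattice points -/

/-- Compactness upgrades limits along convergent lattice points to a uniform bound on a disc:
offending points at arbitrarily fine scales would have a convergent subsequence. -/
lemma eventually_le_of_tendsto_along {F : ℕ → Idx → ℝ} {S a ε : ℝ} (hε : 0 < ε)
    (h : ∀ (φ : ℕ → ℕ) (z : ℕ → Idx) (x : Plane), Tendsto φ atTop atTop →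
      (∀ k, ‖latticePt (φ k) (z k)‖ ≤ S) →
      Tendsto (fun k => latticePt (φ k) (z k)) atTop (𝓝 x) →
      ∃ l ≤ a, Tendsto (fun k => F (φ k) (z k)) atTop (𝓝 l)) :
    ∀ᶠ n in atTop, ∀ z, ‖latticePt n z‖ ≤ S → F n z ≤ a + ε := by
  by_contra hcon
  obtain ⟨φ, hφ, hbad⟩ := extraction_of_frequently_atTop (not_eventually.1 hcon)
  push Not at hbad
  choose z hzS hz using hbad
  obtain ⟨x, -, ψ, hψ, hx⟩ := (isCompact_closedBall (0 : Plane) S).tendsto_subseq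
    (x := fun k => latticePt (φ k) (z k)) fun k => by simpa using hzS k
  obtain ⟨l, hl, hlim⟩ := h (φ ∘ ψ) (z ∘ ψ) x (hφ.tendsto_atTop.comp hψ.tendsto_atTop)
    (fun k => hzS _) hx
  have := ge_of_tendsto' hlim fun k => (hz (ψ k)).le
  linarith

/-! ### The asymptotic upper bound. -/

section
variable {α r M : ℝ} (hp : Params α r M) {x₀ : Plane} (hx₀ : x₀ ≠ 0) {ρ : Plane → ℝ} {R B K : ℝ}
  (hs : SourceBound ρ R B K)
include hp hx₀ hs

lemma tendsto_discObstacle {φ : ℕ → ℕ} (hφ : Tendsto φ atTop atTop) {z : ℕ → Idx} {x : Plane}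
    (hz : Tendsto (fun k => latticePt (φ k) (z k)) atTop (𝓝 x)) :
    Tendsto (fun k => discObstacle α r M x₀ ρ (φ k) (z k)) atTop
      (𝓝 (obstacle α r M x₀ ρ x)) :=
  (((hz.norm.pow 2).div ((tendsto_discSigmaSq hp).comp hφ) hp.sigmaSq_pos.ne').neg).sub
    (tendsto_discPotential hp hx₀ hs hφ hz)

/-- Every continuous superharmonic function above the obstacle is an asymptotic upper bound for
the discrete majorants. -/
theorem eventually_majorant_le {L T : ℝ} (hob : ∀ᶠ n in atTop, ObstacleBound α r M x₀ ρ L T n)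
    {f : Plane → ℝ} (hf : f ∈ admissible α r M x₀ ρ) {S ε : ℝ} (hε : 0 < ε) :
    ∀ᶠ n in atTop, ∀ z, ‖latticePt n z‖ < S →
      discMajorant α r M x₀ ρ n z ≤ f (latticePt n z) + ε := by
  obtain ⟨hfc, hsh, hfγ⟩ := hf
  have hM := hp.M_pos
  have hσ := hp.sigmaSq_pos
  obtain ⟨T', hT'⟩ : ∃ T', T' = max (max T S) 0 := ⟨_, rfl⟩
  have hTT' : T ≤ T' := by rw [hT']; exact (le_max_left _ _).trans (le_max_left _ _)
  have hST' : S ≤ T' := by rw [hT']; exact (le_max_right _ _).trans (le_max_left _ _)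
  have hT'0 : 0 ≤ T' := by rw [hT']; exact le_max_right _ _
  obtain ⟨W, hW⟩ : ∃ W, W = T' + 2 * (M + 3) := ⟨_, rfl⟩
  have hW0 : 0 < W := by rw [hW]; positivity
  obtain ⟨g, hgc, hgf, hgl, C, hgC⟩ := exists_smooth_superharmonic hp hfc hsh W
    (by positivity : 0 < ε / 5)
  -- Consistency gives only `L_n g ≤ η`. Subtracting `(η/σ_n)|x|²`, whose discrete Laplacian is `η`,
  -- restores superharmonicity; as `σ_n ≥ σ/2` in squared notation (`discSigmaSq_bounds`), this
  -- costs at most `ε/5` on the disc of radius `W`.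
  obtain ⟨η, hη⟩ : ∃ η, η = ε / 5 * (sigmaSq α r M / 2) / W ^ 2 := ⟨_, rfl⟩
  have hη0 : 0 < η := by rw [hη]; positivity
  have h1 : ∀ᶠ n in atTop, ∀ z, ‖latticePt n z‖ ≤ W →
      discLap α r M n (fun w => g (latticePt n w)) z ≤ 0 + η :=
    eventually_le_of_tendsto_along hη0 fun φ z x hφ hzW hz =>
      ⟨_, hgl x, tendsto_discLap hp hφ hz hgc fun k y hy => hgC _ y (hzW k) hy⟩
  have h2 : ∀ᶠ n in atTop, ∀ z, ‖latticePt n z‖ ≤ W →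
      discObstacle α r M x₀ ρ n z - g (latticePt n z) ≤ ε / 5 + ε / 5 :=
    eventually_le_of_tendsto_along (by positivity) fun φ z x hφ hzW hz => by
      refine ⟨_, ?_, (tendsto_discObstacle hp hx₀ hs hφ hz).sub ((hgc.tendsto x).comp hz)⟩
      have hxW : ‖x‖ ≤ W := le_of_tendsto' hz.norm hzW
      have h3 := (abs_le.1 (hgf x hxW)).1
      have h4 := hfγ x
      linarith
  filter_upwards [h1, h2, hob] with n h1 h2 h z hz
  have hσn := discSigmaSq_pos hp h.good
  have hσb := (discSigmaSq_bounds hp h.good).1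
  set σ := discSigmaSq α r M n with hσdef
  have hWn : ‖latticePt n z‖ ≤ W := by rw [hW]; linarith
  have key := h.majorant_le_of_local hp hTT'
    (f := fun w => (g (latticePt n w) + -(η / σ) * ‖latticePt n w‖ ^ 2) +
      (2 * (ε / 5) + η / σ * W ^ 2)) ?_ ?_ (hz.trans_le hST')
  · refine key.trans ?_
    have h3 := (abs_le.1 (hgf _ hWn)).2
    have h4 : η / σ * W ^ 2 ≤ ε / 5 := by
      rw [hη]
      calc _ ≤ ε / 5 * σ / W ^ 2 / σ * W ^ 2 := by gcongr
        _ = _ := by field_simp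
    have h5 : 0 ≤ η / σ * ‖latticePt n z‖ ^ 2 := by positivity
    linarith
  · intro w hw
    rw [discLap_add h.good, discLap_add h.good, discLap_const h.good, discLap_const_mul h.good,
      discLap_normSq h.good]
    have h3 := h1 w (by rw [hW]; linarith)
    have h4 : -(η / σ) * σ = -η := by field_simp
    rw [← hσdef, h4]
    linarith
  · intro w hw
    rw [← hW] at hw
    have h3 := h2 w hw
    have h4 : η / σ * ‖latticePt n w‖ ^ 2 ≤ η / σ * W ^ 2 := by gcongr
    linarith

end

/-! ### Uniform convergence from pointwise convergence -/

section
variable {α r M : ℝ} (hp : Params α r M) {x₀ : Plane} {ρ : Plane → ℝ} {L T : ℝ}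
include hp

lemma ObstacleBound.abs_latticeExt_sub_le {n : ℕ} (h : ObstacleBound α r M x₀ ρ L T n) (hL : 0 ≤ L)
    {S : ℝ} {x y : Plane} (hx : ‖x‖ ≤ S) (hy : ‖y‖ ≤ S) :
    |latticeExt n (discMajorant α r M x₀ ρ n) x - latticeExt n (discMajorant α r M x₀ ρ n) y| ≤
      (L + 4 * (S + 1) / sigmaSq α r M) * (‖x - y‖ + 2 * (1 / n)) := by
  have hσ := hp.sigmaSq_pos
  have hn : (1 : ℝ) ≤ n := by exact_mod_cast h.good.pos
  have hS : 0 ≤ S := (norm_nonneg x).trans hx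
  have hx1 := norm_sub_rp_le h.good.pos x
  have hy1 := norm_sub_rp_le h.good.pos y
  have hn1 : 1 / (n : ℝ) ≤ 1 := by rw [div_le_one (by linarith)]; exact hn
  have hd : ‖rp n x - rp n y‖ ≤ ‖x - y‖ + 2 * (1 / n) := by
    have e : rp n x - rp n y = (x - y) - (x - rp n x) + (y - rp n y) := by abel
    rw [e]
    have h1 := norm_add_le ((x - y) - (x - rp n x)) (y - rp n y)
    have h2 := norm_sub_le (x - y) (x - rp n x)
    linarith
  have hb : ∀ v : Plane, ‖v‖ ≤ S → ‖v - rp n v‖ ≤ 1 / n → ‖rp n v‖ ≤ S + 1 := fun v h1 h2 => by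
    have := norm_sub_le v (v - rp n v)
    rw [sub_sub_cancel] at this
    linarith
  have key : ∀ u v : Plane, ‖u‖ ≤ S → ‖u - rp n u‖ ≤ 1 / n →
      ‖rp n v - rp n u‖ ≤ ‖x - y‖ + 2 * (1 / n) →
      latticeExt n (discMajorant α r M x₀ ρ n) v - latticeExt n (discMajorant α r M x₀ ρ n) u ≤
      (L + 4 * (S + 1) / sigmaSq α r M) * (‖x - y‖ + 2 * (1 / n)) := by
    intro u v hu hu1 huv
    have h3 := hb u hu hu1
    refine (h.majorant_sub_le hp (rnd n u) (rnd n v)).trans ?_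
    change (L + 4 * ‖rp n u‖ / sigmaSq α r M) * ‖rp n v - rp n u‖ ≤ _
    gcongr
  rw [abs_le]
  have h1 := key x y hx hx1 (by rwa [norm_sub_rev])
  have h2 := key y x hy hy1 hd
  constructor <;> linarith

variable (hL : 0 ≤ L) (hob : ∀ᶠ n in atTop, ObstacleBound α r M x₀ ρ L T n) {U : Filter ℕ}
  (hU : U ≤ atTop) {σ : Plane → ℝ}
  (hσ : ∀ x, Tendsto (fun n => latticeExt n (discMajorant α r M x₀ ρ n) x) U (𝓝 (σ x)))
include hL hob hU hσ

lemma abs_limit_sub_le [U.NeBot] {S : ℝ} {x y : Plane} (hx : ‖x‖ ≤ S) (hy : ‖y‖ ≤ S) :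
    |σ x - σ y| ≤ (L + 4 * (S + 1) / sigmaSq α r M) * ‖x - y‖ := by
  have h1 : Tendsto (fun n : ℕ => (L + 4 * (S + 1) / sigmaSq α r M) * (‖x - y‖ + 2 * (1 / (n : ℝ))))
      U (𝓝 ((L + 4 * (S + 1) / sigmaSq α r M) * (‖x - y‖ + 2 * 0))) :=
    (((tendsto_one_div_atTop_nhds_zero_nat.mono_left hU).const_mul 2).const_add _).const_mul _
  rw [mul_zero, add_zero] at h1
  refine le_of_tendsto_of_tendsto ((hσ x).sub (hσ y)).abs h1 ?_
  filter_upwards [hU hob] with n hn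
  exact hn.abs_latticeExt_sub_le hp hL hx hy

lemma continuous_limit [U.NeBot] : Continuous σ := by
  refine continuous_iff_continuousAt.2 fun x => continuousAt_of_locally_lipschitz one_pos
    (L + 4 * (‖x‖ + 1 + 1) / sigmaSq α r M) fun y hy => ?_
  rw [Real.dist_eq, dist_eq_norm]
  refine abs_limit_sub_le hp hL hob hU hσ ?_ (by linarith)
  have h1 := norm_le_norm_add_norm_sub' y x
  rw [dist_eq_norm] at hy
  linarith

/-- The extensions are step functions, hence Lipschitz only up to an error of order `1/n`; this
asymptotic equicontinuity with a finite `δ`-net suffices. -/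
theorem tendstoUniformlyOn_of_tendsto [U.NeBot] {A : Set Plane} (hA : IsCompact A) :
    TendstoUniformlyOn (fun n => latticeExt n (discMajorant α r M x₀ ρ n)) σ U A := by
  rw [Metric.tendstoUniformlyOn_iff]
  intro ε hε
  obtain ⟨S, hS⟩ := hA.isBounded.subset_closedBall 0
  have hSn : ∀ x ∈ A, ‖x‖ ≤ S := fun x hx => by simpa using hS hx
  have hpos := hp.sigmaSq_pos
  rcases A.eq_empty_or_nonempty with rfl | ⟨a, ha⟩
  · simp
  have hS0 : 0 ≤ S := (norm_nonneg a).trans (hSn a ha)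
  obtain ⟨Λ, hΛ⟩ : ∃ Λ, Λ = L + 4 * (S + 1) / sigmaSq α r M := ⟨_, rfl⟩
  have hΛ0 : 0 ≤ Λ := by rw [hΛ]; positivity
  obtain ⟨δ, hδ⟩ : ∃ δ, δ = ε / (4 * (Λ + 1)) := ⟨_, rfl⟩
  have hδ0 : 0 < δ := by rw [hδ]; positivity
  have hΛδ : Λ * δ ≤ ε / 4 := by
    rw [hδ, mul_div_assoc', div_le_iff₀ (by positivity)]
    have e : ε / 4 * (4 * (Λ + 1)) = Λ * ε + ε := by ring
    linarith
  obtain ⟨t, htA, htf, hcov⟩ := hA.finite_cover_balls hδ0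
  have h1 : ∀ᶠ n in U, ∀ p ∈ t, |latticeExt n (discMajorant α r M x₀ ρ n) p - σ p| < ε / 4 := by
    rw [htf.eventually_all]
    intro p _
    exact (Metric.tendsto_nhds.1 (hσ p)) (ε / 4) (by positivity)
  have h2 : ∀ᶠ n : ℕ in U, Λ * (2 * (1 / (n : ℝ))) < ε / 4 := by
    have : Tendsto (fun n : ℕ => Λ * (2 * (1 / (n : ℝ)))) U (𝓝 (Λ * (2 * 0))) :=
      ((tendsto_one_div_atTop_nhds_zero_nat.mono_left hU).const_mul 2).const_mul _
    rw [mul_zero, mul_zero] at this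
    exact this.eventually_lt_const (by positivity)
  filter_upwards [h1, h2, hU hob] with n h1 h2 hn x hx
  obtain ⟨p, hp', hxp⟩ := Set.mem_iUnion₂.1 (hcov hx)
  rw [mem_ball_iff_norm] at hxp
  have h3 := hn.abs_latticeExt_sub_le hp hL (hSn x hx) (hSn p (htA hp'))
  have h4 := abs_limit_sub_le hp hL hob hU hσ (hSn x hx) (hSn p (htA hp'))
  have h5 := h1 p hp'
  rw [← hΛ] at h3 h4
  have h6 : Λ * ‖x - p‖ ≤ ε / 4 := (mul_le_mul_of_nonneg_left hxp.le hΛ0).trans hΛδ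
  rw [mul_add] at h3
  rw [Real.dist_eq, abs_sub_comm]
  rw [abs_lt] at h5 ⊢
  rw [abs_le] at h3 h4
  constructor <;> linarith [h3.1, h3.2, h4.1, h4.2, h5.1, h5.2]

end

/-! ### Superharmonicity of the limits -/

/-- Self-adjointness follows from translating the sum by each jump and from the symmetry of the
rates. Finite support of `b` alone makes all sums converge. -/
lemma tsum_mul_discLap {α r M : ℝ} {n : ℕ} (hn : GoodScale α r M n) (a b : Idx → ℝ)
    (hb : (Function.support b).Finite) :
    ∑' z, a z * discLap α r M n b z = ∑' z, discLap α r M n a z * b z := by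
  have hsum : ∀ (c : Idx → ℝ) (v : Idx), Summable fun z => c z * b (z + v) := fun c v => by
    refine summable_of_hasFiniteSupport ((hb.preimage (add_left_injective v).injOn).subset ?_)
    intro z hz
    exact fun h => hz (by simp only [h, mul_zero])
  have hsum0 : ∀ c : Idx → ℝ, Summable fun z => c z * b z := fun c => by simpa using hsum c 0
  have hshift : ∀ v, ∑' z, a z * b (z + v) = ∑' z, a (z + -v) * b z := fun v => by
    rw [← (Equiv.addRight v).tsum_eq fun z => a (z + -v) * b z]
    simp
  have hneg : ∑ v ∈ latBox M n, kern α r M n v * ∑' z, a (z + -v) * b z =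
      ∑ v ∈ latBox M n, kern α r M n v * ∑' z, a (z + v) * b z := by
    rw [latBox, ← sum_idxBox_neg]
    simp only [kern_neg, neg_neg]
  have e1 : ∀ z, a z * discLap α r M n b z = ∑ v ∈ latBox M n,
      (kern α r M n v * (a z * b (z + v)) - kern α r M n v * (a z * b z)) := fun z => by
    rw [discLap_eq hn, Finset.mul_sum]
    exact Finset.sum_congr rfl fun v _ => by ring
  have e2 : ∀ z, discLap α r M n a z * b z = ∑ v ∈ latBox M n,
      (kern α r M n v * (a (z + v) * b z) - kern α r M n v * (a z * b z)) := fun z => by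
    rw [discLap_eq hn, Finset.sum_mul]
    exact Finset.sum_congr rfl fun v _ => by ring
  rw [tsum_congr e1, tsum_congr e2,
    Summable.tsum_finsetSum fun v _ => ((hsum a v).mul_left _).sub ((hsum0 a).mul_left _),
    Summable.tsum_finsetSum fun v _ =>
      ((hsum0 fun z => a (z + v)).mul_left _).sub ((hsum0 a).mul_left _)]
  have e3 : ∀ v, ∑' z, (kern α r M n v * (a z * b (z + v)) - kern α r M n v * (a z * b z)) =
      kern α r M n v * ∑' z, a (z + -v) * b z - kern α r M n v * ∑' z, a z * b z := fun v => by
    rw [Summable.tsum_sub ((hsum a v).mul_left _) ((hsum0 a).mul_left _), tsum_mul_left,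
      tsum_mul_left, hshift]
  have e4 : ∀ v, ∑' z, (kern α r M n v * (a (z + v) * b z) - kern α r M n v * (a z * b z)) =
      kern α r M n v * ∑' z, a (z + v) * b z - kern α r M n v * ∑' z, a z * b z := fun v => by
    rw [Summable.tsum_sub ((hsum0 fun z => a (z + v)).mul_left _) ((hsum0 a).mul_left _),
      tsum_mul_left, tsum_mul_left]
  rw [Finset.sum_congr rfl fun v _ => e3 v, Finset.sum_congr rfl fun v _ => e4 v,
    Finset.sum_sub_distrib, Finset.sum_sub_distrib, hneg]

section
variable {α r M : ℝ} (hp : Params α r M) {χ : Plane → ℝ} {R B K : ℝ} (hs : SourceBound χ R B K)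
include hp hs

lemma abs_discLap_source_le {n : ℕ} (hn : GoodScale α r M n) (z : Idx) :
    |discLap α r M n (fun w => χ (latticePt n w)) z| ≤ K * sigmaSq α r M := by
  have hK := hs.K_nonneg
  have h1 : ∀ e : ℝ, |e| = 1 → e * discLap α r M n (fun w => χ (latticePt n w)) z ≤
      K * sigmaSq α r M := by
    intro e he
    rw [← discLap_const_mul hn]
    refine (discLap_le_of_second_difference hp hn (b := K / 2) fun v _ => ?_).trans ?_
    · have h2 := hs.second (latticePt n z) (latticePt n v)
      rw [← latticePt_add, ← latticePt_sub] at h2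
      calc _ = e * (χ (latticePt n (z + v)) + χ (latticePt n (z - v)) - 2 * χ (latticePt n z)) := by
            ring
        _ ≤ |e * (χ (latticePt n (z + v)) + χ (latticePt n (z - v)) - 2 * χ (latticePt n z))| :=
          le_abs_self _
        _ ≤ _ := by rw [abs_mul, he, one_mul]; linarith
    · have h3 := (discSigmaSq_bounds hp hn).2
      calc K / 2 * discSigmaSq α r M n ≤ K / 2 * (2 * sigmaSq α r M) := by gcongr
        _ = _ := by ring
  rw [abs_le]
  constructor
  · linarith [h1 (-1) (by norm_num)]
  · linarith [h1 1 (by norm_num)]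

lemma discLap_source_eq_zero {n : ℕ} (hn : GoodScale α r M n) {z : Idx}
    (hz : R + 2 * (M + 3) < ‖latticePt n z‖) :
    discLap α r M n (fun w => χ (latticePt n w)) z = 0 := by
  have hM := hp.M_pos
  rw [discLap_eq hn]
  refine Finset.sum_eq_zero fun v hv => ?_
  have h1 := norm_latticePt_le_of_mem_latBox hM.le hn.pos hv
  have h2 := norm_sub_le (latticePt n z + latticePt n v) (latticePt n v)
  rw [add_sub_cancel_right] at h2
  rw [latticePt_add, hs.supp _ (by linarith), hs.supp _ (by linarith [norm_nonneg (latticePt n v)])]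
  simp

lemma abs_discLap_rnd_le {n : ℕ} (hn : GoodScale α r M n) (y : Plane) :
    |discLap α r M n (fun w => χ (latticePt n w)) (rnd n y)| ≤
      (Metric.ball (0 : Plane) (R + 2 * (M + 3) + 2)).indicator
        (fun _ => K * sigmaSq α r M) y := by
  have hn1 : (1 : ℝ) ≤ n := by exact_mod_cast hn.pos
  by_cases hy : y ∈ Metric.ball (0 : Plane) (R + 2 * (M + 3) + 2)
  · rw [Set.indicator_of_mem hy]; exact abs_discLap_source_le hp hs hn _
  · rw [Set.indicator_of_notMem hy, discLap_source_eq_zero hp hs hn, abs_zero]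
    have h1 : R + 2 * (M + 3) + 2 ≤ ‖y‖ := by simpa using hy
    have h2 := norm_sub_rp_le hn.pos y
    have h3 : 1 / (n : ℝ) ≤ 1 := by rw [div_le_one (by linarith)]; exact hn1
    have h4 := norm_sub_norm_le y (rp n y)
    change _ < ‖rp n y‖
    linarith

lemma tendsto_integral_mul_discLap {σ : Plane → ℝ} (hσ : Continuous σ) :
    Tendsto (fun n => ∫ y, σ y * discLap α r M n (fun w => χ (latticePt n w)) (rnd n y)) atTop
      (𝓝 (∫ y, σ y * truncLap α r M χ y)) := by
  obtain ⟨D, hD⟩ : ∃ D, D = R + 2 * (M + 3) + 2 := ⟨_, rfl⟩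
  have hi := (integrable_mul_indicator_ball hσ D).mul_const (K * sigmaSq α r M)
  refine tendsto_integral_filter_of_dominated_convergence _ ?_ ?_ hi ?_
  · exact Eventually.of_forall fun n => (hσ.measurable.mul
      (measurable_comp_rnd n _)).aestronglyMeasurable
  · filter_upwards [eventually_goodScale hp] with n hn
    refine Eventually.of_forall fun y => ?_
    rw [norm_mul, mul_assoc]
    refine mul_le_mul_of_nonneg_left ((abs_discLap_rnd_le hp hs hn y).trans (le_of_eq ?_))
      (norm_nonneg _)
    rw [← hD]
    by_cases hy : y ∈ Metric.ball (0 : Plane) D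
    · simp only [Set.indicator_of_mem hy, one_mul]
    · simp only [Set.indicator_of_notMem hy, zero_mul]
  · refine Eventually.of_forall fun y => Tendsto.const_mul _ ?_
    exact tendsto_discLap hp (φ := id) tendsto_id (z := fun n => rnd n y)
      (rp_tendsto tendsto_id y) hs.cont fun k v _ => hs.second _ v

end

section
variable {α r M : ℝ} (hp : Params α r M) {x₀ : Plane} {ρ : Plane → ℝ} {L T : ℝ}
include hp

/-- Summation by parts moves the operator onto `s_n`, where it is nonpositive, against a nonnegative
weight. -/
lemma ObstacleBound.integral_majorant_mul_nonpos {n : ℕ} (h : ObstacleBound α r M x₀ ρ L T n)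
    {χ : Plane → ℝ} {R B K : ℝ} (hs : SourceBound χ R B K) (hχ : ∀ x, 0 ≤ χ x) :
    ∫ y, latticeExt n (discMajorant α r M x₀ ρ n) y *
      discLap α r M n (fun w => χ (latticePt n w)) (rnd n y) ≤ 0 := by
  have hn := h.good.pos
  have hz : ∀ z ∉ latBox (R + 2 * (M + 3)) n, discMajorant α r M x₀ ρ n z *
      discLap α r M n (fun w => χ (latticePt n w)) z = 0 := fun z hz => by
    rw [discLap_source_eq_zero hp hs h.good, mul_zero]
    by_contra hcon
    exact hz (mem_latBox_of_norm_le hn (by linarith))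
  have e := sum_lattice_eq_integral hn (latBox (R + 2 * (M + 3)) n)
    (fun z => discMajorant α r M x₀ ρ n z * discLap α r M n (fun w => χ (latticePt n w)) z) hz
  have e' : ∑' z, discMajorant α r M x₀ ρ n z * discLap α r M n (fun w => χ (latticePt n w)) z =
      ∑ z ∈ latBox (R + 2 * (M + 3)) n, discMajorant α r M x₀ ρ n z *
        discLap α r M n (fun w => χ (latticePt n w)) z := tsum_eq_sum hz
  simp only [latticeExt_eq]
  rw [← e, ← e', tsum_mul_discLap h.good]
  · refine mul_nonpos_of_nonneg_of_nonpos (by positivity) (tsum_nonpos fun z => ?_)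
    exact mul_nonpos_of_nonpos_of_nonneg (h.discLap_majorant_nonpos hp z) (hχ _)
  · refine (latBox R n).finite_toSet.subset fun w hw => ?_
    by_contra hcon
    exact hw (source_eq_zero hs hn (by linarith) hcon)

/-- Discrete Laplacians of a test function are bounded and supported in a fixed ball, uniformly in
the scale. Locally uniform convergence of `s_n` therefore passes the inequality `∫ s_n L_n χ ≤ 0` to
the limit. -/
theorem isSuperharmonicOn_limit (hL : 0 ≤ L)
    (hob : ∀ᶠ n in atTop, ObstacleBound α r M x₀ ρ L T n) {U : Filter ℕ} [U.NeBot]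
    (hU : U ≤ atTop) {σ : Plane → ℝ}
    (hσ : ∀ x, Tendsto (fun n => latticeExt n (discMajorant α r M x₀ ρ n) x) U (𝓝 (σ x))) :
    IsSuperharmonicOn α r M σ Set.univ := by
  have hc := continuous_limit hp hL hob hU hσ
  refine ⟨hc.locallyIntegrable, fun χ hχ hχc hχ0 _ => ?_⟩
  obtain ⟨R, B, K, hs⟩ := exists_sourceBound (by exact_mod_cast contDiff_infty.1 hχ 2) hχc
  have hK := hs.K_nonneg
  have hpos := hp.sigmaSq_pos
  obtain ⟨D, hD⟩ : ∃ D, D = R + 2 * (M + 3) + 2 := ⟨_, rfl⟩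
  -- `E` bounds the `L¹` norm of the discrete Laplacian of `χ`, so a uniform error `ε/(E+1)` in the
  -- majorant costs at most `ε` in the pairing.
  obtain ⟨E, hE⟩ : ∃ E, E = volume.real (Metric.ball (0 : Plane) D) * (K * sigmaSq α r M) :=
    ⟨_, rfl⟩
  have hE0 : 0 ≤ E := by rw [hE]; positivity
  have hlim := (tendsto_integral_mul_discLap hp hs hc).mono_left hU
  refine le_of_forall_pos_le_add fun ε hε => ?_
  rw [zero_add]
  refine le_of_tendsto hlim ?_
  have hunif := Metric.tendstoUniformlyOn_iff.1 (tendstoUniformlyOn_of_tendsto hp hL hob hU hσ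
    (isCompact_closedBall (0 : Plane) D)) (ε / (E + 1)) (by positivity)
  filter_upwards [hunif, hU hob] with n hn h
  set l : Plane → ℝ := fun y => discLap α r M n (fun w => χ (latticePt n w)) (rnd n y) with hl
  have hlm : Measurable l := measurable_comp_rnd n _
  have hlb : ∀ y, |l y| ≤ (Metric.ball (0 : Plane) D).indicator (fun _ => K * sigmaSq α r M) y :=
    fun y => by rw [hD]; exact abs_discLap_rnd_le hp hs h.good y
  have hsm : Measurable (latticeExt n (discMajorant α r M x₀ ρ n)) := measurable_comp_rnd n _
  have hdiff : ∀ y, ‖(σ y - latticeExt n (discMajorant α r M x₀ ρ n) y) * l y‖ ≤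
      (Metric.ball (0 : Plane) D).indicator
        (fun _ => ε / (E + 1) * (K * sigmaSq α r M)) y := by
    intro y
    have h1 := hlb y
    rw [norm_mul]
    by_cases hy : y ∈ Metric.ball (0 : Plane) D
    · rw [Set.indicator_of_mem hy] at h1 ⊢
      have h2 := hn y (Metric.ball_subset_closedBall hy)
      rw [Real.dist_eq] at h2
      exact mul_le_mul h2.le h1 (abs_nonneg _) (by positivity)
    · rw [Set.indicator_of_notMem hy] at h1 ⊢
      rw [abs_nonpos_iff.1 h1]; simp
  have hi1 : Integrable fun y => (σ y - latticeExt n (discMajorant α r M x₀ ρ n) y) * l y :=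
    (integrable_indicator_ball D _).mono'
      ((hc.measurable.sub hsm).mul hlm).aestronglyMeasurable (Eventually.of_forall hdiff)
  have hi2 : Integrable fun y => σ y * l y := by
    refine ((integrable_mul_indicator_ball hc D).mul_const (K * sigmaSq α r M)).mono'
      (hc.measurable.mul hlm).aestronglyMeasurable (Eventually.of_forall fun y => ?_)
    rw [norm_mul, mul_assoc]
    refine mul_le_mul_of_nonneg_left ((hlb y).trans (le_of_eq ?_)) (norm_nonneg _)
    by_cases hy : y ∈ Metric.ball (0 : Plane) D
    · simp only [Set.indicator_of_mem hy, one_mul]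
    · simp only [Set.indicator_of_notMem hy, zero_mul]
  have hle : ∫ y, (σ y - latticeExt n (discMajorant α r M x₀ ρ n) y) * l y ≤ ε := by
    refine (le_abs_self _).trans ((norm_integral_le_of_norm_le (integrable_indicator_ball D _)
      (Eventually.of_forall hdiff)).trans ?_)
    rw [integral_indicator Metric.isOpen_ball.measurableSet, setIntegral_const, smul_eq_mul,
      mul_left_comm, ← hE, div_mul_eq_mul_div, div_le_iff₀ (by positivity)]
    nlinarith
  have hint := h.integral_majorant_mul_nonpos hp hs hχ0
  have e : ∀ y, latticeExt n (discMajorant α r M x₀ ρ n) y * l y =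
      σ y * l y - (σ y - latticeExt n (discMajorant α r M x₀ ρ n) y) * l y := fun y => by ring
  change ∫ y, latticeExt n (discMajorant α r M x₀ ρ n) y * l y ≤ 0 at hint
  rw [integral_congr_ae (Eventually.of_forall e), integral_sub hi2 hi1] at hint
  linarith

end

/-! ### The convergence theorem -/

section
variable {α r M : ℝ} (hp : Params α r M) {x₀ : Plane} (hx₀ : x₀ ≠ 0) {ρ : Plane → ℝ} {R B K : ℝ}
  (hs : SourceBound ρ R B K)
include hp hx₀ hs

/-- Along every ultrafilter, the discrete majorants converge to the least element of the set of
continuous superharmonic functions above the obstacle. -/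
theorem exists_ultrafilter_limit {L T : ℝ} (hL : 0 ≤ L)
    (hob : ∀ᶠ n in atTop, ObstacleBound α r M x₀ ρ L T n) (U : Ultrafilter ℕ)
    (hU : (U : Filter ℕ) ≤ atTop) : ∃ σ ∈ admissible α r M x₀ ρ,
      (∀ f ∈ admissible α r M x₀ ρ, ∀ x, σ x ≤ f x) ∧
      ∀ x, Tendsto (fun n => latticeExt n (discMajorant α r M x₀ ρ n) x) U (𝓝 (σ x)) := by
  have hγ : ∀ x, Tendsto (fun n => discObstacle α r M x₀ ρ n (rnd n x)) atTop
      (𝓝 (obstacle α r M x₀ ρ x)) := fun x =>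
    tendsto_discObstacle hp hx₀ hs (φ := id) tendsto_id (rp_tendsto tendsto_id x)
  -- The majorant lies between the obstacle and the obstacle plus a constant, and obstacles
  -- converge. So its values stay in a compact interval, and the ultrafilter gives limits at all
  -- points at once, without extracting subsequences.
  have hex : ∀ x, ∃ l, Tendsto (fun n => latticeExt n (discMajorant α r M x₀ ρ n) x) U (𝓝 l) := by
    intro x
    have hmem : ∀ᶠ n in (U : Filter ℕ), latticeExt n (discMajorant α r M x₀ ρ n) x ∈
        Set.Icc (obstacle α r M x₀ ρ x - 1)
          (obstacle α r M x₀ ρ x + 1 + 2 * T ^ 2 / sigmaSq α r M) := by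
      refine hU ?_
      filter_upwards [hob, (hγ x).eventually_lt_const (lt_add_one _),
        (hγ x).eventually_const_lt (sub_one_lt _)] with n hn h1 h2
      have h3 := hn.obstacle_le (rnd n x)
      have h4 := hn.majorant_le_obstacle_add hp (rnd n x)
      rw [latticeExt_eq]
      constructor <;> linarith
    obtain ⟨l, -, hl⟩ := isCompact_Icc.ultrafilter_le_nhds
      (U.map fun n => latticeExt n (discMajorant α r M x₀ ρ n) x) (le_principal_iff.2 hmem)
    exact ⟨l, hl⟩
  choose σ hσ using hex
  refine ⟨σ, ⟨continuous_limit hp hL hob hU hσ, isSuperharmonicOn_limit hp hL hob hU hσ,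
    fun x => ?_⟩, fun f hf x => ?_, hσ⟩
  · refine le_of_tendsto_of_tendsto ((hγ x).mono_left hU) (hσ x) (hU ?_)
    filter_upwards [hob] with n hn
    exact hn.obstacle_le _
  · refine le_of_forall_pos_le_add fun ε hε => ?_
    have h1 : Tendsto (fun n => f (rp n x) + ε) atTop (𝓝 (f x + ε)) :=
      ((hf.1.tendsto x).comp (rp_tendsto (φ := id) tendsto_id x)).add_const ε
    refine le_of_tendsto_of_tendsto (hσ x) (h1.mono_left hU) (hU ?_)
    filter_upwards [eventually_majorant_le hp hx₀ hs hob hf (S := ‖x‖ + 1) hε,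
      (rp_tendsto (φ := id) tendsto_id x).norm.eventually_lt_const (lt_add_one ‖x‖)] with n h2 h3
    exact h2 _ h3

/-- Each ultrafilter limit is a least admissible function, so all of them equal `s`, which forces
convergence. Nonemptiness of the continuum admissible class is itself witnessed by such a limit. -/
theorem majorant_isLeast_and_tendsto {L T : ℝ} (hL : 0 ≤ L)
    (hob : ∀ᶠ n in atTop, ObstacleBound α r M x₀ ρ L T n) :
    (∀ x, IsGLB ((fun f => f x) '' admissible α r M x₀ ρ) (majorant α r M x₀ ρ x)) ∧
    ∀ x, Tendsto (fun n => latticeExt n (discMajorant α r M x₀ ρ n) x) atTop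
      (𝓝 (majorant α r M x₀ ρ x)) := by
  have hleast : ∀ σ ∈ admissible α r M x₀ ρ, (∀ f ∈ admissible α r M x₀ ρ, ∀ x, σ x ≤ f x) →
      ∀ x, IsLeast ((fun f => f x) '' admissible α r M x₀ ρ) (σ x) := fun σ hσ h x =>
    ⟨⟨σ, hσ, rfl⟩, by rintro _ ⟨f, hf, rfl⟩; exact h f hf x⟩
  refine ⟨fun x => ?_, fun x => ?_⟩
  · obtain ⟨σ, hσ, h, -⟩ := exists_ultrafilter_limit hp hx₀ hs hL hob (hyperfilter ℕ)
      Nat.hyperfilter_le_atTop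
    have h1 := (hleast σ hσ h x).isGLB
    rwa [majorant, h1.csInf_eq ⟨_, σ, hσ, rfl⟩]
  · rw [tendsto_iff_ultrafilter]
    intro U hU
    obtain ⟨σ, hσ, h, hlim⟩ := exists_ultrafilter_limit hp hx₀ hs hL hob U hU
    have h1 := (hleast σ hσ h x).isGLB
    rw [majorant, h1.csInf_eq ⟨_, σ, hσ, rfl⟩]
    exact hlim x

end

end Sandpile

end

/-- Locally uniform convergence of the discrete least superharmonic majorants. The first conjuncts
say that the objects involved are well defined; the last one is the convergence. -/
theorem mainTheorem4 (α r M : ℝ) (hα : 1 < α) (hα' : α < 2) (hr : 0 < r) (hrM : r < M)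
    (hk : 0 < Sandpile.nnConst α r M 1)
    (x₀ : Sandpile.Plane) (hx₀ : ‖x₀‖ = 1)
    (ρ : Sandpile.Plane → ℝ) (hρ : ContDiff ℝ 2 ρ) (hρc : HasCompactSupport ρ)
    (hρ0 : ∀ x, 0 ≤ ρ x) :
    (0 < Sandpile.limConst α r M ∧
      Tendsto (Sandpile.normConst α r M) atTop (𝓝 (Sandpile.limConst α r M))) ∧
    (∀ᶠ n : ℕ in atTop, ∀ x : Sandpile.Plane,
      IntegrableOn (fun θ => (Real.cos (inner ℝ θ x) - Real.cos (inner ℝ θ x₀)) /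
        Sandpile.discSymbol α r M n θ) (Sandpile.freqSquare n)) ∧
    (∀ x : Sandpile.Plane, x ≠ 0 →
      Tendsto (fun R : ℝ => Sandpile.cutoffGreen α r M x₀ R x) atTop
        (𝓝 (Sandpile.green α r M x₀ x))) ∧
    (∀ x, Integrable (fun y => Sandpile.green α r M x₀ (x - y) * ρ y)) ∧
    (∀ᶠ n : ℕ in atTop, ∀ z : Sandpile.Idx,
      IsGLB ((fun f => f z) '' Sandpile.discAdmissible α r M x₀ ρ n)
        (Sandpile.discMajorant α r M x₀ ρ n z)) ∧
    (∀ x, IsGLB ((fun f => f x) '' Sandpile.admissible α r M x₀ ρ)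
        (Sandpile.majorant α r M x₀ ρ x)) ∧
    ∀ K : Set Sandpile.Plane, IsCompact K →
      TendstoUniformlyOn
        (fun n : ℕ => Sandpile.latticeExt n (Sandpile.discMajorant α r M x₀ ρ n))
        (Sandpile.majorant α r M x₀ ρ) atTop K := by
  have hp : Sandpile.Params α r M := ⟨hα, hα', hr, hrM⟩
  have hx : x₀ ≠ 0 := by
    rintro rfl
    simp at hx₀
  obtain ⟨R, B, K, hs⟩ := Sandpile.exists_sourceBound hρ hρc
  obtain ⟨L, T, hL, hob⟩ := Sandpile.exists_obstacleBound hp x₀ hs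
  obtain ⟨hglb, hlim⟩ := Sandpile.majorant_isLeast_and_tendsto hp hx hs hL hob
  exact ⟨⟨hp.limConst_pos, hp.tendsto_normConst⟩,
    Sandpile.eventually_integrableOn_discGreen hp x₀,
    fun x hx' => Sandpile.tendsto_cutoffGreen hp hx hx',
    Sandpile.integrable_green_mul hp hx hs,
    hob.mono fun n hn => hn.isGLB, hglb,
    fun A hA => Sandpile.tendstoUniformlyOn_of_tendsto hp hL hob le_rfl hlim hA⟩
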